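/- **Setting.** Let $d\ge 1$, $k\ge 0$ be integers and $p\in(1,2]$. A *polytope* of $\mathbb R^d$ is a nonempty connected set which is the interior of a finite union of closed $d$-simplices. Let $\Omega\subset\mathbb R^d$ be a polytope and $\mathcal M_h=(\mathcal T_h,\mathcal F_h)$ a polytopal mesh of $\Omega$: $\mathcal T_h$ is a finite set of disjoint polytopes with $\overline\Omega=\bigcup_{T\in\mathcal T_h}\overline T$; $\mathcal F_h$ is a finite set of disjoint nonempty connected relatively open subsets $F\subset\overline\Omega$ of hyperplanes, $\overline F\setminus F$ having zero $(d-1)$-dimensional measure; each $F$ is contained either in $\partial T_1\cap\partial T_2$ for two distinct elements or in $\partial T\cap\partial\Omega$ for some element $T$; and $\bigcup_{T}\partial T=\bigcup_F\overline F$. Write $h_X$ for the diameter of $X$ and $\mathcal F_T=\{F\in\mathcal F_h: F\subset\partial T\}$; for $F\in\mathcal F_T$ there is a constant unit vector $n_{TF}$ normal to $F$ and pointing out of $T$. If $d=1$, where faces are points, $h_F$ is replaced by $h_T$ in the norm below. The mesh is assumed regular with parameter $\varrho\in(0,1)$: there is a matching simplicial submesh (a finite conforming triangulation of $\Omega$ in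 which each open simplex is contained in an element and each open simplicial face is contained in or disjoint from any given mesh face) such that each simplex $\tau$ contains a ball of radius $\varrho h_\tau$, and $\varrho h_T\le h_\tau$ whenever $\tau\subset T\in\mathcal T_h$. **HHO space.** With $\mathbb P^l(X)$ the restrictions to $X$ of polynomials of total degree $\le l$, set $\underline U_h^k=\{((v_T)_{T\in\mathcal T_h},(v_F)_{F\in\mathcal F_h}): v_T\in\mathbb P^k(T),\ v_F\in\mathbb P^k(F)\}$ and $$\|\underline v_h\|_{1,p,h}^p=\sum_{T\in\mathcal T_h}\Big(\|\nabla v_T\|_{L^p(T)^d}^p+\sum_{F\in\mathcal F_T}h_F^{1-p}\|v_F-v_T\|_{L^p(F)}^p\Big).$$ Let $\pi_X^l$ be the $L^2$-orthogonal projector on $\mathbb P^l(X)$. For $T\in\mathcal T_h$, $G_T\underline v_T\in\mathbb P^k(T)^d$ is defined by $\int_T G_T\underline v_T\cdot\tau=\int_T\nabla v_T\cdot\tau+\sum_{F\in\mathcal F_T}\int_F(v_F-v_T)\,\tau\cdot n_{TF}$ for all $\tau\in\mathbb P^k(T)^d$; $r_T\underline v_T\in\mathbb P^{k+1}(T)$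 by $\int_T(\nabla r_T\underline v_T-G_T\underline v_T)\cdot\nabla w=0$ for all $w\in\mathbb P^{k+1}(T)$ and $\int_T r_T\underline v_T=\int_T v_T$; and $\Delta_{\partial T}\underline v_T$ by $(\Delta_{\partial T}\underline v_T)_{|F}=h_T^{-1}\big[\pi_F^k(r_T\underline v_T-v_F)-\pi_T^k(r_T\underline v_T-v_T)\big]$ for $F\in\mathcal F_T$. **Flux.** Let $\sigma:\Omega\times\mathbb R^d\to\mathbb R^d$ be such that $\sigma(\cdot,\xi)$ is measurable for all $\xi$, $\sigma(x,0)=0$ for a.e. $x\in\Omega$, and, for some $0\le\delta\in L^p(\Omega)$ and $\sigma_{hc},\sigma_{sm}>0$, for a.e. $x\in\Omega$ and all $\tau,\eta\in\mathbb R^d$, $$|\sigma(x,\tau)-\sigma(x,\eta)|\le\sigma_{hc}(\delta(x)^p+|\tau|^p+|\eta|^p)^{\frac{p-2}p}|\tau-\eta|,$$ $$(\sigma(x,\tau)-\sigma(x,\eta))\cdot(\tau-\eta)\ge\sigma_{sm}(\delta(x)^p+|\tau|^p+|\eta|^p)^{\frac{p-2}p}|\tau-\eta|^2,$$ the right-hand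 sides being $0$ when $\delta(x)^p+|\tau|^p+|\eta|^p=0$. **Stabilization.** Let $0\le\zeta$ be a function on $\bigcup_F\overline F$ with $\zeta_{|F}\in L^p(F)$ for all $F$, $\|\zeta\|_{L^p(\partial\mathcal M_h)}^p=\sum_T h_T\sum_{F\in\mathcal F_T}\|\zeta\|_{L^p(F)}^p$, and let $c_{hc},c_{sm}>0$. For each $T$ let $S_T:\partial T\times\mathbb R\to\mathbb R$ be measurable and such that, for a.e. $x\in\partial T$ and all $v,w\in\mathbb R$, $S_T(x,0)=0$ and (same convention) $$|S_T(x,w)-S_T(x,v)|\le c_{hc}\,\sigma_{hc}(\zeta(x)^p+|w|^p+|v|^p)^{\frac{p-2}p}|w-v|,$$ $$(S_T(x,w)-S_T(x,v))(w-v)\ge c_{sm}\,\sigma_{sm}(\zeta(x)^p+|w|^p+|v|^p)^{\frac{p-2}p}|w-v|^2.$$ Set $$a_h(\underline w_h,\underline v_h)=\sum_{T\in\mathcal T_h}\Big(\int_T\sigma(\cdot,G_T\underline w_T)\cdot G_T\underline v_T+h_T\int_{\partial T}S_T(\cdot,\Delta_{\partial T}\underline w_T)\,\Delta_{\partial T}\underline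 v_T\Big).$$ **Lemma 1 (strong monotonicity of $a_h$).** There is a real number $C>0$ depending only on $d,k,p,\varrho,c_{sm}$ (so independent of $h$, the mesh, $\Omega$, $\sigma$, $\delta$, $\sigma_{hc}$, $\sigma_{sm}$, $\zeta$, $c_{hc}$ and the functions $S_T$) such that, for all $\underline v_h,\underline w_h\in\underline U_h^k$, with $\underline e_h=\underline v_h-\underline w_h$, $$\|\underline e_h\|_{1,p,h}^2\le C\,\sigma_{sm}^{-1}\Big(\|\delta\|_{L^p(\Omega)}^p+\|\zeta\|_{L^p(\partial\mathcal M_h)}^p+\|\underline v_h\|_{1,p,h}^p+\|\underline w_h\|_{1,p,h}^p\Big)^{\frac{2-p}p}\big(a_h(\underline v_h,\underline e_h)-a_h(\underline w_h,\underline e_h)\big).$$ -/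

import Mathlib

open MeasureTheory Filter Topology

noncomputable section

namespace HHO

/-- The ambient Euclidean space `ℝ^d`. -/
abbrev E (d : ℕ) : Type := EuclideanSpace ℝ (Fin d)

/-! ### Geometry: polytopes, polytopal meshes, regularity -/

/-- The open simplex (relative interior of the convex hull) with vertex set `s`. For a single
vertex this is the vertex itself. -/
def openSimplex {d : ℕ} (s : Finset (E d)) : Set (E d) :=
  {x | ∃ w : E d → ℝ, (∀ y ∈ s, 0 < w y) ∧ ∑ y ∈ s, w y = 1 ∧ ∑ y ∈ s, w y • y = x}

/-- A polytope of `ℝ^d`: a (nonempty) connected set which is the interior of a finite union of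
closed `d`-simplices. It is in particular open and bounded. -/
def IsPolytope {d : ℕ} (X : Set (E d)) : Prop :=
  IsConnected X ∧
  ∃ S : Finset (Finset (E d)),
    (∀ s ∈ S, s.card = d + 1 ∧ AffineIndependent ℝ ((↑) : s → E d)) ∧
    X = interior (⋃ s ∈ S, convexHull ℝ (s : Set (E d)))

/-- `n` is the unit vector normal to the face `F` and pointing out of `T`. -/
def IsOutwardNormal {d : ℕ} (T F : Set (E d)) (n : E d) : Prop :=
  ‖n‖ = 1 ∧ (∀ x ∈ F, ∀ y ∈ F, inner ℝ (y - x) n = 0) ∧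
  ∀ᵐ x ∂((μHE[d - 1] : Measure (E d)).restrict F),
    ∀ᶠ t : ℝ in 𝓝[>] 0, x - t • n ∈ T ∧ x + t • n ∉ T

/-- A polytopal mesh of `Ω`: finitely many polytopal elements and finitely many hyperplanar
faces, the measure on faces being the `(d-1)`-dimensional surface measure. -/
structure PolytopalMesh (d : ℕ) (Ω : Set (E d)) where
  /-- the mesh elements -/
  elems : Finset (Set (E d))
  /-- the mesh faces -/
  faces : Finset (Set (E d))
  elem_polytope : ∀ T ∈ elems, IsPolytope T
  elem_disjoint : ∀ T₁ ∈ elems, ∀ T₂ ∈ elems, T₁ ≠ T₂ → Disjoint T₁ T₂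
  closure_eq : closure Ω = ⋃ T ∈ elems, closure T
  face_subset : ∀ F ∈ faces, F ⊆ closure Ω
  face_connected : ∀ F ∈ faces, IsConnected F
  /-- each face is a relatively open subset of a hyperplane -/
  face_hyperplane : ∀ F ∈ faces, ∃ H : AffineSubspace ℝ (E d),
    Module.finrank ℝ H.direction + 1 = d ∧ ∃ U : Set (E d), IsOpen U ∧ F = U ∩ (H : Set (E d))
  face_boundary_null : ∀ F ∈ faces, (μHE[d - 1] : Measure (E d)) (closure F \ F) = 0
  face_disjoint : ∀ F₁ ∈ faces, ∀ F₂ ∈ faces, F₁ ≠ F₂ → Disjoint F₁ F₂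
  /-- each face is an interface or a boundary face -/
  face_type : ∀ F ∈ faces,
    (∃ T₁ ∈ elems, ∃ T₂ ∈ elems, T₁ ≠ T₂ ∧ F ⊆ frontier T₁ ∩ frontier T₂) ∨
    (∃ T ∈ elems, F ⊆ frontier T ∩ frontier Ω)
  /-- the faces partition the mesh skeleton -/
  skeleton_eq : ⋃ T ∈ elems, frontier T = ⋃ F ∈ faces, closure F
  /-- an element has a constant unit outward normal on each of its faces -/
  exists_normal : ∀ T ∈ elems, ∀ F ∈ faces, F ⊆ frontier T → ∃ n : E d, IsOutwardNormal T F n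

namespace PolytopalMesh

variable {d : ℕ} {Ω : Set (E d)}

open Classical in
/-- `F_T`: the faces that lie on the boundary of the element `T`. -/
def facesOf (M : PolytopalMesh d Ω) (T : M.elems) : Finset M.faces :=
  Finset.univ.filter fun F => F.1 ⊆ frontier T.1

open Classical in
/-- The constant unit vector `n_{TF}` normal to `F` and pointing out of `T`, for `F ∈ F_T`. -/
def normal (M : PolytopalMesh d Ω) (T : M.elems) (F : M.faces) : E d :=
  if h : F.1 ⊆ frontier T.1 then (M.exists_normal T.1 T.2 F.1 F.2 h).choose else 0

/-- `h_T`, the diameter of `T`. -/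
def hT (M : PolytopalMesh d Ω) (T : M.elems) : ℝ := Metric.diam T.1

/-- The length `h_F` used in the local norm on `T`: the diameter of `F`. In dimension one faces
are points, and `h_T` plays the role of `h_F`. -/
def hF (M : PolytopalMesh d Ω) (T : M.elems) (F : M.faces) : ℝ :=
  if d = 1 then M.hT T else Metric.diam F.1

/-- `K` is a matching simplicial submesh of `M`: a finite conforming triangulation of `Ω` such
that each open simplex is contained in a mesh element and each open simplicial face is either
disjoint from or contained in any given mesh face. -/
structure IsMatchingSimplicialSubmesh (M : PolytopalMesh d Ω)
    (K : Geometry.SimplicialComplex ℝ (E d)) : Prop where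
  finite : K.faces.Finite
  pure : ∀ s ∈ K.faces, ∃ t ∈ K.faces, s ⊆ t ∧ t.card = d + 1
  space_eq : K.space = closure Ω
  simplex_subset : ∀ τ ∈ K.faces, τ.card = d + 1 → ∃ T ∈ M.elems, openSimplex τ ⊆ T
  face_compat : ∀ σ ∈ K.faces, σ.card = d → ∀ F ∈ M.faces,
    Disjoint (openSimplex σ) F ∨ openSimplex σ ⊆ F

/-- The mesh `M` is regular with regularity parameter `ρ`: it has a matching simplicial submesh
whose simplices `τ` are shape regular (`ρ h_τ ≤ r_τ`, i.e. `τ` contains a ball of radius `ρ h_τ`)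
and contact regular (`ρ h_T ≤ h_τ` whenever `τ ⊆ T`). -/
def IsRegular (M : PolytopalMesh d Ω) (ρ : ℝ) : Prop :=
  ∃ K : Geometry.SimplicialComplex ℝ (E d), M.IsMatchingSimplicialSubmesh K ∧
    (∀ τ ∈ K.faces, τ.card = d + 1 →
      ∃ x : E d, Metric.ball x (ρ * Metric.diam (openSimplex τ)) ⊆ openSimplex τ) ∧
    (∀ T : M.elems, ∀ τ ∈ K.faces, τ.card = d + 1 → openSimplex τ ⊆ T.1 →
      ρ * M.hT T ≤ Metric.diam (openSimplex τ))

end PolytopalMesh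

/-! ### Polynomials and projectors -/

/-- Real polynomials in `d` variables. -/
abbrev Poly (d : ℕ) : Type := MvPolynomial (Fin d) ℝ

/-- The value of a polynomial at a point. -/
def pval {d : ℕ} (q : Poly d) (x : E d) : ℝ := MvPolynomial.eval (fun i => x i) q

/-- The value of a vector of polynomials at a point. -/
def vval {d : ℕ} (q : Fin d → Poly d) (x : E d) : E d := WithLp.toLp 2 fun i => pval (q i) x

/-- The gradient of a polynomial. -/
def grad {d : ℕ} (q : Poly d) : Fin d → Poly d := fun i => MvPolynomial.pderiv i q

/-- `P^l(T)` for a mesh element `T`: polynomials of total degree at most `l`. As `T` is open and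
nonempty, they are identified with their restrictions to `T`. -/
abbrev ElemPoly (d l : ℕ) : Submodule ℝ (Poly d) := MvPolynomial.restrictTotalDegree (Fin d) ℝ l

/-- Restriction of a polynomial to `F`, extended by zero outside `F`. -/
def restrictTo {d : ℕ} (F : Set (E d)) : Poly d →ₗ[ℝ] (E d → ℝ) where
  toFun q := F.indicator (pval q)
  map_add' q r := by
    classical
    funext x
    by_cases hx : x ∈ F <;> simp [hx, pval]
  map_smul' c q := by
    classical
    funext x
    by_cases hx : x ∈ F <;> simp [hx, pval]

/-- `P^l(F)` for a mesh face `F`: restrictions to `F` of polynomials of total degree at most `l`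
(a function on `F` being identified with its extension by zero). -/
def FacePoly {d : ℕ} (l : ℕ) (F : Set (E d)) : Submodule ℝ (E d → ℝ) :=
  (ElemPoly d l).map (restrictTo F)

/-- Surface measure on the face `F`. -/
def surf {d : ℕ} (F : Set (E d)) : Measure (E d) := (μHE[d - 1] : Measure (E d)).restrict F

/-- The `L²`-orthogonal projection of `f` on `P^l(T)`: the unique solution of the defining
equations. -/
def projElem {d : ℕ} (l : ℕ) (T : Set (E d)) (f : E d → ℝ) : Poly d :=
  Classical.epsilon fun q => q ∈ ElemPoly d l ∧
    ∀ w ∈ ElemPoly d l, ∫ x in T, (pval q x - f x) * pval w x = 0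

/-- The `L²`-orthogonal projection of `f` on `P^l(F)`: the unique solution of the defining
equations. -/
def projFace {d : ℕ} (l : ℕ) (F : Set (E d)) (f : E d → ℝ) : E d → ℝ :=
  Classical.epsilon fun q => q ∈ FacePoly l F ∧
    ∀ w ∈ FacePoly l F, ∫ x, (q x - f x) * w x ∂(surf F) = 0

/-- The norm of `L^q(μ)`, for functions in that space. -/
def normL {d : ℕ} {V : Type*} [NormedAddCommGroup V] (q : ℝ) (f : E d → V)
    (μ : Measure (E d)) : ℝ :=
  (∫ x, ‖f x‖ ^ q ∂μ) ^ (1 / q)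

/-! ### The hybrid space, its seminorm and the local reconstructions -/

/-- The HHO space: families `((v_T)_T, (v_F)_F)` with `v_T ∈ P^k(T)` and `v_F ∈ P^k(F)`. -/
abbrev Space {d : ℕ} {Ω : Set (E d)} (M : PolytopalMesh d Ω) (k : ℕ) : Type :=
  (M.elems → ElemPoly d k) × ((F : M.faces) → FacePoly k F.1)

section

variable {d : ℕ} {Ω : Set (E d)} {M : PolytopalMesh d Ω} {k : ℕ}

/-- The element component `v_T`. -/
def elemPart (v : Space M k) (T : M.elems) : Poly d := (v.1 T : Poly d)

/-- The face component `v_F`. -/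
def facePart (v : Space M k) (F : M.faces) : E d → ℝ := (v.2 F : E d → ℝ)

/-- The local seminorm `‖v_T‖_{1,q,T}`. -/
def localNorm (q : ℝ) (v : Space M k) (T : M.elems) : ℝ :=
  (normL q (vval (grad (elemPart v T))) (volume.restrict T.1) ^ q +
    ∑ F ∈ M.facesOf T, M.hF T F ^ (1 - q) *
      normL q (fun x => facePart v F x - pval (elemPart v T) x) (surf F.1) ^ q) ^ (1 / q)

/-- The global seminorm `‖v_h‖_{1,q,h}`. -/
def globalNorm (q : ℝ) (v : Space M k) : ℝ :=
  (∑ T : M.elems, localNorm q v T ^ q) ^ (1 / q)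

/-- The gradient reconstruction `G_T^k v_T ∈ P^k(T)^d`: the unique solution of
`∫_T G·τ = ∫_T ∇v_T·τ + ∑_{F ∈ F_T} ∫_F (v_F - v_T) (τ·n_{TF})` for all `τ ∈ P^k(T)^d`. -/
def gradRec (v : Space M k) (T : M.elems) : Fin d → Poly d :=
  Classical.epsilon fun G => (∀ i, G i ∈ ElemPoly d k) ∧
    ∀ τ : Fin d → Poly d, (∀ i, τ i ∈ ElemPoly d k) →
      ∫ x in T.1, inner ℝ (vval G x) (vval τ x) =
        (∫ x in T.1, inner ℝ (vval (grad (elemPart v T)) x) (vval τ x)) +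
        ∑ F ∈ M.facesOf T, ∫ x, (facePart v F x - pval (elemPart v T) x) *
          inner ℝ (vval τ x) (M.normal T F) ∂(surf F.1)

/-- The potential reconstruction `r_T^{k+1} v_T ∈ P^{k+1}(T)`: the unique solution of
`∫_T (∇r - G_T^k v_T)·∇w = 0` for all `w ∈ P^{k+1}(T)` and `∫_T r = ∫_T v_T`. -/
def potRec (v : Space M k) (T : M.elems) : Poly d :=
  Classical.epsilon fun r => r ∈ ElemPoly d (k + 1) ∧
    (∀ w ∈ ElemPoly d (k + 1),
      ∫ x in T.1, inner ℝ (vval (grad r) x - vval (gradRec v T) x) (vval (grad w) x) = 0) ∧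
    ∫ x in T.1, pval r x = ∫ x in T.1, pval (elemPart v T) x

/-- The restriction to the face `F ∈ F_T` of the boundary residual of `v_T`:
`h_T⁻¹ [π_F^k (r_T^{k+1} v_T - v_F) - π_T^k (r_T^{k+1} v_T - v_T)]`. -/
def bdryRes (v : Space M k) (T : M.elems) (F : M.faces) (x : E d) : ℝ :=
  1 / M.hT T *
    (projFace k F.1 (fun y => pval (potRec v T) y - facePart v F y) x -
      pval (projElem k T.1 (fun y => pval (potRec v T) y - pval (elemPart v T) y)) x)

/-- The local stabilization function `s_T(w_T, v_T)` built on `S_T`; the integral over the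
boundary of `T` is the sum of the integrals over the faces of `T`. -/
def stab (S : M.elems → E d → ℝ → ℝ) (w v : Space M k) (T : M.elems) : ℝ :=
  M.hT T * ∑ F ∈ M.facesOf T, ∫ x, S T x (bdryRes w T F x) * bdryRes v T F x ∂(surf F.1)

/-- The discrete diffusion function `a_h(w_h, v_h)`. -/
def diffusion (σ : E d → E d → E d) (S : M.elems → E d → ℝ → ℝ) (w v : Space M k) : ℝ :=
  ∑ T : M.elems,
    ((∫ x in T.1, inner ℝ (σ x (vval (gradRec w T) x)) (vval (gradRec v T) x)) + stab S w v T)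

/-- The norm of `L^p` on the mesh skeleton:
`(∑_T h_T ∑_{F ∈ F_T} ‖ζ‖_{L^p(F)}^p)^{1/p}`. -/
def skeletonNorm (M : PolytopalMesh d Ω) (p : ℝ) (ζ : E d → ℝ) : ℝ :=
  (∑ T : M.elems, M.hT T * ∑ F ∈ M.facesOf T, normL p ζ (surf F.1) ^ p) ^ (1 / p)

end

/-! ### Assumptions on the flux and on the stabilization -/

/-- The assumption on the flux function `σ`, with degeneracy function `δ` and constants
`σhc, σsm`. (When `δ(x)^p + |τ|^p + |η|^p = 0` one has `τ = η`, and both inequalities reduce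
to `0 ≤ 0`, i.e. their singular right-hand sides are extended by zero.) -/
structure FluxAssumption {d : ℕ} (Ω : Set (E d)) (p : ℝ) (σ : E d → E d → E d) (δ : E d → ℝ)
    (σhc σsm : ℝ) : Prop where
  hc_pos : 0 < σhc
  sm_pos : 0 < σsm
  degeneracy_memLp : MemLp δ (ENNReal.ofReal p) (volume.restrict Ω)
  degeneracy_nonneg : ∀ᵐ x ∂(volume.restrict Ω), 0 ≤ δ x
  zero : ∀ᵐ x ∂(volume.restrict Ω), σ x 0 = 0
  measurable : ∀ ξ : E d, AEMeasurable (fun x => σ x ξ) (volume.restrict Ω)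
  continuity : ∀ᵐ x ∂(volume.restrict Ω), ∀ τ η : E d,
    ‖σ x τ - σ x η‖ ≤ σhc * (δ x ^ p + ‖τ‖ ^ p + ‖η‖ ^ p) ^ ((p - 2) / p) * ‖τ - η‖
  monotonicity : ∀ᵐ x ∂(volume.restrict Ω), ∀ τ η : E d,
    σsm * (δ x ^ p + ‖τ‖ ^ p + ‖η‖ ^ p) ^ ((p - 2) / p) * ‖τ - η‖ ^ 2 ≤
      inner ℝ (σ x τ - σ x η) (τ - η)

/-- The assumption on the functions `S_T : ∂T × ℝ → ℝ` defining the local stabilizations, with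
degeneracy function `ζ` on the skeleton; `chc` and `csm` are the multiplicative constants hidden
in its two inequalities. The boundary of `T` is covered, up to a null set, by the faces of `T`.
Measurability is only asked of the sections `S_T(·, w)`. -/
structure StabAssumption {d : ℕ} {Ω : Set (E d)} (M : PolytopalMesh d Ω) (p : ℝ)
    (S : M.elems → E d → ℝ → ℝ) (ζ : E d → ℝ) (chc csm σhc σsm : ℝ) : Prop where
  degeneracy_memLp : ∀ F : M.faces, MemLp ζ (ENNReal.ofReal p) (surf F.1)
  degeneracy_nonneg : ∀ F : M.faces, ∀ᵐ x ∂(surf F.1), 0 ≤ ζ x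
  measurable : ∀ T : M.elems, ∀ F ∈ M.facesOf T, ∀ w : ℝ,
    AEMeasurable (fun x => S T x w) (surf F.1)
  continuity : ∀ T : M.elems, ∀ F ∈ M.facesOf T, ∀ᵐ x ∂(surf F.1), ∀ v w : ℝ,
    |S T x w - S T x v| ≤
      chc * (σhc * (ζ x ^ p + |w| ^ p + |v| ^ p) ^ ((p - 2) / p) * |w - v|)
  monotonicity : ∀ T : M.elems, ∀ F ∈ M.facesOf T, ∀ᵐ x ∂(surf F.1), ∀ v w : ℝ,
    csm * (σsm * (ζ x ^ p + |w| ^ p + |v| ^ p) ^ ((p - 2) / p) * |w - v| ^ 2) ≤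
      (S T x w - S T x v) * (w - v)
  zero : ∀ T : M.elems, ∀ F ∈ M.facesOf T, ∀ᵐ x ∂(surf F.1), S T x 0 = 0

end HHO

end

/-! ### Polynomials of bounded degree and inverse estimates on balls -/

namespace HHO

/-! Write e for the difference of two arguments, D for `δ ^ p` plus the p-th powers of their norms,
and Y for the monotonicity product divided by its constant. The hypothesis reads D^((p-2)/p) |e|^2 ≤
Y, so |e|^p ≤ Y^(p/2) D^(1-p/2). A Hölder argument over all elements (for the gradients) and all
faces (for the boundary residuals) bounds the L^p size of the pair (G_T e, Δ_∂T e) by the gap of a_h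
to the power p/2 times the total of D to the power 1-p/2, and the power 2/p gives the claim. What
remains is that the size of this pair, `pairNorm`, is equivalent to the norm of the hybrid space:
one direction recovers the norm of e, the other bounds the total of D.

This equivalence is local (`pairNorm_gradRec_le`, `localNorm_le_pairNorm_gradRec`) and is proved
with suprema. On a regular mesh, `exists_elemControl` bounds the supremum of a polynomial, on a ball
of radius h_T containing T and on each face of T, by its means of order p and 2. Up to constants and
powers of h_T, L^p norms are therefore sup norms, and it suffices to compare pointwise bounds.
Testing the definition of G_T with G_T itself bounds it by ∇v_T and the scaled jumps; testing with
∇v_T gives the converse. For the residual, h_T Δ = (π_F r - π_T r) - (v_F - v_T), and both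
projections of r stay within a multiple of h_T sup|G_T| of the constant r(x₀)
(`IsResidual.abs_sub_le`), so -Δ and the scaled jump differ by at most a multiple of sup|G_T|.

Hölder's inequality is replaced by the weighted inequality of arithmetic and geometric means with
two free parameters (`rpow_le_of_sq_le`). The resulting bound is linear in Y and D, passes through
integrals and sums, and is optimized only once, at the end (`le_rpow_mul_rpow`). The projections and
reconstructions are defined by choice; `exists_repr` shows that their equations are solvable. -/

lemma continuous_pval {d : ℕ} (q : Poly d) : Continuous (pval q) := by
  unfold pval
  exact (MvPolynomial.continuous_eval q).comp (by fun_prop)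

@[simp] lemma pval_add {d : ℕ} (q r : Poly d) (x : E d) : pval (q + r) x = pval q x + pval r x := by
  simp [pval]

@[simp] lemma pval_sub {d : ℕ} (q r : Poly d) (x : E d) : pval (q - r) x = pval q x - pval r x := by
  simp [pval]

@[simp] lemma pval_smul {d : ℕ} (c : ℝ) (q : Poly d) (x : E d) : pval (c • q) x = c * pval q x := by
  simp [pval]

@[simp] lemma pval_C {d : ℕ} (c : ℝ) (x : E d) : pval (MvPolynomial.C c : Poly d) x = c := by
  simp [pval]

@[simp] lemma pval_zero {d : ℕ} (x : E d) : pval (0 : Poly d) x = 0 := by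
  simp [pval]

lemma C_mem_elemPoly {d : ℕ} (l : ℕ) (c : ℝ) : (MvPolynomial.C c : Poly d) ∈ ElemPoly d l := by
  simp [MvPolynomial.mem_restrictTotalDegree]

lemma elemPoly_mono {d l l' : ℕ} (h : l ≤ l') : ElemPoly d l ≤ ElemPoly d l' := fun q hq => by
  rw [MvPolynomial.mem_restrictTotalDegree] at hq ⊢
  exact hq.trans h

lemma grad_mem_elemPoly {d l : ℕ} {q : Poly d} (hq : q ∈ ElemPoly d (l + 1)) (i : Fin d) :
    grad q i ∈ ElemPoly d l := by
  rw [MvPolynomial.mem_restrictTotalDegree] at hq ⊢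
  unfold grad
  rw [q.as_sum, map_sum]
  refine MvPolynomial.totalDegree_finsetSum_le fun s hs => ?_
  rw [MvPolynomial.pderiv_monomial]
  by_cases hsi : s i = 0
  · simp [hsi]
  refine (MvPolynomial.totalDegree_monomial_le _ _).trans ?_
  have h1 := (MvPolynomial.le_totalDegree hs).trans hq
  have h2 : (s - Finsupp.single i 1) + Finsupp.single i 1 = s :=
    tsub_add_cancel_of_le (by simpa [Nat.one_le_iff_ne_zero] using hsi)
  have h3 : s.sum (fun _ e => e) =
      (s - Finsupp.single i 1).sum (fun _ e => e) + 1 := by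
    conv_lhs => rw [← h2]
    rw [Finsupp.sum_add_index' (by simp) (by simp)]
    simp
  change (s - Finsupp.single i 1).sum (fun _ e => e) ≤ l
  omega

/-- Composition of a polynomial with an affine map does not raise its total degree. -/
lemma exists_pval_comp {m n l : ℕ} (A : Fin n → Fin m → ℝ) (b : Fin n → ℝ) {q : Poly n}
    (hq : q ∈ ElemPoly n l) :
    ∃ r ∈ ElemPoly m l, ∀ (x : E m) (y : E n), (∀ i, y i = b i + ∑ j, A i j * x j) →
      pval r x = pval q y := by
  let g : Fin n → Poly m := fun i => MvPolynomial.C (b i) +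
    ∑ j, MvPolynomial.C (A i j) * MvPolynomial.X j
  have hg : ∀ i, (g i).totalDegree ≤ 1 := fun i => by
    refine (MvPolynomial.totalDegree_add _ _).trans (max_le (by simp) ?_)
    refine MvPolynomial.totalDegree_finsetSum_le fun j _ => ?_
    refine (MvPolynomial.totalDegree_mul _ _).trans ?_
    simp
  refine ⟨MvPolynomial.aeval g q, ?_, fun x y h => ?_⟩
  · rw [MvPolynomial.mem_restrictTotalDegree] at hq ⊢
    rw [q.as_sum, map_sum]
    refine MvPolynomial.totalDegree_finsetSum_le fun s hs => ?_
    rw [MvPolynomial.aeval_monomial]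
    refine (MvPolynomial.totalDegree_mul _ _).trans ?_
    have h1 := (MvPolynomial.le_totalDegree hs).trans hq
    have h2 : (s.prod fun i e => g i ^ e).totalDegree ≤ s.sum fun _ e => e := by
      refine (MvPolynomial.totalDegree_finsetProd _ _).trans ?_
      refine Finset.sum_le_sum fun i _ => (MvPolynomial.totalDegree_pow _ _).trans ?_
      calc s i * (g i).totalDegree ≤ s i * 1 := Nat.mul_le_mul_left _ (hg i)
        _ = s i := mul_one _
    have h3 : (algebraMap ℝ (Poly m) (MvPolynomial.coeff s q)).totalDegree = 0 :=
      MvPolynomial.totalDegree_C _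
    omega
  · unfold pval
    have hev : ∀ q : Poly n, MvPolynomial.eval (fun i => x i) (MvPolynomial.aeval g q) =
        MvPolynomial.eval (fun i => y i) q := by
      intro q
      induction q using MvPolynomial.induction_on with
      | C a => simp
      | add p q hp hq => rw [map_add, map_add, map_add, hp, hq]
      | mul_X p i hp => rw [map_mul, map_mul, map_mul, hp]; simp [h, g]
    exact hev q

/-- An open set contains a cube, that is, a product of infinite subsets of the line, and such a
product determines a polynomial. -/
lemma eq_zero_of_pval_eqOn_open {n : ℕ} {U : Set (E n)} (hU : IsOpen U) (hne : U.Nonempty)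
    {q : Poly n} (h : ∀ x ∈ U, pval q x = 0) : q = 0 := by
  obtain ⟨x₀, hx₀⟩ := hne
  have ho : IsOpen {x : Fin n → ℝ | (WithLp.toLp 2 x : E n) ∈ U} :=
    hU.preimage (PiLp.continuous_toLp 2 _)
  obtain ⟨ε, hε, hb⟩ := Metric.isOpen_iff.1 ho (fun i => x₀ i) hx₀
  refine MvPolynomial.funext_set (fun i => Metric.ball (x₀ i) ε) (fun i => ?_) fun x hx => ?_
  · rw [Real.ball_eq_Ioo]; exact Set.Ioo_infinite (by linarith)
  · have hx' : x ∈ Metric.ball (fun i => x₀ i) ε := by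
      rw [ball_pi _ hε]; exact hx
    simpa [pval] using h _ (hb hx')

/-- Equivalence of norms in finite dimension. The L^p norm on the small ball is definite on
polynomials, so the embedding `A` into L^p is antilipschitz in coordinates, while the supremum over
the unit ball is at most a multiple of the coordinate norm. -/
theorem exists_sup_le_integral_unit (n l : ℕ) {s : ℝ} (hs : 0 < s) {p : ℝ} (hp : 1 ≤ p) :
    ∃ C : ℝ, 0 < C ∧ ∀ q ∈ ElemPoly n l, ∀ x ∈ Metric.closedBall (0 : E n) 1,
      |pval q x| ^ p ≤ C * ∫ y in Metric.ball (0 : E n) s, |pval q y| ^ p := by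
  have hp0 : 0 < p := by linarith
  set μ : Measure (E n) := volume.restrict (Metric.ball (0 : E n) s) with hμ
  have : IsFiniteMeasure μ := ⟨by simpa [hμ] using measure_ball_lt_top⟩
  set P : ENNReal := ENNReal.ofReal p with hP
  have hP1 : 1 ≤ P := by simpa [hP] using hp
  have : Fact (1 ≤ P) := ⟨hP1⟩
  have hmem : ∀ q : Poly n, MemLp (pval q) P μ := fun q => by
    obtain ⟨c, hc⟩ := (isCompact_closedBall (0 : E n) s).exists_bound_of_continuousOn
      (continuous_pval q).continuousOn
    refine MemLp.of_bound (continuous_pval q).aestronglyMeasurable c ?_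
    exact (ae_restrict_iff' measurableSet_ball).2
      (Eventually.of_forall fun x hx => hc x (Metric.ball_subset_closedBall hx))
  let e := (Module.finBasis ℝ (ElemPoly n l)).equivFun.symm
  let A : (Fin (Module.finrank ℝ (ElemPoly n l)) → ℝ) →ₗ[ℝ] Lp ℝ P μ :=
    { toFun := fun c => (hmem (e c : Poly n)).toLp
      map_add' := fun c c' => by
        rw [← MemLp.toLp_add]
        congr 1
        funext x; simp
      map_smul' := fun a c => by
        rw [RingHom.id_apply, ← MemLp.toLp_const_smul]
        congr 1
        funext x; simp }
  have hA : LinearMap.ker A = ⊥ := by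
    rw [LinearMap.ker_eq_bot']
    intro c hc
    have h1 : pval (e c : Poly n) =ᵐ[μ] 0 := by
      have := (MemLp.toLp_eq_toLp_iff (hmem (e c : Poly n)) (MemLp.zero' (p := P) (μ := μ))).1
        (hc.trans (MemLp.toLp_zero _).symm)
      exact this
    have h2 := Measure.eqOn_open_of_ae_eq h1 Metric.isOpen_ball
      (continuous_pval _).continuousOn continuousOn_const
    have h3 : (e c : Poly n) = 0 := eq_zero_of_pval_eqOn_open Metric.isOpen_ball
      ⟨0, Metric.mem_ball_self hs⟩ h2
    have h4 : e c = 0 := Subtype.ext h3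
    simpa using h4
  obtain ⟨K, hK, hKA⟩ := A.exists_antilipschitzWith hA
  have hb : ∃ M : ℝ, 0 ≤ M ∧ ∀ c, ∀ x ∈ Metric.closedBall (0 : E n) 1,
      |pval (e c : Poly n) x| ≤ M * ‖c‖ := by
    have hex : ∀ i : Fin (Module.finrank ℝ (ElemPoly n l)), ∃ m : ℝ,
        ∀ x ∈ Metric.closedBall (0 : E n) 1, |pval (e (Pi.single i 1) : Poly n) x| ≤ m :=
      fun i => (isCompact_closedBall (0 : E n) 1).exists_bound_of_continuousOn
        (continuous_pval _).continuousOn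
    choose m hm using hex
    have hm0 : ∀ i, 0 ≤ m i := fun i => (abs_nonneg _).trans (hm i 0 (by simp))
    refine ⟨∑ i, m i, Finset.sum_nonneg fun i _ => hm0 i, fun c x hx => ?_⟩
    have hc : (e c : Poly n) = ∑ i, c i • (e (Pi.single i 1) : Poly n) := by
      conv_lhs => rw [pi_eq_sum_univ' c]
      rw [map_sum]
      push_cast
      refine Finset.sum_congr rfl fun i _ => ?_
      rw [map_smul]
      rfl
    have hv : pval (e c : Poly n) x = ∑ i, c i * pval (e (Pi.single i 1) : Poly n) x := by
      rw [hc]; simp [pval]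
    rw [hv, Finset.sum_mul]
    refine (Finset.abs_sum_le_sum_abs _ _).trans (Finset.sum_le_sum fun i _ => ?_)
    rw [abs_mul, mul_comm]
    exact mul_le_mul (hm i x hx) (norm_le_pi_norm c i) (abs_nonneg _) (hm0 i)
  obtain ⟨M, hM, hMb⟩ := hb
  -- The summand 1 only makes the constant positive, since `M` and `K` may vanish.
  refine ⟨(M * K) ^ p + 1, by positivity, fun q hq x hx => ?_⟩
  set c := e.symm ⟨q, hq⟩ with hc
  have hec : (e c : Poly n) = q := by simp [hc]
  have h1 := hMb c x hx
  rw [hec] at h1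
  have h2 : ‖c‖ ≤ K * ‖A c‖ := hKA.le_mul_norm (map_zero A) c
  set I := ∫ y in Metric.ball (0 : E n) s, |pval q y| ^ p with hI
  have hI0 : 0 ≤ I := integral_nonneg fun y => by positivity
  have h3 : ‖A c‖ = I ^ p⁻¹ := by
    change ‖(hmem (e c : Poly n)).toLp‖ = _
    rw [Lp.norm_toLp, (hmem _).eLpNorm_eq_integral_rpow_norm (by positivity) (by simp [hP]), hec,
      ENNReal.toReal_ofReal (by positivity)]
    simp [hP, ENNReal.toReal_ofReal hp0.le, hI, hμ]
  have h4 : |pval q x| ≤ M * K * I ^ p⁻¹ := by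
    calc _ ≤ M * ‖c‖ := h1
      _ ≤ M * (K * ‖A c‖) := by gcongr
      _ = _ := by rw [h3]; ring
  calc |pval q x| ^ p ≤ (M * K * I ^ p⁻¹) ^ p := by gcongr
    _ = (M * K) ^ p * I := by
      rw [Real.mul_rpow (by positivity) (by positivity), ← Real.rpow_mul hI0,
        inv_mul_cancel₀ hp0.ne', Real.rpow_one]
    _ ≤ _ := by nlinarith

/-- Scaling by z ↦ x₀ + h z, whose Jacobian is h^n, keeps the constant independent of the ball. -/
theorem exists_sup_le_integral (n l : ℕ) {s : ℝ} (hs : 0 < s) {p : ℝ} (hp : 1 ≤ p) :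
    ∃ C : ℝ, 0 < C ∧ ∀ q ∈ ElemPoly n l, ∀ (x₀ : E n) (h : ℝ), 0 < h →
      ∀ x ∈ Metric.closedBall x₀ h,
      h ^ n * |pval q x| ^ p ≤ C * ∫ y in Metric.ball x₀ (s * h), |pval q y| ^ p := by
  obtain ⟨C, hC, H⟩ := exists_sup_le_integral_unit n l hs hp
  refine ⟨C, hC, fun q hq x₀ h hh x hx => ?_⟩
  obtain ⟨r, hr, hrq⟩ := exists_pval_comp (m := n) (fun i j => if i = j then h else 0)
    (fun i => x₀ i) hq
  have hrq' : ∀ z : E n, pval r z = pval q (x₀ + h • z) := fun z => hrq z _ fun i => by simp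
  have hz : h⁻¹ • (x - x₀) ∈ Metric.closedBall (0 : E n) 1 := by
    rw [mem_closedBall_zero_iff, norm_smul, norm_inv, Real.norm_of_nonneg hh.le, inv_mul_le_one₀ hh,
      ← dist_eq_norm]
    exact hx
  have h1 := H r hr _ hz
  rw [hrq', smul_inv_smul₀ hh.ne', add_sub_cancel] at h1
  have h2 : ∫ y in Metric.ball x₀ (s * h), |pval q y| ^ p =
      h ^ n * ∫ y in Metric.ball (0 : E n) s, |pval r y| ^ p := by
    rw [← integral_indicator measurableSet_ball, ← integral_indicator measurableSet_ball,
      ← integral_add_left_eq_self _ x₀]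
    have h3 := Measure.integral_comp_smul (volume : Measure (E n))
      (fun y => (Metric.ball x₀ (s * h)).indicator (fun y => |pval q y| ^ p) (x₀ + y)) h
    rw [finrank_euclideanSpace_fin, abs_of_nonneg (by positivity), smul_eq_mul] at h3
    have h4 : (fun y : E n => (Metric.ball x₀ (s * h)).indicator (fun y => |pval q y| ^ p)
        (x₀ + h • y)) = (Metric.ball (0 : E n) s).indicator (fun y => |pval r y| ^ p) := by
      funext y
      have : x₀ + h • y ∈ Metric.ball x₀ (s * h) ↔ y ∈ Metric.ball (0 : E n) s := by
        rw [mem_ball_zero_iff, mem_ball_iff_norm, add_sub_cancel_left, norm_smul,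
          Real.norm_of_nonneg hh.le, mul_comm, mul_lt_mul_iff_left₀ hh]
      by_cases hy : y ∈ Metric.ball (0 : E n) s
      · rw [Set.indicator_of_mem hy, Set.indicator_of_mem (this.2 hy), hrq']
      · rw [Set.indicator_of_notMem hy, Set.indicator_of_notMem (fun h => hy (this.1 h))]
    rw [h4] at h3
    rw [h3, mul_inv_cancel_left₀ (by positivity)]
  rw [h2]
  calc h ^ n * |pval q x| ^ p ≤ h ^ n * (C * ∫ y in Metric.ball (0 : E n) s, |pval r y| ^ p) := by
        gcongr
    _ = _ := by ring

/-- The version for an m-dimensional affine subspace, needed on faces: the isometry `φ` pulls a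
polynomial back to one of the same degree bound in m variables and carries Lebesgue measure to
Hausdorff measure. -/
theorem exists_sup_le_integral_isometry (m n l : ℕ) {s : ℝ} (hs : 0 < s) {p : ℝ} (hp : 1 ≤ p) :
    ∃ C : ℝ, 0 < C ∧ ∀ q ∈ ElemPoly n l, ∀ (φ : E m →ᵃⁱ[ℝ] E n) (h : ℝ), 0 < h →
      ∀ x ∈ Metric.closedBall (φ 0) h ∩ Set.range φ,
      h ^ m * |pval q x| ^ p ≤
        C * ∫ y in Metric.ball (φ 0) (s * h) ∩ Set.range φ, |pval q y| ^ p ∂μHE[m] := by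
  obtain ⟨C, hC, H⟩ := exists_sup_le_integral m l hs hp
  refine ⟨C, hC, fun q hq φ h hh x hx => ?_⟩
  obtain ⟨r, hr, hrq⟩ := exists_pval_comp (m := m)
    (fun i j => φ.linearIsometry (EuclideanSpace.single j 1) i) (fun i => φ 0 i) hq
  have hrq' : ∀ z : E m, pval r z = pval q (φ z) := fun z => hrq z _ fun i => by
    have h1 : φ z = φ.linearIsometry z + φ 0 := by
      have := φ.map_vadd 0 z
      simpa using this
    have h2 : z = ∑ j, z j • (EuclideanSpace.single j (1 : ℝ) : E m) := by
      ext i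
      simp [Pi.single_apply]
    have h3 : φ.linearIsometry z = ∑ j, z j • φ.linearIsometry (EuclideanSpace.single j 1) := by
      conv_lhs => rw [h2]
      simp
    rw [h1, PiLp.add_apply, h3, add_comm]
    simp [mul_comm]
  obtain ⟨hx1, z, rfl⟩ := hx
  have hz : z ∈ Metric.closedBall (0 : E m) h := by
    rw [Metric.mem_closedBall] at hx1 ⊢
    rwa [φ.isometry.dist_eq] at hx1
  have h1 := H r hr 0 h hh z hz
  rw [hrq'] at h1
  convert h1 using 2
  have hφ := φ.isometry.isClosedEmbedding.measurableEmbedding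
  have h2 := φ.isometry.map_euclideanHausdorffMeasure (d := m)
  rw [EuclideanSpace.euclideanHausdorffMeasure_eq_volume] at h2
  rw [← Measure.restrict_restrict measurableSet_ball, ← h2, hφ.setIntegral_map,
    φ.isometry.preimage_ball]
  simp only [hrq']

end HHO

/-! ### Simplices, polytopes and the geometry of regular meshes -/

namespace HHO

open Module (finrank)

section Simplex

variable {d : ℕ} {s t : Finset (E d)}

lemma openSimplex_subset_convexHull (s : Finset (E d)) :
    openSimplex s ⊆ convexHull ℝ (s : Set (E d)) := by
  rintro x ⟨w, hw, hw1, rfl⟩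
  exact Finset.mem_convexHull'.2 ⟨w, fun y hy => (hw y hy).le, hw1, rfl⟩

lemma convexHull_subset_closure_openSimplex (hs : s.Nonempty) :
    convexHull ℝ (s : Set (E d)) ⊆ closure (openSimplex s) := by
  intro x hx
  obtain ⟨w, hw, hw1, rfl⟩ := Finset.mem_convexHull'.1 hx
  have hc : (0 : ℝ) < s.card := by exact_mod_cast hs.card_pos
  -- Moving the weights slightly towards the barycentre makes all of them positive.
  have hlim : Tendsto (fun ε : ℝ => ∑ y ∈ s, ((1 - ε) * w y + ε * (s.card : ℝ)⁻¹) • y)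
      (𝓝[>] 0) (𝓝 (∑ y ∈ s, w y • y)) := by
    have : Continuous fun ε : ℝ => ∑ y ∈ s, ((1 - ε) * w y + ε * (s.card : ℝ)⁻¹) • y := by
      fun_prop
    have h0 := (this.tendsto 0).mono_left (nhdsWithin_le_nhds (s := Set.Ioi 0))
    simpa using h0
  refine mem_closure_of_tendsto hlim ?_
  filter_upwards [Ioo_mem_nhdsGT (show (0 : ℝ) < 1 by norm_num)] with ε hε
  refine ⟨fun y => (1 - ε) * w y + ε * (s.card : ℝ)⁻¹, fun y hy => ?_, ?_, rfl⟩
  · have := mul_nonneg (sub_nonneg.2 hε.2.le) (hw y hy)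
    have h2 : 0 < ε * (s.card : ℝ)⁻¹ := mul_pos hε.1 (inv_pos.2 hc)
    linarith
  · rw [Finset.sum_add_distrib, ← Finset.mul_sum, hw1, Finset.sum_const, nsmul_eq_mul]
    field_simp
    ring

lemma weights_unique (hs : AffineIndependent ℝ ((↑) : s → E d)) {w w' : E d → ℝ}
    (h1 : ∑ y ∈ s, w y = ∑ y ∈ s, w' y) (h2 : ∑ y ∈ s, w y • y = ∑ y ∈ s, w' y • y) :
    ∀ y ∈ s, w y = w' y := by
  intro y hy
  have h := (affineIndependent_iff.1 hs) Finset.univ (fun z => w z - w' z)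
    (by
      rw [Finset.sum_coe_sort s (fun z => w z - w' z), Finset.sum_sub_distrib, h1, sub_self])
    (by
      rw [Finset.sum_coe_sort s (fun z => (w z - w' z) • z)]
      simp_rw [sub_smul]
      rw [Finset.sum_sub_distrib, h2, sub_self]) ⟨y, hy⟩ (Finset.mem_univ _)
  exact sub_eq_zero.1 h

/-- A common point lies in the hull of the common vertices. By uniqueness of barycentric coordinates
its weights at the other vertices vanish, but in an open simplex all weights are positive. -/
lemma eq_of_openSimplex_inter {K : Geometry.SimplicialComplex ℝ (E d)}
    (hs : s ∈ K.faces) (ht : t ∈ K.faces) (h : (openSimplex s ∩ openSimplex t).Nonempty) :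
    s = t := by
  classical
  have key : ∀ s t : Finset (E d), s ∈ K.faces → t ∈ K.faces →
      (openSimplex s ∩ openSimplex t).Nonempty → s ⊆ t := by
    rintro s t hs ht ⟨x, ⟨w, hw, hw1, hwx⟩, hxt⟩
    have hx : x ∈ convexHull ℝ ((s ∩ t : Finset (E d)) : Set (E d)) := by
      have := K.inter_subset_convexHull hs ht
        ⟨openSimplex_subset_convexHull s ⟨w, hw, hw1, hwx⟩, openSimplex_subset_convexHull t hxt⟩
      simpa using this
    obtain ⟨u, hu, hu1, hux⟩ := Finset.mem_convexHull'.1 hx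
    have e1 : ∀ f : E d → E d, ∑ y ∈ s, (if y ∈ t then f y else 0) = ∑ y ∈ s ∩ t, f y := by
      intro f; rw [← Finset.sum_filter, Finset.filter_mem_eq_inter]
    have e2 : ∀ f : E d → ℝ, ∑ y ∈ s, (if y ∈ t then f y else 0) = ∑ y ∈ s ∩ t, f y := by
      intro f; rw [← Finset.sum_filter, Finset.filter_mem_eq_inter]
    have hun := weights_unique (K.indep hs) (w := w) (w' := fun y => if y ∈ t then u y else 0)
      (by rw [hw1, e2, hu1]) (by
        simp_rw [ite_smul, zero_smul]
        rw [hwx, e1, hux])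
    intro y hy
    by_contra hyt
    have := hun y hy
    rw [if_neg hyt] at this
    exact (hw y hy).ne' this
  exact (key s t hs ht h).antisymm (key t s ht hs (by rwa [Set.inter_comm]))

open Classical in
lemma exists_mem_convexHull_erase {x : E d} (hx : x ∈ convexHull ℝ (s : Set (E d)))
    (hx' : x ∉ openSimplex s) : ∃ a ∈ s, x ∈ convexHull ℝ ((s.erase a : Finset (E d)) : Set (E d)) := by
  obtain ⟨w, hw, hw1, hwx⟩ := Finset.mem_convexHull'.1 hx
  by_contra hcon
  push Not at hcon
  refine hx' ⟨w, fun y hy => (hw y hy).lt_of_ne' fun h0 => hcon y hy ?_, hw1, hwx⟩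
  refine Finset.mem_convexHull'.2 ⟨w, fun z hz => hw z (Finset.mem_of_mem_erase hz), ?_, ?_⟩
  · rw [← hw1, ← Finset.sum_erase_add s _ hy, h0, add_zero]
  · rw [← hwx, ← Finset.sum_erase_add s _ hy, h0, zero_smul, add_zero]

open Classical in
/-- If a simplex contains a ball, each of its facets contains a relative ball of the same radius. -/
lemma exists_relative_ball_subset_facet (hs : AffineIndependent ℝ ((↑) : s → E d)) {a : E d}
    (ha : a ∈ s) (hne : (s.erase a).Nonempty) {x : E d} {r : ℝ} (hr : 0 < r)
    (hb : Metric.ball x r ⊆ openSimplex s) :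
    ∃ y ∈ openSimplex (s.erase a),
      ∀ z ∈ affineSpan ℝ ((s.erase a : Finset (E d)) : Set (E d)), dist z y < r →
        z ∈ openSimplex (s.erase a) := by
  obtain ⟨w, hw, hw1, hwx⟩ := hb (Metric.mem_ball_self hr)
  have hsum := Finset.sum_erase_add s w ha
  have hpos : 0 < ∑ y ∈ s.erase a, w y :=
    Finset.sum_pos (fun y hy => hw y (Finset.mem_of_mem_erase hy)) hne
  set c := 1 - w a with hc
  have hcs : ∑ y ∈ s.erase a, w y = c := by linarith
  have hc0 : 0 < c := hcs ▸ hpos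
  have hwa := hw a ha
  -- The centre x is w(a) a + c y with y in the facet: y is the projection of x from the vertex a
  -- onto the opposite facet.
  have hyx : c • ∑ y ∈ s.erase a, (c⁻¹ * w y) • y = x - w a • a := by
    rw [Finset.smul_sum, ← hwx, ← Finset.sum_erase_add s _ ha, add_sub_cancel_right]
    refine Finset.sum_congr rfl fun y _ => ?_
    rw [smul_smul, mul_inv_cancel_left₀ hc0.ne']
  refine ⟨∑ y ∈ s.erase a, (c⁻¹ * w y) • y, ⟨fun y => c⁻¹ * w y, fun y hy => ?_, ?_, rfl⟩, ?_⟩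
  · exact mul_pos (inv_pos.2 hc0) (hw y (Finset.mem_of_mem_erase hy))
  · rw [← Finset.mul_sum, hcs, inv_mul_cancel₀ hc0.ne']
  · intro z hz hzy
    set y := ∑ y ∈ s.erase a, (c⁻¹ * w y) • y
    obtain ⟨u, hu1, hu⟩ : ∃ u : E d → ℝ, ∑ y ∈ s.erase a, u y = 1 ∧
        ∑ y ∈ s.erase a, u y • y = z := by
      have hr : ((s.erase a : Finset (E d)) : Set (E d)) =
          Set.range ((↑) : ((s.erase a : Finset (E d)) : Set (E d)) → E d) :=
        Subtype.range_coe.symm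
      rw [hr] at hz
      obtain ⟨v, hv1, hv⟩ := eq_affineCombination_of_mem_affineSpan_of_fintype hz
      rw [Finset.affineCombination_eq_linear_combination _ _ _ hv1] at hv
      refine ⟨fun y => if h : y ∈ s.erase a then v ⟨y, h⟩ else 0, ?_, ?_⟩
      · rw [← hv1, ← Finset.sum_coe_sort]
        exact Finset.sum_congr rfl fun y _ => by simp
      · rw [hv, ← Finset.sum_coe_sort]
        exact Finset.sum_congr rfl fun y _ => by simp
    -- The homothety of centre a and ratio c ≤ 1 sends y to x and contracts distances, so it sends z
    -- into the given ball. The weights of the image are positive, and away from a they are c times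
    -- those of z.
    obtain ⟨v, hv, hv1, hvx⟩ := hb (show w a • a + c • z ∈ Metric.ball x r by
      rw [Metric.mem_ball, dist_eq_norm]
      have : w a • a + c • z - x = c • (z - y) := by
        rw [smul_sub, hyx]; abel
      rw [this, norm_smul, Real.norm_of_nonneg hc0.le, ← dist_eq_norm]
      calc c * dist z y ≤ 1 * dist z y := by gcongr; linarith
        _ < r := by linarith)
    have hun := weights_unique hs (w := v) (w' := fun y => if y = a then w a else c * u y)
      (by
        rw [hv1, ← Finset.sum_erase_add s _ ha, if_pos rfl,
          Finset.sum_congr rfl fun y hy => if_neg (Finset.ne_of_mem_erase hy),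
          ← Finset.mul_sum, hu1]
        linarith)
      (by
        rw [hvx, ← Finset.sum_erase_add s _ ha, if_pos rfl,
          Finset.sum_congr rfl fun y hy => by rw [if_neg (Finset.ne_of_mem_erase hy), mul_smul],
          ← Finset.smul_sum, hu]
        abel)
    refine ⟨u, fun b hb => ?_, hu1, hu⟩
    have h1 := hun b (Finset.mem_of_mem_erase hb)
    rw [if_neg (Finset.ne_of_mem_erase hb)] at h1
    have h2 := hv b (Finset.mem_of_mem_erase hb)
    rw [h1] at h2
    exact pos_of_mul_pos_right h2 hc0.le

lemma finrank_direction_affineSpan (hs : AffineIndependent ℝ ((↑) : s → E d)) {n : ℕ}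
    (hn : s.card = n + 1) : finrank ℝ (affineSpan ℝ (s : Set (E d))).direction = n := by
  have h := hs.finrank_vectorSpan (n := n) (by rwa [Fintype.card_coe])
  rw [direction_affineSpan]
  rwa [show Set.range ((↑) : s → E d) = (s : Set (E d)) from Subtype.range_coe] at h

end Simplex

section Polytope

variable {d : ℕ} {X : Set (E d)}

lemma IsPolytope.isOpen (h : IsPolytope X) : IsOpen X := by
  obtain ⟨-, S, -, rfl⟩ := h
  exact isOpen_interior

lemma isClosed_iUnion_convexHull (S : Finset (Finset (E d))) :
    IsClosed (⋃ s ∈ S, convexHull ℝ (s : Set (E d))) :=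
  S.finite_toSet.isClosed_biUnion fun s _ => s.finite_toSet.isClosed_convexHull ℝ

lemma IsPolytope.isBounded (h : IsPolytope X) : Bornology.IsBounded X := by
  obtain ⟨-, S, -, rfl⟩ := h
  refine Bornology.IsBounded.subset ?_ interior_subset
  refine (Bornology.isBounded_biUnion S.finite_toSet).2 ?_
  exact fun s _ => (isBounded_convexHull).2 s.finite_toSet.isBounded

/-- A polytope is regular open, being the interior of a closed set. This yields T ⊆ Ω from the mere
inclusion of T in the closure of Ω. -/
lemma IsPolytope.interior_closure (h : IsPolytope X) : interior (closure X) ⊆ X := by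
  obtain ⟨-, S, -, rfl⟩ := h
  exact interior_mono ((isClosed_iUnion_convexHull S).closure_interior_subset)

end Polytope

namespace PolytopalMesh

variable {d : ℕ} {Ω : Set (E d)} (M : PolytopalMesh d Ω)

lemma elem_subset (hΩ : IsPolytope Ω) (T : M.elems) : T.1 ⊆ Ω := by
  refine Set.Subset.trans ?_ hΩ.interior_closure
  refine ((M.elem_polytope T.1 T.2).isOpen).subset_interior_iff.2 ?_
  rw [M.closure_eq]
  exact subset_closure.trans (Set.subset_biUnion_of_mem (u := fun T => closure T) T.2)

lemma isOpen_elem (T : M.elems) : IsOpen T.1 := (M.elem_polytope T.1 T.2).isOpen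

lemma isBounded_elem (T : M.elems) : Bornology.IsBounded T.1 := (M.elem_polytope T.1 T.2).isBounded

lemma nonempty_elem (T : M.elems) : T.1.Nonempty := (M.elem_polytope T.1 T.2).1.nonempty

lemma mem_facesOf {T : M.elems} {F : M.faces} : F ∈ M.facesOf T ↔ F.1 ⊆ frontier T.1 := by
  simp [facesOf]

/-- The simplices of a submesh that lie in the element `T`. -/
def simplicesIn (K : Geometry.SimplicialComplex ℝ (E d)) (T : Set (E d)) : Set (Finset (E d)) :=
  {τ | τ ∈ K.faces ∧ τ.card = d + 1 ∧ openSimplex τ ⊆ T}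

variable {M} {K : Geometry.SimplicialComplex ℝ (E d)} (hK : M.IsMatchingSimplicialSubmesh K)
include hK

/-- A point of T lies in some closed d-simplex by purity. The open set T then meets the open
simplex, which lies in a single element; disjointness of the elements makes that element T. -/
lemma IsMatchingSimplicialSubmesh.elem_subset (T : M.elems) :
    T.1 ⊆ ⋃ τ ∈ simplicesIn K T.1, convexHull ℝ (τ : Set (E d)) := by
  intro x hx
  have hx' : x ∈ K.space := by
    rw [hK.space_eq, M.closure_eq]
    exact Set.mem_biUnion T.2 (subset_closure hx)
  obtain ⟨s, hs, hxs⟩ := Geometry.SimplicialComplex.mem_space_iff.1 hx'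
  obtain ⟨t, ht, hst, htc⟩ := hK.pure s hs
  have hxt : x ∈ convexHull ℝ (t : Set (E d)) := convexHull_mono (by exact_mod_cast hst) hxs
  refine Set.mem_biUnion ⟨ht, htc, ?_⟩ hxt
  obtain ⟨z, hzT, hzt⟩ := mem_closure_iff.1 (convexHull_subset_closure_openSimplex
    (K.nonempty_of_mem_faces ht) hxt) T.1 (M.isOpen_elem T) hx
  obtain ⟨T', hT', htT'⟩ := hK.simplex_subset t ht htc
  have : T' = T.1 := by
    by_contra hne
    exact Set.disjoint_left.1 (M.elem_disjoint T' hT' T.1 T.2 hne) (htT' hzt) hzT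
  rwa [← this]

lemma IsMatchingSimplicialSubmesh.finite_simplicesIn (T : Set (E d)) :
    (simplicesIn K T).Finite := hK.finite.subset fun _ h => h.1

lemma IsMatchingSimplicialSubmesh.closure_elem_subset (T : M.elems) :
    closure T.1 ⊆ ⋃ τ ∈ simplicesIn K T.1, convexHull ℝ (τ : Set (E d)) := by
  refine closure_minimal (hK.elem_subset T) ?_
  exact (hK.finite_simplicesIn T.1).isClosed_biUnion fun s _ => s.finite_toSet.isClosed_convexHull ℝ

lemma IsMatchingSimplicialSubmesh.exists_simplex (T : M.elems) : (simplicesIn K T.1).Nonempty := by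
  obtain ⟨x, hx⟩ := M.nonempty_elem T
  obtain ⟨τ, hτ, -⟩ := Set.mem_iUnion₂.1 (hK.elem_subset T hx)
  exact ⟨τ, hτ⟩

open Classical in
/-- Every face of an element contains a facet of a submesh simplex lying in that element. -/
lemma IsMatchingSimplicialSubmesh.exists_facet (hd : 1 ≤ d) {T : M.elems} {F : M.faces}
    (hF : F ∈ M.facesOf T) :
    ∃ τ ∈ simplicesIn K T.1, ∃ a ∈ τ, openSimplex (τ.erase a) ⊆ F.1 ∧
      F.1 ⊆ affineSpan ℝ ((τ.erase a : Finset (E d)) : Set (E d)) := by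
  rw [M.mem_facesOf] at hF
  obtain ⟨H, hH, U, hU, hFU⟩ := M.face_hyperplane F.1 F.2
  have hFc : IsLocallyClosed F.1 := by
    rw [hFU]
    exact hU.isLocallyClosed.inter (AffineSubspace.closed_of_finiteDimensional H).isLocallyClosed
  have : LocallyCompactSpace F.1 := hFc.locallyCompactSpace
  have : Nonempty F.1 := (M.face_connected F.1 F.2).nonempty.to_subtype
  let ι := {q : Finset (E d) × E d // q.1 ∈ simplicesIn K T.1 ∧ q.2 ∈ q.1}
  have : Finite ι := by
    have h : Set.Finite {q : Finset (E d) × E d | q.1 ∈ simplicesIn K T.1 ∧ q.2 ∈ q.1} := by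
      refine ((hK.finite_simplicesIn T.1).biUnion fun τ _ =>
        (τ.finite_toSet.image fun a => (τ, a))).subset ?_
      rintro ⟨τ, a⟩ ⟨h1, h2⟩
      exact Set.mem_biUnion h1 ⟨a, h2, rfl⟩
    exact h.to_subtype
  -- Baire's theorem in the locally compact space F: the finitely many closed facets of the
  -- simplices in T cover F, because a point of ∂T is in no open simplex contained in T. Hence one
  -- facet contains a relatively open part of F.
  obtain ⟨⟨⟨τ, a⟩, hτ, ha⟩, z, hz⟩ := nonempty_interior_of_iUnion_of_closed (X := F.1) (ι := ι)
    (f := fun q => (↑) ⁻¹' (convexHull ℝ ((q.1.1.erase q.1.2 : Finset (E d)) : Set (E d))))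
    (fun q => (Set.Finite.isClosed_convexHull ℝ (Finset.finite_toSet _)).preimage
      continuous_subtype_val)
    (by
      refine Set.eq_univ_of_forall fun x => ?_
      have hxc : x.1 ∈ closure T.1 := frontier_subset_closure (hF x.2)
      obtain ⟨τ, hτ, hxτ⟩ := Set.mem_iUnion₂.1 (hK.closure_elem_subset T hxc)
      have hxT : x.1 ∉ T.1 := by
        have := hF x.2
        rw [frontier, (M.isOpen_elem T).interior_eq] at this
        exact this.2
      obtain ⟨a, ha, hxa⟩ := exists_mem_convexHull_erase hxτ fun h => hxT (hτ.2.2 h)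
      exact Set.mem_iUnion.2 ⟨⟨⟨τ, a⟩, hτ, ha⟩, hxa⟩)
  dsimp only at hτ ha hz
  refine ⟨τ, hτ, a, ha, ?_⟩
  set σ := τ.erase a with hσ
  have hσc : σ.card = d := by rw [hσ, Finset.card_erase_of_mem ha, hτ.2.1]; simp
  have hσne : σ.Nonempty := by rw [← Finset.card_pos]; omega
  have hσK : σ ∈ K.faces := K.down_closed hτ.1 (Finset.erase_subset _ _) hσne
  have hzUH : z.1 ∈ U ∩ (H : Set (E d)) := hFU.subset z.2
  rw [mem_interior_iff_mem_nhds, mem_nhds_subtype] at hz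
  obtain ⟨u, hu, huz⟩ := hz
  obtain ⟨ε, hε, hεu⟩ := Metric.mem_nhds_iff.1 (inter_mem hu (hU.mem_nhds hzUH.1))
  have hzH : z.1 ∈ H := hzUH.2
  have hsub : ∀ y ∈ H, dist y z.1 < ε → y ∈ convexHull ℝ (σ : Set (E d)) := fun y hy hyz => by
    have h1 := hεu hyz
    have h2 : y ∈ F.1 := by rw [hFU]; exact ⟨h1.2, hy⟩
    exact huz (show (⟨y, h2⟩ : F.1) ∈ _ from h1.1)
  have hzσ : z.1 ∈ convexHull ℝ (σ : Set (E d)) := hsub _ hzH (by simpa using hε)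
  -- Small displacements from z along the hyperplane H of F stay in the facet, so H is parallel to
  -- it; the dimensions agree, and H is the affine span of the facet.
  have hdir : H.direction ≤ (affineSpan ℝ (σ : Set (E d))).direction := by
    intro v hv
    by_cases hv0 : v = 0
    · rw [hv0]; exact Submodule.zero_mem _
    have hvn : 0 < ‖v‖ := norm_pos_iff.2 hv0
    have hc : 0 < ε / (2 * ‖v‖) := by positivity
    have h1 : (ε / (2 * ‖v‖)) • v +ᵥ z.1 ∈ convexHull ℝ (σ : Set (E d)) := by
      refine hsub _ (AffineSubspace.vadd_mem_of_mem_direction (Submodule.smul_mem _ _ hv) hzH) ?_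
      rw [dist_eq_norm, vadd_eq_add, add_sub_cancel_right, norm_smul, Real.norm_of_nonneg hc.le]
      field_simp
      norm_num
    have h2 := AffineSubspace.vsub_mem_direction (convexHull_subset_affineSpan _ h1)
      (convexHull_subset_affineSpan _ hzσ)
    rw [vadd_vsub] at h2
    have h3 := Submodule.smul_mem _ (ε / (2 * ‖v‖))⁻¹ h2
    rwa [inv_smul_smul₀ hc.ne'] at h3
  have hfin : finrank ℝ (affineSpan ℝ (σ : Set (E d))).direction = d - 1 :=
    finrank_direction_affineSpan (K.indep hσK) (by omega)
  have hdir' := Submodule.eq_of_le_of_finrank_eq hdir (by omega)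
  have hHσ : H = affineSpan ℝ (σ : Set (E d)) :=
    AffineSubspace.ext_of_direction_eq hdir' ⟨z.1, hzH, convexHull_subset_affineSpan _ hzσ⟩
  refine ⟨?_, fun x hx => ?_⟩
  -- The open facet is dense in the closed one, so it meets F; compatibility of the submesh with the
  -- faces then forces inclusion.
  · obtain ⟨y, hyU, hyσ⟩ := mem_closure_iff.1 (convexHull_subset_closure_openSimplex hσne hzσ) U hU
      hzUH.1
    refine (hK.face_compat σ hσK hσc F.1 F.2).resolve_left fun hdis =>
      Set.disjoint_left.1 hdis hyσ ?_
    rw [hFU]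
    refine ⟨hyU, ?_⟩
    rw [hHσ]
    exact convexHull_subset_affineSpan _ (openSimplex_subset_convexHull _ hyσ)
  · rw [← hHσ]
    rw [hFU] at hx
    exact hx.2

omit hK

lemma hT_pos (hd : 1 ≤ d) (T : M.elems) : 0 < M.hT T := by
  have : Nonempty (Fin d) := ⟨⟨0, hd⟩⟩
  obtain ⟨x, hx⟩ := M.nonempty_elem T
  exact Metric.diam_pos (infinite_of_mem_nhds x ((M.isOpen_elem T).mem_nhds hx)).nontrivial
    (M.isBounded_elem T)

lemma closure_elem_subset_closedBall {T : M.elems} {x : E d} (hx : x ∈ T.1) :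
    closure T.1 ⊆ Metric.closedBall x (M.hT T) := by
  refine closure_minimal (fun y hy => ?_) Metric.isClosed_closedBall
  exact Metric.dist_le_diam_of_mem (M.isBounded_elem T) hy hx

lemma face_subset_closure {T : M.elems} {F : M.faces} (hF : F ∈ M.facesOf T) :
    F.1 ⊆ closure T.1 := (M.mem_facesOf.1 hF).trans frontier_subset_closure

lemma measurableSet_face (F : M.faces) : MeasurableSet F.1 := by
  obtain ⟨H, -, U, hU, hFU⟩ := M.face_hyperplane F.1 F.2
  rw [hFU]
  exact hU.measurableSet.inter (AffineSubspace.closed_of_finiteDimensional H).measurableSet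

section Regular

variable {ρ : ℝ} (hρ : 0 < ρ) (hM : M.IsRegular ρ) (hd : 1 ≤ d)
include hρ hM hd

-- A simplex in T contains a ball of radius ρ h_τ ≥ ρ² h_T. This is the source of every factor ρ²
-- below.
omit hd in
lemma IsRegular.exists_ball_subset (T : M.elems) :
    ∃ x, Metric.ball x (ρ ^ 2 * M.hT T) ⊆ T.1 := by
  obtain ⟨K, hK, h1, h2⟩ := hM
  obtain ⟨τ, hτ⟩ := hK.exists_simplex T
  obtain ⟨x, hx⟩ := h1 τ hτ.1 hτ.2.1
  refine ⟨x, ((Metric.ball_subset_ball ?_).trans hx).trans hτ.2.2⟩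
  have := h2 T τ hτ.1 hτ.2.1 hτ.2.2
  nlinarith

/-- The face contains an open facet of a submesh simplex, and a facet inherits a relative ball with
the radius of the ball in its simplex. -/
lemma IsRegular.exists_relative_ball_subset {T : M.elems} {F : M.faces} (hF : F ∈ M.facesOf T) :
    ∃ y ∈ F.1, ∃ H : AffineSubspace ℝ (E d), finrank ℝ H.direction = d - 1 ∧
      F.1 ⊆ H ∧ ∀ z ∈ H, dist z y < ρ ^ 2 * M.hT T → z ∈ F.1 := by
  classical
  obtain ⟨K, hK, h1, h2⟩ := hM
  obtain ⟨τ, hτ, a, ha, hσF, hFH⟩ := hK.exists_facet hd hF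
  have hσc : (τ.erase a).card = d := by rw [Finset.card_erase_of_mem ha, hτ.2.1]; simp
  have hσne : (τ.erase a).Nonempty := by rw [← Finset.card_pos]; omega
  have hσK : τ.erase a ∈ K.faces := K.down_closed hτ.1 (Finset.erase_subset _ _) hσne
  obtain ⟨x, hx⟩ := h1 τ hτ.1 hτ.2.1
  have h3 := h2 T τ hτ.1 hτ.2.1 hτ.2.2
  have h4 : 0 < ρ * M.hT T := mul_pos hρ (M.hT_pos hd T)
  have h5 : 0 < ρ * Metric.diam (openSimplex τ) := by nlinarith
  obtain ⟨y, hy, hyb⟩ := exists_relative_ball_subset_facet (K.indep hτ.1) ha hσne h5 hx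
  refine ⟨y, hσF hy, affineSpan ℝ ((τ.erase a : Finset (E d)) : Set (E d)), ?_, hFH,
    fun z hz hzy => hσF (hyb z hz (hzy.trans_le ?_))⟩
  · exact finrank_direction_affineSpan (K.indep hσK) (by omega)
  · nlinarith

lemma IsRegular.card_facesOf_le (T : M.elems) :
    ((M.facesOf T).card : ℝ) * (ρ ^ 2) ^ d ≤ d + 1 := by
  classical
  have hball := hM.exists_ball_subset hρ T
  obtain ⟨K, hK, h1, h2⟩ := hM
  have hh := M.hT_pos hd T
  set Θ := (hK.finite_simplicesIn T.1).toFinset with hΘ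
  have hmem : ∀ τ ∈ Θ, τ ∈ simplicesIn K T.1 := fun τ hτ => (Set.Finite.mem_toFinset _).1 hτ
  have hbτ : ∀ τ ∈ Θ, ∃ x, Metric.ball x (ρ ^ 2 * M.hT T) ⊆ openSimplex τ := fun τ hτ => by
    obtain ⟨x, hx⟩ := h1 τ (hmem τ hτ).1 (hmem τ hτ).2.1
    refine ⟨x, (Metric.ball_subset_ball ?_).trans hx⟩
    have := h2 T τ (hmem τ hτ).1 (hmem τ hτ).2.1 (hmem τ hτ).2.2
    nlinarith
  choose! c hc using hbτ
  -- The open simplices in T contain disjoint balls of radius ρ² h_T, all inside a ball of radius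
  -- h_T; comparing volumes bounds their number.
  have hcard : (Θ.card : ℝ) * (ρ ^ 2) ^ d ≤ 1 := by
    obtain ⟨x₀, hx₀⟩ := hball
    have hr : 0 < ρ ^ 2 * M.hT T := by positivity
    have hx₀T : x₀ ∈ T.1 := hx₀ (Metric.mem_ball_self hr)
    have hsub : (⋃ τ ∈ Θ, Metric.ball (c τ) (ρ ^ 2 * M.hT T)) ⊆
        Metric.closedBall x₀ (M.hT T) := by
      refine Set.iUnion₂_subset fun τ hτ => (hc τ hτ).trans ?_
      exact ((hmem τ hτ).2.2.trans subset_closure).trans (M.closure_elem_subset_closedBall hx₀T)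
    have hvol := measure_mono (μ := (volume : Measure (E d))) hsub
    rw [measure_biUnion_finset (fun τ hτ τ' hτ' hne => by
        refine Set.disjoint_left.2 fun x hx hx' => hne ?_
        exact eq_of_openSimplex_inter (hmem τ hτ).1 (hmem τ' hτ').1
          ⟨x, hc τ hτ hx, hc τ' hτ' hx'⟩) (fun _ _ => measurableSet_ball)] at hvol
    rw [Finset.sum_congr rfl fun τ _ => Measure.addHaar_ball_of_pos volume (c τ) hr,
      Measure.addHaar_closedBall _ _ hh.le, finrank_euclideanSpace_fin] at hvol
    have hB : (volume (Metric.ball (0 : E d) 1)) ≠ ⊤ := measure_ball_lt_top.ne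
    have hB0 : 0 < (volume (Metric.ball (0 : E d) 1)).toReal :=
      ENNReal.toReal_pos (Metric.measure_ball_pos _ _ one_pos).ne' hB
    have hvol' := ENNReal.toReal_mono (ENNReal.mul_ne_top ENNReal.ofReal_ne_top hB) hvol
    rw [Finset.sum_const, nsmul_eq_mul, ENNReal.toReal_mul, ENNReal.toReal_mul, ENNReal.toReal_mul,
      ENNReal.toReal_natCast, ENNReal.toReal_ofReal (by positivity),
      ENNReal.toReal_ofReal (by positivity), ← mul_assoc] at hvol'
    have h3 := le_of_mul_le_mul_right hvol' hB0
    rw [mul_pow, ← mul_assoc] at h3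
    exact le_of_mul_le_mul_right (h3.trans_eq (one_mul _).symm) (by positivity)
  have hfac : ∀ F ∈ M.facesOf T, ∃ σ ∈ Θ.biUnion fun τ => τ.powersetCard d,
      σ.Nonempty ∧ openSimplex σ ⊆ F.1 := fun F hF => by
    obtain ⟨τ, hτ, a, ha, hσF, -⟩ := hK.exists_facet hd hF
    have hσc : (τ.erase a).card = d := by rw [Finset.card_erase_of_mem ha, hτ.2.1]; simp
    refine ⟨τ.erase a, Finset.mem_biUnion.2 ⟨τ, (Set.Finite.mem_toFinset _).2 hτ,
      Finset.mem_powersetCard.2 ⟨Finset.erase_subset _ _, hσc⟩⟩, ?_, hσF⟩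
    rw [← Finset.card_pos]; omega
  choose! g hg hgne hgF using hfac
  have hle : (M.facesOf T).card ≤ (Θ.biUnion fun τ => τ.powersetCard d).card := by
    -- Distinct faces are disjoint, so they cannot contain the same nonempty open facet. Each
    -- simplex has d + 1 facets.
    refine Finset.card_le_card_of_injOn g hg fun F hF F' hF' hgg => ?_
    by_contra hne
    obtain ⟨y, hy⟩ := hgne F hF
    have hz' : (openSimplex (g F)).Nonempty := by
      rw [← closure_nonempty_iff]
      exact ⟨y, convexHull_subset_closure_openSimplex (hgne F hF) (subset_convexHull ℝ _ hy)⟩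
    obtain ⟨z, hz⟩ := hz'
    have hzF' : z ∈ F'.1 := hgF F' hF' (hgg ▸ hz)
    exact Set.disjoint_left.1 (M.face_disjoint F.1 F.2 F'.1 F'.2
      (fun h => hne (Subtype.ext h))) (hgF F hF hz) hzF'
  have hle2 : (Θ.biUnion fun τ => τ.powersetCard d).card ≤ Θ.card * (d + 1) := by
    refine Finset.card_biUnion_le_card_mul _ _ _ fun τ hτ => ?_
    rw [Finset.card_powersetCard, (hmem τ hτ).2.1, Nat.choose_succ_self_right]
  have h5 : ((M.facesOf T).card : ℝ) ≤ Θ.card * (d + 1) := by exact_mod_cast hle.trans hle2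
  calc ((M.facesOf T).card : ℝ) * (ρ ^ 2) ^ d ≤ Θ.card * (d + 1) * (ρ ^ 2) ^ d := by gcongr
    _ = Θ.card * (ρ ^ 2) ^ d * (d + 1) := by ring
    _ ≤ 1 * (d + 1) := by gcongr
    _ = _ := one_mul _

/-- For d ≥ 2 the relative ball of radius ρ² h_T contains a point at half that distance from its
centre. For d = 1 the convention h_F = h_T applies and ρ ≤ 1 suffices. -/
lemma IsRegular.le_hF {T : M.elems} {F : M.faces} (hF : F ∈ M.facesOf T) (hρ1 : ρ < 1) :
    ρ ^ 2 / 2 * M.hT T ≤ M.hF T F := by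
  have hh := M.hT_pos hd T
  unfold PolytopalMesh.hF
  split_ifs with h1
  · have : ρ ^ 2 ≤ 1 := by nlinarith
    nlinarith
  · obtain ⟨y, hy, H, hH, hFH, hb⟩ := hM.exists_relative_ball_subset hρ hd hF
    have hnt : Nontrivial H.direction := Module.nontrivial_of_finrank_pos (R := ℝ) (by omega)
    obtain ⟨u, hu⟩ := exists_norm_eq H.direction (show (0 : ℝ) ≤ ρ ^ 2 / 2 * M.hT T by positivity)
    have hu' : ‖(u : E d)‖ = ρ ^ 2 / 2 * M.hT T := hu
    have hdist : dist ((u : E d) +ᵥ y) y = ρ ^ 2 / 2 * M.hT T := by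
      rw [dist_eq_norm, vadd_eq_add, add_sub_cancel_right, hu']
    have hz : (u : E d) +ᵥ y ∈ F.1 := by
      refine hb _ (AffineSubspace.vadd_mem_of_mem_direction u.2 (hFH hy)) ?_
      rw [hdist]
      have : 0 < ρ ^ 2 * M.hT T := by positivity
      linarith
    rw [← hdist]
    exact Metric.dist_le_diam_of_mem
      ((M.isBounded_elem T).closure.subset (M.face_subset_closure hF)) hz hy

omit hρ hM hd in
lemma hF_le_hT {T : M.elems} {F : M.faces} (hF : F ∈ M.facesOf T) :
    M.hF T F ≤ M.hT T := by
  unfold PolytopalMesh.hF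
  split_ifs with h1
  · exact le_rfl
  · unfold PolytopalMesh.hT
    rw [← Metric.diam_closure T.1]
    exact Metric.diam_mono (M.face_subset_closure hF) (M.isBounded_elem T).closure

end Regular

end PolytopalMesh

end HHO

/-! ### Uniform inverse inequalities on elements and faces -/

namespace HHO

open Module (finrank)

variable {d : ℕ}

lemma integrable_of_continuous {V : Type*} [NormedAddCommGroup V] {μ : Measure (E d)}
    [IsFiniteMeasure μ] {B : Set (E d)} (hB : Bornology.IsBounded B) (hμ : ∀ᵐ x ∂μ, x ∈ B)
    {f : E d → V} (hf : Continuous f) : Integrable f μ := by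
  obtain ⟨c, hc⟩ := hB.isCompact_closure.exists_bound_of_continuousOn hf.continuousOn
  exact Integrable.of_bound hf.aestronglyMeasurable c
    (hμ.mono fun x hx => hc x (subset_closure hx))

/-- A bounded region `B` carrying a finite measure `μ` of mass comparable to `W`, on which the
supremum of a polynomial of degree at most `l` is controlled by its means of order `p` and `2`. -/
structure PolyControl (l : ℕ) (p c W : ℝ) (μ : Measure (E d)) (B : Set (E d)) : Prop where
  finite : IsFiniteMeasure μ
  ae_mem : ∀ᵐ x ∂μ, x ∈ B
  bounded : Bornology.IsBounded B
  mass_le : μ.real Set.univ ≤ c * W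
  sup_rpow_le : ∀ q ∈ ElemPoly d l, ∀ x ∈ B, W * |pval q x| ^ p ≤ c * ∫ y, |pval q y| ^ p ∂μ
  sup_sq_le : ∀ q ∈ ElemPoly d l, ∀ x ∈ B, W * pval q x ^ 2 ≤ c * ∫ y, pval q y ^ 2 ∂μ

lemma PolyControl.mono {l : ℕ} {p c c' W : ℝ} {μ : Measure (E d)} {B : Set (E d)} (hW : 0 ≤ W)
    (h : PolyControl l p c W μ B) (hc : c ≤ c') : PolyControl l p c' W μ B where
  finite := h.finite
  ae_mem := h.ae_mem
  bounded := h.bounded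
  mass_le := h.mass_le.trans (by gcongr)
  sup_rpow_le q hq x hx := (h.sup_rpow_le q hq x hx).trans
    (mul_le_mul_of_nonneg_right hc (integral_nonneg fun y => by positivity))
  sup_sq_le q hq x hx := (h.sup_sq_le q hq x hx).trans
    (mul_le_mul_of_nonneg_right hc (integral_nonneg fun y => by positivity))

/-- The supremum is taken over a full ball containing T, although the means are over T only. The
ball is convex, so the mean value inequality is available there even when T is not convex. -/
lemma exists_polyControl_ball (d l : ℕ) {s : ℝ} (hs : 0 < s) {p : ℝ} (hp : 1 ≤ p) :
    ∃ c : ℝ, 0 < c ∧ ∀ (T : Set (E d)) (x₀ : E d) (h : ℝ), 0 < h → MeasurableSet T →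
      Metric.ball x₀ (s * h) ⊆ T → T ⊆ Metric.closedBall x₀ h →
      PolyControl l p c (h ^ d) (volume.restrict T) (Metric.closedBall x₀ h) := by
  obtain ⟨C₁, hC₁, H₁⟩ := exists_sup_le_integral d l hs hp
  obtain ⟨C₂, hC₂, H₂⟩ := exists_sup_le_integral d l hs (show (1 : ℝ) ≤ 2 by norm_num)
  refine ⟨max (volume.real (Metric.closedBall (0 : E d) 1)) (max C₁ C₂),
    lt_max_of_lt_right (lt_max_of_lt_left hC₁), fun T x₀ h hh hT hbT hTb => ?_⟩
  have hfin : IsFiniteMeasure (volume.restrict T) :=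
    ⟨by simpa using (measure_mono hTb).trans_lt measure_closedBall_lt_top⟩
  have hae : ∀ᵐ x ∂(volume.restrict T), x ∈ Metric.closedBall x₀ h :=
    (ae_restrict_iff' hT).2 (Eventually.of_forall hTb)
  have hmono : ∀ {f : E d → ℝ}, Continuous f → (∀ x, 0 ≤ f x) →
      ∫ y in Metric.ball x₀ (s * h), f y ≤ ∫ y in T, f y := fun {f} hf h0 =>
    setIntegral_mono_set (integrable_of_continuous Metric.isBounded_closedBall hae hf)
      (Eventually.of_forall h0) hbT.eventuallyLE
  refine ⟨hfin, hae, Metric.isBounded_closedBall, ?_, fun q hq x hx => ?_, fun q hq x hx => ?_⟩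
  · rw [measureReal_restrict_apply_univ]
    refine (measureReal_mono hTb measure_closedBall_lt_top.ne).trans ?_
    rw [measureReal_def, Measure.addHaar_closedBall' _ _ hh.le, ENNReal.toReal_mul,
      ENNReal.toReal_ofReal (by positivity), finrank_euclideanSpace_fin, mul_comm]
    gcongr
    exact le_max_left _ _
  · refine (H₁ q hq x₀ h hh x hx).trans ?_
    refine mul_le_mul ((le_max_left _ _).trans (le_max_right _ _)) (hmono ?_ fun x => by positivity)
      (integral_nonneg fun y => by positivity) (hC₁.le.trans ((le_max_left _ _).trans
        (le_max_right _ _)))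
    exact (continuous_pval q).abs.rpow_const fun _ => Or.inr (by linarith)
  · have := H₂ q hq x₀ h hh x hx
    simp only [Real.rpow_two, sq_abs] at this
    refine this.trans ?_
    refine mul_le_mul ((le_max_right _ _).trans (le_max_right _ _))
      (hmono ((continuous_pval q).pow 2) fun x => by positivity)
      (integral_nonneg fun y => by positivity) (hC₁.le.trans ((le_max_left _ _).trans
        (le_max_right _ _)))

lemma exists_affineIsometry_range_eq {n : ℕ} (H : AffineSubspace ℝ (E d))
    (hH : finrank ℝ H.direction = n) {y : E d} (hy : y ∈ H) :
    ∃ φ : E n →ᵃⁱ[ℝ] E d, φ 0 = y ∧ Set.range φ = H := by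
  let b := (stdOrthonormalBasis ℝ H.direction).reindex (finCongr hH)
  let L : E n →ₗᵢ[ℝ] E d := H.direction.subtypeₗᵢ.comp b.repr.symm.toLinearIsometry
  let φ : E n →ᵃⁱ[ℝ] E d :=
    (AffineIsometryEquiv.constVAdd ℝ (E d) y).toAffineIsometry.comp L.toAffineIsometry
  have hφ : ∀ z, φ z = y + L z := fun z => rfl
  refine ⟨φ, by simp [hφ], Set.ext fun z => ⟨?_, fun hz => ?_⟩⟩
  · rintro ⟨x, rfl⟩
    rw [hφ, add_comm]
    exact AffineSubspace.vadd_mem_of_mem_direction (b.repr.symm x).2 hy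
  · refine ⟨b.repr ⟨z - y, AffineSubspace.vsub_mem_direction hz hy⟩, ?_⟩
    rw [hφ]
    simp [L]

/-- The hyperplane of F is parametrized isometrically with y as image of the origin; the weight is
now h^(d-1). -/
lemma exists_polyControl_face (d l : ℕ) {s : ℝ} (hs : 0 < s) {p : ℝ} (hp : 1 ≤ p) :
    ∃ c : ℝ, 0 < c ∧ ∀ (F : Set (E d)) (y : E d) (h : ℝ) (H : AffineSubspace ℝ (E d)), 0 < h →
      y ∈ F → finrank ℝ H.direction = d - 1 → MeasurableSet F →
      F ⊆ H → (∀ z ∈ H, dist z y < s * h → z ∈ F) → F ⊆ Metric.closedBall y h →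
      PolyControl l p c (h ^ (d - 1)) (surf F) F := by
  obtain ⟨C₁, hC₁, H₁⟩ := exists_sup_le_integral_isometry (d - 1) d l hs hp
  obtain ⟨C₂, hC₂, H₂⟩ := exists_sup_le_integral_isometry (d - 1) d l hs
    (show (1 : ℝ) ≤ 2 by norm_num)
  refine ⟨max (volume.real (Metric.closedBall (0 : E (d - 1)) 1)) (max C₁ C₂),
    lt_max_of_lt_right (lt_max_of_lt_left hC₁), fun F y h H hh hy hH hF hFH hb hFb => ?_⟩
  obtain ⟨φ, rfl, hφ⟩ := exists_affineIsometry_range_eq H hH (hFH hy)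
  have hsub : F ⊆ φ '' Metric.closedBall 0 h := fun z hz => by
    obtain ⟨x, rfl⟩ : z ∈ Set.range φ := by rw [hφ]; exact hFH hz
    refine ⟨x, ?_, rfl⟩
    have := hFb hz
    rwa [Metric.mem_closedBall, φ.isometry.dist_eq] at this
  have hmeas : (μHE[d - 1] : Measure (E d)) F ≤
      volume (Metric.closedBall (0 : E (d - 1)) h) := by
    refine (measure_mono hsub).trans ?_
    rw [φ.isometry.euclideanHausdorffMeasure_image,
      EuclideanSpace.euclideanHausdorffMeasure_eq_volume]
  have hsurf : surf F Set.univ = (μHE[d - 1] : Measure (E d)) F := by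
    rw [surf, Measure.restrict_apply_univ]
  have hfin : IsFiniteMeasure (surf F) :=
    ⟨by rw [hsurf]; exact hmeas.trans_lt measure_closedBall_lt_top⟩
  have hae : ∀ᵐ x ∂(surf F), x ∈ F := ae_restrict_mem hF
  have hbd : Bornology.IsBounded F := Metric.isBounded_closedBall.subset hFb
  have hballF : Metric.ball (φ 0) (s * h) ∩ Set.range φ ⊆ F := fun z hz => by
    refine hb z ?_ hz.1
    have := hz.2
    rwa [hφ] at this
  have hmono : ∀ {f : E d → ℝ}, Continuous f → (∀ x, 0 ≤ f x) →
      ∫ y in Metric.ball (φ 0) (s * h) ∩ Set.range φ, f y ∂μHE[d - 1] ≤ ∫ y, f y ∂(surf F) :=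
    fun {f} hf h0 => setIntegral_mono_set (integrable_of_continuous hbd hae hf)
      (Eventually.of_forall h0) hballF.eventuallyLE
  have hx' : ∀ x ∈ F, x ∈ Metric.closedBall (φ 0) h ∩ Set.range φ := fun x hx =>
    ⟨hFb hx, by rw [hφ]; exact hFH hx⟩
  refine ⟨hfin, hae, hbd, ?_, fun q hq x hx => ?_, fun q hq x hx => ?_⟩
  · rw [measureReal_def, hsurf]
    refine (ENNReal.toReal_mono measure_closedBall_lt_top.ne hmeas).trans ?_
    rw [Measure.addHaar_closedBall' _ _ hh.le, ENNReal.toReal_mul,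
      ENNReal.toReal_ofReal (by positivity), finrank_euclideanSpace_fin, mul_comm]
    gcongr
    exact le_max_left _ _
  · refine (H₁ q hq φ h hh x (hx' x hx)).trans ?_
    refine mul_le_mul ((le_max_left _ _).trans (le_max_right _ _)) (hmono ?_ fun x => by positivity)
      (integral_nonneg fun y => by positivity) (hC₁.le.trans ((le_max_left _ _).trans
        (le_max_right _ _)))
    exact (continuous_pval q).abs.rpow_const fun _ => Or.inr (by linarith)
  · have := H₂ q hq φ h hh x (hx' x hx)
    simp only [Real.rpow_two, sq_abs] at this
    refine this.trans ?_
    refine mul_le_mul ((le_max_right _ _).trans (le_max_right _ _))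
      (hmono ((continuous_pval q).pow 2) fun x => by positivity)
      (integral_nonneg fun y => by positivity) (hC₁.le.trans ((le_max_left _ _).trans
        (le_max_right _ _)))

/-- The quantitative geometric information about an element `T` used in the local estimates. -/
structure ElemControl {Ω : Set (E d)} (M : PolytopalMesh d Ω) (l : ℕ) (p c : ℝ) (T : M.elems)
    (x₀ : E d) : Prop where
  elem : PolyControl l p c (M.hT T ^ d) (volume.restrict T.1) (Metric.closedBall x₀ (M.hT T))
  face : ∀ F ∈ M.facesOf T, PolyControl l p c (M.hT T ^ (d - 1)) (surf F.1) F.1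
  face_subset : ∀ F ∈ M.facesOf T, F.1 ⊆ Metric.closedBall x₀ (M.hT T)
  card_le : ((M.facesOf T).card : ℝ) ≤ c
  hT_le : ∀ F ∈ M.facesOf T, M.hT T ≤ c * M.hF T F

/-- The mesh geometry is condensed here: every later constant depends on the mesh only through `c`,
hence on d, l, p and ρ alone. -/
theorem exists_elemControl (hd : 1 ≤ d) (l : ℕ) {p : ℝ} (hp : 1 ≤ p) {ρ : ℝ}
    (hρ : ρ ∈ Set.Ioo (0 : ℝ) 1) :
    ∃ c : ℝ, 1 ≤ c ∧ ∀ (Ω : Set (E d)) (M : PolytopalMesh d Ω), M.IsRegular ρ →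
      ∀ T : M.elems, ∃ x₀, ElemControl M l p c T x₀ := by
  have hs : 0 < ρ ^ 2 := pow_pos hρ.1 2
  obtain ⟨c₁, hc₁, H₁⟩ := exists_polyControl_ball d l hs hp
  obtain ⟨c₂, hc₂, H₂⟩ := exists_polyControl_face d l hs hp
  -- The sum dominates each requirement: the two inverse inequalities, the number of faces, the
  -- ratio h_T / h_F, and the normalization 1 ≤ c.
  refine ⟨1 + c₁ + c₂ + (d + 1) / (ρ ^ 2) ^ d + 2 / ρ ^ 2, ?_, fun Ω M hM T => ?_⟩
  · have : 0 ≤ ((d : ℝ) + 1) / (ρ ^ 2) ^ d := by positivity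
    have : 0 ≤ 2 / ρ ^ 2 := by positivity
    linarith
  have e1 : 0 ≤ ((d : ℝ) + 1) / (ρ ^ 2) ^ d := by positivity
  have e2 : 0 ≤ 2 / ρ ^ 2 := by positivity
  have hh := M.hT_pos hd T
  obtain ⟨x₀, hx₀⟩ := hM.exists_ball_subset hρ.1 T
  have hx₀T : x₀ ∈ T.1 := hx₀ (Metric.mem_ball_self (by positivity))
  have hcl := M.closure_elem_subset_closedBall hx₀T
  refine ⟨x₀, ?_, fun F hF => ?_, fun F hF => ?_, ?_, fun F hF => ?_⟩
  · refine (H₁ T.1 x₀ _ hh (M.isOpen_elem T).measurableSet hx₀ (subset_closure.trans hcl)).mono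
      (by positivity) (by linarith)
  · obtain ⟨y, hy, H, hH, hFH, hb⟩ := hM.exists_relative_ball_subset hρ.1 hd hF
    refine (H₂ F.1 y _ H hh hy hH (M.measurableSet_face F) hFH hb fun z hz => ?_).mono
      (by positivity) (by linarith)
    rw [Metric.mem_closedBall, PolytopalMesh.hT, ← Metric.diam_closure T.1]
    exact Metric.dist_le_diam_of_mem (M.isBounded_elem T).closure (M.face_subset_closure hF hz)
      (M.face_subset_closure hF hy)
  · exact (M.face_subset_closure hF).trans hcl
  · have h1 := hM.card_facesOf_le hρ.1 hd T
    rw [← le_div_iff₀ (by positivity)] at h1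
    linarith
  · have h1 := hM.le_hF hρ.1 hd hF hρ.2
    have h2 : 0 < M.hF T F := by
      have : 0 < ρ ^ 2 / 2 * M.hT T := by positivity
      linarith
    have h3 : M.hT T ≤ 2 / ρ ^ 2 * M.hF T F := by
      rw [div_mul_eq_mul_div, le_div_iff₀ hs]
      linarith
    nlinarith

end HHO

/-! ### Gradients, and solvability of the variational problems -/

namespace HHO

open Module (finrank)

variable {d : ℕ}

section Vectors

@[simp] lemma vval_apply (Q : Fin d → Poly d) (x : E d) (i : Fin d) : vval Q x i = pval (Q i) x := rfl

@[simp] lemma vval_add (Q R : Fin d → Poly d) (x : E d) : vval (Q + R) x = vval Q x + vval R x := by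
  ext i; simp

@[simp] lemma vval_sub (Q R : Fin d → Poly d) (x : E d) : vval (Q - R) x = vval Q x - vval R x := by
  ext i; simp

@[simp] lemma vval_smul (c : ℝ) (Q : Fin d → Poly d) (x : E d) :
    vval (c • Q) x = c • vval Q x := by
  ext i; simp

@[simp] lemma vval_zero (x : E d) : vval (0 : Fin d → Poly d) x = 0 := by
  ext i; simp

lemma continuous_vval (Q : Fin d → Poly d) : Continuous (vval Q) :=
  (PiLp.continuous_toLp 2 _).comp (continuous_pi fun i => continuous_pval (Q i))

/-- The gradient as a linear map. -/
noncomputable def gradHom (d : ℕ) : Poly d →ₗ[ℝ] (Fin d → Poly d) where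
  toFun := grad
  map_add' q r := by funext i; simp [grad]
  map_smul' c q := by funext i; simp [grad]

lemma grad_sub (q r : Poly d) : grad (q - r) = grad q - grad r := (gradHom d).map_sub q r

lemma grad_add (q r : Poly d) : grad (q + r) = grad q + grad r := (gradHom d).map_add q r

lemma grad_C (c : ℝ) : grad (MvPolynomial.C c : Poly d) = 0 := by
  funext i; simp [grad]

lemma hasFDerivAt_pval (q : Poly d) (x : E d) :
    HasFDerivAt (pval q) (innerSL ℝ (vval (grad q) x)) x := by
  induction q using MvPolynomial.induction_on with
  | C a =>
    rw [grad_C, vval_zero, map_zero]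
    have : pval (MvPolynomial.C a : Poly d) = fun _ => a := by funext y; simp
    rw [this]
    exact hasFDerivAt_const a x
  | add p q hp hq =>
    rw [grad_add, vval_add, map_add]
    have : pval (p + q) = fun y => pval p y + pval q y := by funext y; simp
    rw [this]
    exact hp.add hq
  | mul_X p i hp =>
    have h1 : pval (p * MvPolynomial.X i) = fun y => pval p y * y i := by
      funext y; simp [pval]
    have h2 : HasFDerivAt (fun y : E d => y i)
        (EuclideanSpace.proj i : E d →L[ℝ] ℝ) x := (EuclideanSpace.proj i : E d →L[ℝ] ℝ).hasFDerivAt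
    rw [h1]
    refine (hp.mul h2).congr_fderiv ?_
    ext v
    have h3 : ∀ j, pval (grad (p * MvPolynomial.X i) j) x =
        (if j = i then pval p x else 0) + x i * pval (grad p j) x := by
      intro j
      by_cases hj : j = i
      · subst hj
        simp [grad, pval]
      · simp [grad, pval, MvPolynomial.pderiv_X_of_ne (Ne.symm hj), hj]
    simp only [add_apply, smul_apply,
      innerSL_apply_apply, PiLp.inner_apply, vval_apply, RCLike.inner_apply, conj_trivial,
      smul_eq_mul, h3, mul_add, Finset.sum_add_distrib, mul_ite, mul_zero, Finset.sum_ite_eq',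
      Finset.mem_univ, if_true, Finset.mul_sum, PiLp.proj_apply]
    refine congrArg₂ _ (mul_comm _ _) (Finset.sum_congr rfl fun j _ => by ring)

lemma abs_pval_sub_le {q : Poly d} {x₀ : E d} {h a : ℝ}
    (hq : ∀ x ∈ Metric.closedBall x₀ h, ‖vval (grad q) x‖ ≤ a) {x : E d}
    (hx : x ∈ Metric.closedBall x₀ h) (ha : 0 ≤ a) : |pval q x - pval q x₀| ≤ a * h := by
  have hh : 0 ≤ h := dist_nonneg.trans hx
  have := (convex_closedBall x₀ h).norm_image_sub_le_of_norm_hasFDerivWithin_le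
    (fun y _ => (hasFDerivAt_pval q y).hasFDerivWithinAt)
    (fun y hy => by rw [innerSL_apply_norm]; exact hq y hy) (Metric.mem_closedBall_self hh) hx
  refine this.trans ?_
  gcongr
  rwa [← dist_eq_norm]

end Vectors

section Existence

/-- Riesz representation in finite dimension: the Gram form is definite, so it maps `V` injectively,
hence onto, its dual. It guarantees that the objects defined through `Classical.epsilon` solve their
equations. -/
lemma exists_repr {V W : Type*} [AddCommGroup V] [Module ℝ V] [FiniteDimensional ℝ V]
    [NormedAddCommGroup W] [InnerProductSpace ℝ W] (μ : Measure (E d)) (J : V →ₗ[ℝ] (E d → W))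
    (hint : ∀ v w, Integrable (fun x => (inner ℝ (J v x) (J w x) : ℝ)) μ)
    (hdef : ∀ v, ∫ x, (inner ℝ (J v x) (J v x) : ℝ) ∂μ = 0 → v = 0) (ℓ : V →ₗ[ℝ] ℝ) :
    ∃ v, ∀ w, ∫ x, (inner ℝ (J v x) (J w x) : ℝ) ∂μ = ℓ w := by
  let B : V →ₗ[ℝ] V →ₗ[ℝ] ℝ := LinearMap.mk₂ ℝ
    (fun v w => ∫ x, (inner ℝ (J v x) (J w x) : ℝ) ∂μ)
    (fun v v' w => by
      rw [← integral_add (hint v w) (hint v' w)]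
      simp [inner_add_left])
    (fun c v w => by
      rw [smul_eq_mul, ← integral_const_mul]
      simp [real_inner_smul_left])
    (fun v w w' => by
      rw [← integral_add (hint v w) (hint v w')]
      simp [inner_add_right])
    (fun c v w => by
      rw [smul_eq_mul, ← integral_const_mul]
      simp [real_inner_smul_right])
  have hinj : Function.Injective B := by
    rw [injective_iff_map_eq_zero]
    intro v hv
    exact hdef v (by simpa [B] using LinearMap.congr_fun hv v)
  have hsurj : Function.Surjective B :=
    (LinearMap.injective_iff_surjective_of_finrank_eq_finrank
      (Subspace.dual_finrank_eq (K := ℝ) (V := V)).symm).1 hinj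
  obtain ⟨v, hv⟩ := hsurj ℓ
  exact ⟨v, fun w => by simpa [B] using LinearMap.congr_fun hv w⟩

/-- `vval` as a linear map. -/
noncomputable def vvalHom (d : ℕ) : (Fin d → Poly d) →ₗ[ℝ] (E d → E d) where
  toFun := vval
  map_add' Q R := by funext x; simp
  map_smul' c Q := by funext x; simp

/-- `pval` as a linear map. -/
noncomputable def pvalHom (d : ℕ) : Poly d →ₗ[ℝ] (E d → ℝ) where
  toFun := pval
  map_add' Q R := by funext x; simp
  map_smul' c Q := by funext x; simp

variable {T : Set (E d)} (hT : IsOpen T) (hb : Bornology.IsBounded T) (hne : T.Nonempty)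
include hT hb

lemma isFiniteMeasure_restrict : IsFiniteMeasure ((volume : Measure (E d)).restrict T) :=
  have := hT
  ⟨by simpa using hb.measure_lt_top⟩

lemma integrable_elem {V : Type*} [NormedAddCommGroup V] {f : E d → V} (hf : Continuous f) :
    Integrable f ((volume : Measure (E d)).restrict T) :=
  have := isFiniteMeasure_restrict hT hb
  integrable_of_continuous hb (ae_restrict_mem hT.measurableSet) hf

lemma eq_zero_of_integral_sq_eq_zero {V : Type*} [NormedAddCommGroup V] [InnerProductSpace ℝ V]
    {f : E d → V} (hf : Continuous f) (h : ∫ x in T, (inner ℝ (f x) (f x) : ℝ) = 0) :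
    ∀ x ∈ T, f x = 0 := by
  have hc : Continuous fun x => (inner ℝ (f x) (f x) : ℝ) := hf.inner hf
  rw [integral_eq_zero_iff_of_nonneg (fun x => real_inner_self_nonneg)
    (integrable_elem hT hb hc)] at h
  have h2 := Measure.eqOn_open_of_ae_eq h hT hc.continuousOn continuousOn_const
  exact fun x hx => inner_self_eq_zero.1 (h2 hx)

include hne

lemma eq_zero_of_integral_vval {Q : Fin d → Poly d}
    (h : ∫ x in T, (inner ℝ (vval Q x) (vval Q x) : ℝ) = 0) : Q = 0 := by
  have h1 := eq_zero_of_integral_sq_eq_zero hT hb (continuous_vval Q) h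
  funext i
  exact eq_zero_of_pval_eqOn_open hT hne fun x hx => by
    rw [← vval_apply, h1 x hx]; rfl

lemma exists_vval_repr (S : Submodule ℝ (Fin d → Poly d)) [FiniteDimensional ℝ S]
    (ℓ : (Fin d → Poly d) →ₗ[ℝ] ℝ) :
    ∃ Q ∈ S, ∀ τ ∈ S, ∫ x in T, (inner ℝ (vval Q x) (vval τ x) : ℝ) = ℓ τ := by
  obtain ⟨Q, hQ⟩ := exists_repr (volume.restrict T) ((vvalHom d).comp S.subtype)
    (fun v w => integrable_elem hT hb ((continuous_vval _).inner (continuous_vval _)))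
    (fun v hv => Subtype.ext (eq_zero_of_integral_vval hT hb hne hv)) (ℓ.comp S.subtype)
  exact ⟨Q, Q.2, fun τ hτ => hQ ⟨τ, hτ⟩⟩

lemma projElem_spec (l : ℕ) {f : E d → ℝ} (hf : Continuous f) :
    projElem l T f ∈ ElemPoly d l ∧
      ∀ w ∈ ElemPoly d l, ∫ x in T, (pval (projElem l T f) x - f x) * pval w x = 0 := by
  refine Classical.epsilon_spec (p := fun q => q ∈ ElemPoly d l ∧
    ∀ w ∈ ElemPoly d l, ∫ x in T, (pval q x - f x) * pval w x = 0) ?_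
  have hi : ∀ w : Poly d, Integrable (fun x => f x * pval w x) (volume.restrict T) := fun w =>
    integrable_elem hT hb (hf.mul (continuous_pval w))
  let ℓ : Poly d →ₗ[ℝ] ℝ :=
    { toFun := fun w => ∫ x in T, f x * pval w x
      map_add' := fun w w' => by
        rw [← integral_add (hi w) (hi w')]
        simp [mul_add]
      map_smul' := fun c w => by
        rw [RingHom.id_apply, smul_eq_mul, ← integral_const_mul]
        simp [mul_left_comm] }
  obtain ⟨q, hq⟩ := exists_repr (volume.restrict T) ((pvalHom d).comp (ElemPoly d l).subtype)
    (fun v w => integrable_elem hT hb ((continuous_pval _).inner (continuous_pval _)))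
    (fun v hv => Subtype.ext (eq_zero_of_pval_eqOn_open hT hne
      (eq_zero_of_integral_sq_eq_zero hT hb (continuous_pval _) hv)))
    (ℓ.comp (ElemPoly d l).subtype)
  refine ⟨q, q.2, fun w hw => ?_⟩
  have h1 := hq ⟨w, hw⟩
  have h2 : ∫ x in T, pval (q : Poly d) x * pval w x = ∫ x in T, f x * pval w x := by
    rw [show (∫ x in T, f x * pval w x) = (ℓ.comp (ElemPoly d l).subtype) ⟨w, hw⟩ from rfl, ← h1]
    refine integral_congr_ae (Eventually.of_forall fun x => ?_)
    change _ = inner ℝ (pval (q : Poly d) x) (pval w x)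
    simp [mul_comm]
  simp_rw [sub_mul]
  rw [integral_sub (integrable_elem hT hb (f := fun x => pval (q : Poly d) x * pval w x)
    ((continuous_pval _).mul (continuous_pval _))) (hi w), h2, sub_self]

end Existence

section Face

variable {F : Set (E d)} {k l : ℕ} {p c W : ℝ}

lemma exists_eq_pval_of_mem_facePoly {u : E d → ℝ} (hu : u ∈ FacePoly l F) :
    ∃ q ∈ ElemPoly d l, u = F.indicator (pval q) := by
  obtain ⟨q, hq, rfl⟩ := hu
  exact ⟨q, hq, rfl⟩

variable (hF : MeasurableSet F)
  (hc : PolyControl l p c W (surf F) F) (hW : 0 < W)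

include hc in
lemma integrable_face {f g : E d → ℝ} (hg : Continuous g) (hfg : ∀ x ∈ F, f x = g x) :
    Integrable f (surf F) := by
  have := hc.finite
  exact (integrable_of_continuous hc.bounded hc.ae_mem hg).congr
    (hc.ae_mem.mono fun x hx => (hfg x hx).symm)

include hc in
lemma integrable_face_mul {u w : E d → ℝ} (hu : u ∈ FacePoly k F) (hw : w ∈ FacePoly k F)
    {f : E d → ℝ} (hf : Continuous f) : Integrable (fun x => (u x - f x) * w x) (surf F) := by
  obtain ⟨q, -, rfl⟩ := exists_eq_pval_of_mem_facePoly hu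
  obtain ⟨r, -, rfl⟩ := exists_eq_pval_of_mem_facePoly hw
  refine integrable_face hc (((continuous_pval q).sub hf).mul (continuous_pval r)) fun x hx => ?_
  rw [Set.indicator_of_mem hx, Set.indicator_of_mem hx]
  rfl

-- F has no interior in the ambient space, so definiteness comes from the inverse inequality
-- instead: a polynomial with zero quadratic mean on F vanishes at every point of F. Extension by
-- zero makes it vanish elsewhere too.
include hc hW in
lemma projFace_spec (hk : k ≤ l) {f g : E d → ℝ} (hg : Continuous g) (hfg : ∀ x ∈ F, f x = g x) :
    projFace k F f ∈ FacePoly k F ∧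
      ∀ w ∈ FacePoly k F, ∫ x, (projFace k F f x - f x) * w x ∂(surf F) = 0 := by
  refine Classical.epsilon_spec (p := fun q => q ∈ FacePoly k F ∧
    ∀ w ∈ FacePoly k F, ∫ x, (q x - f x) * w x ∂(surf F) = 0) ?_
  have h0 : (0 : E d → ℝ) ∈ FacePoly k F := Submodule.zero_mem _
  have hint : ∀ w ∈ FacePoly k F, Integrable (fun x => f x * w x) (surf F) := fun w hw => by
    obtain ⟨r, -, rfl⟩ := exists_eq_pval_of_mem_facePoly hw
    refine integrable_face hc (hg.mul (continuous_pval r)) fun x hx => ?_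
    rw [Set.indicator_of_mem hx, hfg x hx]
    rfl
  have hint2 : ∀ u ∈ FacePoly k F, ∀ w ∈ FacePoly k F,
      Integrable (fun x => u x * w x) (surf F) := fun u hu w hw => by
    simpa using integrable_face_mul hc hu hw (f := fun _ => 0) continuous_const
  let ℓ : FacePoly k F →ₗ[ℝ] ℝ :=
    { toFun := fun w => ∫ x, f x * w.1 x ∂(surf F)
      map_add' := fun w w' => by
        rw [← integral_add (hint _ w.2) (hint _ w'.2)]
        simp [mul_add]
      map_smul' := fun c w => by
        rw [RingHom.id_apply, smul_eq_mul, ← integral_const_mul]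
        simp [mul_left_comm] }
  have : FiniteDimensional ℝ (FacePoly k F) := by unfold FacePoly; infer_instance
  obtain ⟨q, hq⟩ := exists_repr (surf F) (FacePoly k F).subtype
    (fun v w => by
      refine (hint2 _ v.2 _ w.2).congr (Eventually.of_forall fun x => ?_)
      simp [mul_comm])
    (fun v hv => by
      obtain ⟨q, hq, hvq⟩ := exists_eq_pval_of_mem_facePoly v.2
      refine Subtype.ext ?_
      have h1 : ∫ y, pval q y ^ 2 ∂(surf F) = 0 := by
        rw [← hv]
        refine integral_congr_ae (hc.ae_mem.mono fun x hx => ?_)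
        simp only [Submodule.subtype_apply, hvq, Set.indicator_of_mem hx]
        simp [sq]
      rw [hvq]
      funext x
      by_cases hx : x ∈ F
      · have h2 := hc.sup_sq_le q (elemPoly_mono hk hq) x hx
        rw [h1, mul_zero] at h2
        have h3 : pval q x ^ 2 ≤ 0 := nonpos_of_mul_nonpos_right h2 hW
        rw [Set.indicator_of_mem hx]
        exact pow_eq_zero_iff (two_ne_zero) |>.1 (le_antisymm h3 (sq_nonneg _))
      · rw [Set.indicator_of_notMem hx]; rfl) ℓ
  refine ⟨q, q.2, fun w hw => ?_⟩
  have h1 := hq ⟨w, hw⟩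
  have h2 : ∫ x, (q : E d → ℝ) x * w x ∂(surf F) = ∫ x, f x * w x ∂(surf F) := by
    rw [show (∫ x, f x * w x ∂(surf F)) = ℓ ⟨w, hw⟩ from rfl, ← h1]
    refine integral_congr_ae (Eventually.of_forall fun x => ?_)
    simp [mul_comm]
  simp_rw [sub_mul]
  rw [integral_sub (hint2 _ q.2 _ hw) (hint _ hw), h2, sub_self]

end Face

end HHO

/-! ### Well-posedness and linearity of the reconstructions -/

namespace HHO

open Module (finrank)

variable {d : ℕ} {Ω : Set (E d)} {M : PolytopalMesh d Ω} {k : ℕ} {p c : ℝ} {T : M.elems} {x₀ : E d}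

lemma elemPart_mem (v : Space M k) (T : M.elems) : elemPart v T ∈ ElemPoly d k := (v.1 T).2

lemma facePart_mem (v : Space M k) (F : M.faces) : facePart v F ∈ FacePoly k F.1 := (v.2 F).2

@[simp] lemma elemPart_sub (v w : Space M k) (T : M.elems) :
    elemPart (v - w) T = elemPart v T - elemPart w T := rfl

@[simp] lemma facePart_sub (v w : Space M k) (F : M.faces) (x : E d) :
    facePart (v - w) F x = facePart v F x - facePart w F x := rfl

/-- The difference `v_F - v_T` of the face and element components. -/
noncomputable def jump (v : Space M k) (T : M.elems) (F : M.faces) (x : E d) : ℝ :=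
  facePart v F x - pval (elemPart v T) x

lemma jump_sub (v w : Space M k) (T : M.elems) (F : M.faces) (x : E d) :
    jump (v - w) T F x = jump v T F x - jump w T F x := by
  simp [jump]; ring

lemma exists_jump_eq (v : Space M k) (T : M.elems) (F : M.faces) :
    ∃ q ∈ ElemPoly d k, ∀ x ∈ F.1, jump v T F x = pval q x := by
  obtain ⟨q, hq, h⟩ := exists_eq_pval_of_mem_facePoly (facePart_mem v F)
  refine ⟨q - elemPart v T, Submodule.sub_mem _ hq (elemPart_mem v T), fun x hx => ?_⟩
  rw [jump, h, Set.indicator_of_mem hx, pval_sub]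

lemma norm_normal_le (T : M.elems) (F : M.faces) : ‖M.normal T F‖ ≤ 1 := by
  unfold PolytopalMesh.normal
  split_ifs with h
  · exact (M.exists_normal T.1 T.2 F.1 F.2 h).choose_spec.1.le
  · simp

lemma integrable_on_elem (T : M.elems) {V : Type*} [NormedAddCommGroup V] {f : E d → V}
    (hf : Continuous f) : Integrable f (volume.restrict T.1) :=
  integrable_elem (M.isOpen_elem T) (M.isBounded_elem T) hf

variable (hT : ElemControl M (k + 1) p c T x₀)
include hT

lemma integrable_jump (v : Space M k) {F : M.faces} (hF : F ∈ M.facesOf T) {g : E d → ℝ}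
    (hg : Continuous g) : Integrable (fun x => jump v T F x * g x) (surf F.1) := by
  obtain ⟨q, -, h⟩ := exists_jump_eq v T F
  refine integrable_face (hT.face F hF) ((continuous_pval q).mul hg) fun x hx => ?_
  rw [h x hx]
  rfl

/-- The right-hand side of the equations defining the gradient reconstruction. -/
noncomputable def gradFunctional (v : Space M k) :
    (Fin d → Poly d) →ₗ[ℝ] ℝ where
  toFun τ := (∫ x in T.1, inner ℝ (vval (grad (elemPart v T)) x) (vval τ x)) +
        ∑ F ∈ M.facesOf T, ∫ x, jump v T F x * inner ℝ (vval τ x) (M.normal T F) ∂(surf F.1)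
  map_add' τ τ' := by
    have h1 : ∀ τ, Integrable (fun x => inner ℝ (vval (grad (elemPart v T)) x) (vval τ x))
        (volume.restrict T.1) := fun τ =>
      integrable_on_elem T ((continuous_vval _).inner (continuous_vval τ))
    have h2 : ∀ F ∈ M.facesOf T, ∀ τ, Integrable
        (fun x => jump v T F x * inner ℝ (vval τ x) (M.normal T F)) (surf F.1) := fun F hF τ =>
      integrable_jump hT v hF ((continuous_vval τ).inner continuous_const)
    simp only [vval_add, inner_add_right, inner_add_left, mul_add]
    rw [integral_add (h1 τ) (h1 τ'),
      Finset.sum_congr rfl fun F hF => integral_add (h2 F hF τ) (h2 F hF τ'),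
      Finset.sum_add_distrib]
    ring
  map_smul' a τ := by
    simp only [vval_smul, real_inner_smul_right, real_inner_smul_left, RingHom.id_apply,
      smul_eq_mul, mul_add, Finset.mul_sum, mul_left_comm, integral_const_mul]

lemma gradRec_spec (v : Space M k) : (∀ i, gradRec v T i ∈ ElemPoly d k) ∧
    ∀ τ : Fin d → Poly d, (∀ i, τ i ∈ ElemPoly d k) →
      ∫ x in T.1, inner ℝ (vval (gradRec v T) x) (vval τ x) =
        (∫ x in T.1, inner ℝ (vval (grad (elemPart v T)) x) (vval τ x)) +
        ∑ F ∈ M.facesOf T, ∫ x, jump v T F x * inner ℝ (vval τ x) (M.normal T F) ∂(surf F.1) := by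
  refine Classical.epsilon_spec (p := fun G : Fin d → Poly d => (∀ i, G i ∈ ElemPoly d k) ∧
    ∀ τ : Fin d → Poly d, (∀ i, τ i ∈ ElemPoly d k) →
      ∫ x in T.1, inner ℝ (vval G x) (vval τ x) =
        (∫ x in T.1, inner ℝ (vval (grad (elemPart v T)) x) (vval τ x)) +
        ∑ F ∈ M.facesOf T, ∫ x, (facePart v F x - pval (elemPart v T) x) *
          inner ℝ (vval τ x) (M.normal T F) ∂(surf F.1)) ?_
  -- The space P^k(T)^d, written as the range of a map from a product of finite-dimensional spaces
  -- so that its finite dimension is inferred.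
  let S : Submodule ℝ (Fin d → Poly d) := LinearMap.range
    (LinearMap.pi fun i : Fin d => (ElemPoly d k).subtype.comp
      (LinearMap.proj (φ := fun _ : Fin d => ElemPoly d k) i))
  obtain ⟨G, hGS, hG⟩ := exists_vval_repr (M.isOpen_elem T) (M.isBounded_elem T)
    (M.nonempty_elem T) S (gradFunctional hT v)
  refine ⟨G, fun i => ?_, fun τ hτ => hG τ ⟨fun i => ⟨τ i, hτ i⟩, rfl⟩⟩
  obtain ⟨g, rfl⟩ := hGS
  exact (g i).2

/-- Uniqueness: the defect of linearity `τ` is itself admissible, and testing the three defining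
equations with it gives a vanishing quadratic integral. -/
lemma gradRec_sub (v w : Space M k) : gradRec (v - w) T = gradRec v T - gradRec w T := by
  have hv := gradRec_spec hT v
  have hw := gradRec_spec hT w
  have hvw := gradRec_spec hT (v - w)
  rw [← sub_eq_zero]
  refine eq_zero_of_integral_vval (M.isOpen_elem T) (M.isBounded_elem T) (M.nonempty_elem T) ?_
  set τ := gradRec (v - w) T - (gradRec v T - gradRec w T) with hτ
  have hτm : ∀ i, τ i ∈ ElemPoly d k := fun i =>
    Submodule.sub_mem _ (hvw.1 i) (Submodule.sub_mem _ (hv.1 i) (hw.1 i))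
  have hi : ∀ Q : Fin d → Poly d, Integrable (fun x => (inner ℝ (vval Q x) (vval τ x) : ℝ))
      (volume.restrict T.1) := fun Q =>
    integrable_on_elem T ((continuous_vval _).inner (continuous_vval τ))
  have h1 : ∀ x, (inner ℝ (vval τ x) (vval τ x) : ℝ) = inner ℝ (vval (gradRec (v - w) T) x) (vval τ x)
      - inner ℝ (vval (gradRec v T - gradRec w T) x) (vval τ x) := by
    intro x
    rw [← inner_sub_left, ← vval_sub]
  have h4 : ∫ x in T.1, (inner ℝ (vval (gradRec v T - gradRec w T) x) (vval τ x) : ℝ) =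
      (∫ x in T.1, inner ℝ (vval (gradRec v T) x) (vval τ x)) -
        ∫ x in T.1, inner ℝ (vval (gradRec w T) x) (vval τ x) := by
    rw [← integral_sub (hi _) (hi _)]
    simp [inner_sub_left]
  simp_rw [h1]
  rw [integral_sub (hi _) (hi _), h4, hvw.2 τ hτm, hv.2 τ hτm, hw.2 τ hτm]
  have h2 : ∫ x in T.1, (inner ℝ (vval (grad (elemPart (v - w) T)) x) (vval τ x) : ℝ) =
      (∫ x in T.1, inner ℝ (vval (grad (elemPart v T)) x) (vval τ x)) -
        ∫ x in T.1, inner ℝ (vval (grad (elemPart w T)) x) (vval τ x) := by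
    rw [← integral_sub (hi _) (hi _)]
    simp [grad_sub, inner_sub_left]
  have h3 : ∑ F ∈ M.facesOf T,
        ∫ x, jump (v - w) T F x * inner ℝ (vval τ x) (M.normal T F) ∂(surf F.1) =
      (∑ F ∈ M.facesOf T, ∫ x, jump v T F x * inner ℝ (vval τ x) (M.normal T F) ∂(surf F.1)) -
      ∑ F ∈ M.facesOf T, ∫ x, jump w T F x * inner ℝ (vval τ x) (M.normal T F) ∂(surf F.1) := by
    rw [← Finset.sum_sub_distrib]
    refine Finset.sum_congr rfl fun F hF => ?_
    rw [← integral_sub (integrable_jump hT v hF ((continuous_vval τ).inner continuous_const))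
      (integrable_jump hT w hF ((continuous_vval τ).inner continuous_const))]
    simp [jump_sub, sub_mul]
  rw [h2, h3]
  ring

-- Only the elliptic equation is kept. The mean value fixes r up to an additive constant, and
-- constants cancel in the boundary residual.
omit hT in
lemma potRec_spec (v : Space M k) : potRec v T ∈ ElemPoly d (k + 1) ∧
    ∀ w ∈ ElemPoly d (k + 1),
      ∫ x in T.1, inner ℝ (vval (grad (potRec v T)) x - vval (gradRec v T) x) (vval (grad w) x)
        = 0 := by
  suffices h : potRec v T ∈ ElemPoly d (k + 1) ∧
    (∀ w ∈ ElemPoly d (k + 1),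
      ∫ x in T.1, inner ℝ (vval (grad (potRec v T)) x - vval (gradRec v T) x) (vval (grad w) x)
        = 0) ∧ ∫ x in T.1, pval (potRec v T) x = ∫ x in T.1, pval (elemPart v T) x from ⟨h.1, h.2.1⟩
  refine Classical.epsilon_spec (p := fun r => r ∈ ElemPoly d (k + 1) ∧
    (∀ w ∈ ElemPoly d (k + 1),
      ∫ x in T.1, inner ℝ (vval (grad r) x - vval (gradRec v T) x) (vval (grad w) x) = 0) ∧
    ∫ x in T.1, pval r x = ∫ x in T.1, pval (elemPart v T) x) ?_
  have hi : ∀ Q τ : Fin d → Poly d, Integrable (fun x => (inner ℝ (vval Q x) (vval τ x) : ℝ))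
      (volume.restrict T.1) := fun Q τ =>
    integrable_on_elem T ((continuous_vval _).inner (continuous_vval τ))
  let ℓ : (Fin d → Poly d) →ₗ[ℝ] ℝ :=
    { toFun := fun τ => ∫ x in T.1, inner ℝ (vval (gradRec v T) x) (vval τ x)
      map_add' := fun τ τ' => by
        rw [← integral_add (hi _ τ) (hi _ τ')]
        simp [inner_add_right]
      map_smul' := fun a τ => by
        rw [RingHom.id_apply, smul_eq_mul, ← integral_const_mul]
        simp [real_inner_smul_right] }
  obtain ⟨Q, ⟨r, hr, rfl⟩, hQ⟩ := exists_vval_repr (M.isOpen_elem T) (M.isBounded_elem T)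
    (M.nonempty_elem T) ((ElemPoly d (k + 1)).map (gradHom d)) ℓ
  have hm : 0 < (volume : Measure (E d)).real T.1 :=
    ENNReal.toReal_pos ((M.isOpen_elem T).measure_pos _ (M.nonempty_elem T)).ne'
      (M.isBounded_elem T).measure_lt_top.ne
  -- Constants have zero gradient, so adding one corrects the mean without disturbing the elliptic
  -- equation.
  set a := ((∫ x in T.1, pval (elemPart v T) x) - ∫ x in T.1, pval r x) /
    (volume : Measure (E d)).real T.1 with ha
  refine ⟨r + MvPolynomial.C a, Submodule.add_mem _ hr (C_mem_elemPoly _ _), fun w hw => ?_, ?_⟩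
  · have h1 := hQ (grad w) ⟨w, hw, rfl⟩
    simp only [grad_add, grad_C, add_zero, inner_sub_left]
    rw [integral_sub (hi _ _) (hi _ _), sub_eq_zero]
    exact h1
  · simp only [pval_add, pval_C]
    rw [integral_add (integrable_on_elem T (continuous_pval r))
      (integrable_on_elem T continuous_const), setIntegral_const, smul_eq_mul, ha]
    field_simp
    ring

end HHO

/-! ### Pointwise stability of projections and residuals -/

namespace HHO

variable {d : ℕ}

section Control

variable {l : ℕ} {p c W : ℝ} {μ : Measure (E d)} {B : Set (E d)}

/-- If the supremum of `‖f‖` is controlled by its quadratic mean, and the latter by a linear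
functional of size `b`, then `‖f‖` is controlled by `b`. -/
lemma norm_le_of_sq_le {V : Type*} [NormedAddCommGroup V] {f : E d → V} {I b : ℝ} (hW : 0 < W)
    (hc : 0 ≤ c) (hb : 0 ≤ b) (hf : ∀ x ∈ B, W * ‖f x‖ ^ 2 ≤ c * I)
    (hI : ∀ s, 0 ≤ s → (∀ x ∈ B, ‖f x‖ ≤ s) → I ≤ b * W * s) : ∀ x ∈ B, ‖f x‖ ≤ c * b := by
  intro x hx
  have hcI : 0 ≤ c * I := (by positivity : (0 : ℝ) ≤ W * ‖f x‖ ^ 2).trans (hf x hx)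
  -- This is the bound on the supremum given by the quadratic mean. Inserting it in the hypothesis
  -- on I yields s² ≤ c b s, and one factor s cancels.
  set s := √(c * I / W) with hs
  have hs0 : 0 ≤ s := Real.sqrt_nonneg _
  have hs2 : s ^ 2 = c * I / W := Real.sq_sqrt (by positivity)
  have hfs : ∀ x ∈ B, ‖f x‖ ≤ s := fun x hx => by
    refine Real.le_sqrt_of_sq_le ?_
    rw [le_div_iff₀ hW, mul_comm]
    exact hf x hx
  have h1 := hI s hs0 hfs
  have h2 : s ^ 2 ≤ c * b * s := by
    rw [hs2, div_le_iff₀ hW]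
    calc c * I ≤ c * (b * W * s) := by gcongr
      _ = _ := by ring
  refine (hfs x hx).trans ?_
  rcases hs0.eq_or_lt with h0 | h0
  · rw [← h0]; positivity
  · exact le_of_mul_le_mul_right (by rwa [sq] at h2) h0

variable (hμ : PolyControl l p c W μ B)
include hμ

lemma PolyControl.integrable {V : Type*} [NormedAddCommGroup V] {f : E d → V}
    (hf : Continuous f) : Integrable f μ :=
  have := hμ.finite
  integrable_of_continuous hμ.bounded hμ.ae_mem hf

lemma PolyControl.integral_le {f : E d → ℝ} {a : ℝ} (ha : 0 ≤ a) (hf : ∀ᵐ x ∂μ, |f x| ≤ a) :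
    |∫ x, f x ∂μ| ≤ a * (c * W) := by
  have := hμ.finite
  have h1 : ∀ᵐ x ∂μ, ‖f x‖ ≤ a := hf
  refine (norm_integral_le_of_norm_le_const h1).trans ?_
  exact mul_le_mul_of_nonneg_left hμ.mass_le ha

lemma PolyControl.vval_sq_le {Q : Fin d → Poly d} (hQ : ∀ i, Q i ∈ ElemPoly d l) :
    ∀ x ∈ B, W * ‖vval Q x‖ ^ 2 ≤ c * ∫ y, inner ℝ (vval Q y) (vval Q y) ∂μ := by
  intro x hx
  have h1 : ∀ y, (inner ℝ (vval Q y) (vval Q y) : ℝ) = ∑ i, pval (Q i) y ^ 2 := fun y => by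
    rw [real_inner_self_eq_norm_sq, EuclideanSpace.norm_sq_eq]
    simp
  simp_rw [h1]
  rw [integral_finsetSum _ fun i _ => hμ.integrable (f := fun y => pval (Q i) y ^ 2)
      ((continuous_pval (Q i)).pow 2),
    ← real_inner_self_eq_norm_sq, h1, Finset.mul_sum, Finset.mul_sum]
  exact Finset.sum_le_sum fun i _ => hμ.sup_sq_le (Q i) (hQ i) x hx

/-- The scalar inequality is applied to the component that is largest at x; the Euclidean norm is at
most d times it, whence the factor d^p. -/
lemma PolyControl.vval_rpow_le (hd : 1 ≤ d) (hW : 0 ≤ W) (hc : 0 ≤ c) (hp : 1 ≤ p)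
    {Q : Fin d → Poly d} (hQ : ∀ i, Q i ∈ ElemPoly d l) :
    ∀ x ∈ B, W * ‖vval Q x‖ ^ p ≤ (d : ℝ) ^ p * c * ∫ y, ‖vval Q y‖ ^ p ∂μ := by
  intro x hx
  have hp0 : 0 ≤ p := by linarith
  have : Nonempty (Fin d) := ⟨⟨0, hd⟩⟩
  obtain ⟨i, -, hi⟩ := Finset.exists_max_image Finset.univ (fun i => |pval (Q i) x|)
    Finset.univ_nonempty
  have hd1 : (1 : ℝ) ≤ d := by exact_mod_cast hd
  have h1 : ‖vval Q x‖ ≤ d * |pval (Q i) x| := by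
    refine abs_le_of_sq_le_sq' ?_ (by positivity) |>.2
    rw [EuclideanSpace.norm_sq_eq]
    calc ∑ j, ‖vval Q x j‖ ^ 2 ≤ ∑ _j : Fin d, |pval (Q i) x| ^ 2 :=
          Finset.sum_le_sum fun j hj => by
            have := hi j hj
            rw [vval_apply, Real.norm_eq_abs]
            gcongr
      _ = d * |pval (Q i) x| ^ 2 := by simp
      _ ≤ d * d * |pval (Q i) x| ^ 2 := by
        gcongr
        nlinarith
      _ = _ := by ring
  have h2 : ∫ y, |pval (Q i) y| ^ p ∂μ ≤ ∫ y, ‖vval Q y‖ ^ p ∂μ := by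
    refine integral_mono (hμ.integrable ((continuous_pval (Q i)).abs.rpow_const fun _ => Or.inr hp0))
      (hμ.integrable ((continuous_vval Q).norm.rpow_const fun _ => Or.inr hp0)) fun y => ?_
    have : |pval (Q i) y| ≤ ‖vval Q y‖ := PiLp.norm_apply_le (vval Q y) i
    dsimp only
    gcongr
  calc W * ‖vval Q x‖ ^ p ≤ W * (d * |pval (Q i) x|) ^ p := by gcongr
    _ = (d : ℝ) ^ p * (W * |pval (Q i) x| ^ p) := by
      rw [Real.mul_rpow (by positivity) (by positivity)]; ring
    _ ≤ (d : ℝ) ^ p * (c * ∫ y, |pval (Q i) y| ^ p ∂μ) := by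
      exact mul_le_mul_of_nonneg_left (hμ.sup_rpow_le _ (hQ i) x hx) (by positivity)
    _ ≤ (d : ℝ) ^ p * (c * ∫ y, ‖vval Q y‖ ^ p ∂μ) := by gcongr
    _ = _ := by ring

end Control

variable {Ω : Set (E d)} {M : PolytopalMesh d Ω} {k : ℕ} {p c : ℝ} {T : M.elems} {x₀ : E d}

/-- `r` is a potential with gradient the elliptic projection of `G`, and `u` and `q` are the
`L²`-orthogonal projections of `r` on the polynomials of degree at most `k` of `F` and `T`. -/
structure IsResidual (k : ℕ) (T F : Set (E d)) (G : Fin d → Poly d) (r : Poly d) (u : E d → ℝ)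
    (q : Poly d) : Prop where
  pot_mem : r ∈ ElemPoly d (k + 1)
  face_mem : u ∈ FacePoly k F
  elem_mem : q ∈ ElemPoly d k
  pot : ∀ w ∈ ElemPoly d (k + 1),
    ∫ x in T, (inner ℝ (vval (grad r) x - vval G x) (vval (grad w) x) : ℝ) = 0
  elem : ∀ w ∈ ElemPoly d k, ∫ x in T, (pval q x - pval r x) * pval w x = 0
  face : ∀ w ∈ FacePoly k F, ∫ x, (u x - pval r x) * w x ∂(surf F) = 0

section Residual

variable (hT : ElemControl M (k + 1) p c T x₀)
include hT

lemma IsResidual.sub {F : M.faces} (hF : F ∈ M.facesOf T) {G G' : Fin d → Poly d} {r r' : Poly d}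
    {u u' : E d → ℝ} {q q' : Poly d} (h : IsResidual k T.1 F.1 G r u q)
    (h' : IsResidual k T.1 F.1 G' r' u' q') :
    IsResidual k T.1 F.1 (G - G') (r - r') (u - u') (q - q') where
  pot_mem := Submodule.sub_mem _ h.pot_mem h'.pot_mem
  face_mem := Submodule.sub_mem _ h.face_mem h'.face_mem
  elem_mem := Submodule.sub_mem _ h.elem_mem h'.elem_mem
  pot w hw := by
    have e : ∀ x, (inner ℝ (vval (grad (r - r')) x - vval (G - G') x) (vval (grad w) x) : ℝ) =
        inner ℝ (vval (grad r) x - vval G x) (vval (grad w) x) -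
          inner ℝ (vval (grad r') x - vval G' x) (vval (grad w) x) := fun x => by
      rw [← inner_sub_left, grad_sub, vval_sub, vval_sub]
      congr 1
      abel
    have hi : ∀ (r : Poly d) (G : Fin d → Poly d), Integrable
        (fun x => (inner ℝ (vval (grad r) x - vval G x) (vval (grad w) x) : ℝ))
        (volume.restrict T.1) := fun r G => integrable_on_elem T
      (((continuous_vval _).sub (continuous_vval G)).inner (continuous_vval _))
    simp_rw [e]
    rw [integral_sub (hi _ _) (hi _ _), h.pot w hw, h'.pot w hw, sub_zero]
  elem w hw := by
    have e : ∀ x, (pval (q - q') x - pval (r - r') x) * pval w x =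
        (pval q x - pval r x) * pval w x - (pval q' x - pval r' x) * pval w x := fun x => by
      rw [pval_sub, pval_sub]; ring
    have hi : ∀ q r : Poly d, Integrable (fun x => (pval q x - pval r x) * pval w x)
        (volume.restrict T.1) := fun q r => integrable_on_elem T
      (((continuous_pval q).sub (continuous_pval r)).mul (continuous_pval w))
    simp_rw [e]
    rw [integral_sub (hi _ _) (hi _ _), h.elem w hw, h'.elem w hw, sub_zero]
  face w hw := by
    have e : ∀ x, ((u - u') x - pval (r - r') x) * w x =
        (u x - pval r x) * w x - (u' x - pval r' x) * w x := fun x => by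
      rw [pval_sub, Pi.sub_apply]; ring
    simp_rw [e]
    rw [integral_sub (integrable_face_mul (hT.face F hF) h.face_mem hw (continuous_pval r))
      (integrable_face_mul (hT.face F hF) h'.face_mem hw (continuous_pval r')), h.face w hw,
      h'.face w hw, sub_zero]

/-- The elliptic projection gives |∇r| ≤ c² a, so r stays within b = c² h_T a of r(x₀) on the ball.
Both projections fix constants and are stable in the supremum up to c², so each stays within c² b of
r(x₀). For a = 0 it follows that u - q on F is determined by G. -/
lemma IsResidual.abs_sub_le (hd : 1 ≤ d) (hc : 1 ≤ c) {F : M.faces} (hF : F ∈ M.facesOf T)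
    {G : Fin d → Poly d} {r : Poly d} {u : E d → ℝ} {q : Poly d}
    (h : IsResidual k T.1 F.1 G r u q) {a : ℝ} (ha : 0 ≤ a)
    (hG : ∀ x ∈ Metric.closedBall x₀ (M.hT T), ‖vval G x‖ ≤ a) :
    ∀ x ∈ F.1, |u x - pval q x| ≤ 2 * c ^ 4 * M.hT T * a := by
  have hh := M.hT_pos hd T
  set B := Metric.closedBall x₀ (M.hT T) with hB
  have hc0 : 0 ≤ c := by linarith
  have hgrad : ∀ x ∈ B, ‖vval (grad r) x‖ ≤ c * (c * a) := by
    refine norm_le_of_sq_le (W := M.hT T ^ d) (by positivity) hc0 (by positivity)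
      (hT.elem.vval_sq_le fun i => elemPoly_mono (Nat.le_succ k) (grad_mem_elemPoly h.pot_mem i))
      fun s hs hrs => ?_
    have h1 := h.pot r h.pot_mem
    simp_rw [inner_sub_left] at h1
    rw [integral_sub
      (integrable_on_elem T ((continuous_vval (grad r)).inner (continuous_vval (grad r))))
      (integrable_on_elem T ((continuous_vval G).inner (continuous_vval (grad r)))),
      sub_eq_zero] at h1
    rw [h1]
    refine (le_abs_self _).trans ((hT.elem.integral_le (a := a * s) (by positivity) ?_).trans_eq
      (by ring))
    filter_upwards [hT.elem.ae_mem] with x hx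
    exact (abs_real_inner_le_norm _ _).trans
      (mul_le_mul (hG x hx) (hrs x hx) (norm_nonneg _) ha)
  set b := c * (c * a) * M.hT T with hb
  have hb0 : 0 ≤ b := by positivity
  have hr : ∀ x ∈ B, |pval r x - pval r x₀| ≤ b := fun x hx =>
    abs_pval_sub_le hgrad hx (by positivity)
  set m : Poly d := MvPolynomial.C (pval r x₀) with hm
  -- Subtracting the constant `m` and testing the projection with q - m, itself a polynomial of
  -- degree at most k.
  have hq : ∀ x ∈ B, ‖pval (q - m) x‖ ≤ c * (c * b) := by
    have hqm : q - m ∈ ElemPoly d k := Submodule.sub_mem _ h.elem_mem (C_mem_elemPoly _ _)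
    refine norm_le_of_sq_le (W := M.hT T ^ d) (I := ∫ y in T.1, pval (q - m) y ^ 2)
      (by positivity) hc0 (by positivity) (fun x hx => ?_) fun s hs hrs => ?_
    · rw [Real.norm_eq_abs, sq_abs]
      exact hT.elem.sup_sq_le _ (elemPoly_mono (Nat.le_succ k) hqm) x hx
    have h1 : ∫ y in T.1, pval (q - m) y ^ 2 = ∫ y in T.1, (pval r y - pval r x₀) * pval (q - m) y := by
      rw [← sub_eq_zero, ← h.elem _ hqm, ← integral_sub
        (integrable_on_elem T (f := fun y => pval (q - m) y ^ 2) ((continuous_pval (q - m)).pow 2))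
        (integrable_on_elem T (f := fun y => (pval r y - pval r x₀) * pval (q - m) y)
          (((continuous_pval r).sub continuous_const).mul (continuous_pval _)))]
      refine integral_congr_ae (Eventually.of_forall fun x => ?_)
      simp only [pval_sub, hm, pval_C]
      ring
    rw [h1]
    refine (le_abs_self _).trans ((hT.elem.integral_le (a := b * s) (by positivity) ?_).trans_eq
      (by ring))
    filter_upwards [hT.elem.ae_mem] with x hx
    rw [abs_mul]
    exact mul_le_mul (hr x hx) (hrs x hx) (abs_nonneg _) hb0
  obtain ⟨n, hn, hun⟩ := exists_eq_pval_of_mem_facePoly h.face_mem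
  have hu : ∀ x ∈ F.1, ‖pval (n - m) x‖ ≤ c * (c * b) := by
    have hcF := hT.face F hF
    have hnm : n - m ∈ ElemPoly d k := Submodule.sub_mem _ hn (C_mem_elemPoly _ _)
    refine norm_le_of_sq_le (W := M.hT T ^ (d - 1)) (I := ∫ y, pval (n - m) y ^ 2 ∂(surf F.1))
      (by positivity) hc0 (by positivity) (fun x hx => ?_) fun s hs hrs => ?_
    · rw [Real.norm_eq_abs, sq_abs]
      exact hcF.sup_sq_le _ (elemPoly_mono (Nat.le_succ k) hnm) x hx
    have h1 : ∫ y, pval (n - m) y ^ 2 ∂(surf F.1) =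
        ∫ y, (pval r y - pval r x₀) * pval (n - m) y ∂(surf F.1) := by
      rw [← sub_eq_zero, ← h.face (restrictTo F.1 (n - m)) ⟨_, hnm, rfl⟩, ← integral_sub
        (hcF.integrable (f := fun y => pval (n - m) y ^ 2) ((continuous_pval (n - m)).pow 2))
        (hcF.integrable (f := fun y => (pval r y - pval r x₀) * pval (n - m) y)
          (((continuous_pval r).sub continuous_const).mul (continuous_pval _)))]
      refine integral_congr_ae (hcF.ae_mem.mono fun x hx => ?_)
      change _ = (u x - pval r x) * F.1.indicator (pval (n - m)) x
      rw [hun, Set.indicator_of_mem hx, Set.indicator_of_mem hx]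
      simp only [pval_sub, hm, pval_C]
      ring
    rw [h1]
    refine (le_abs_self _).trans ((hcF.integral_le (a := b * s) (by positivity) ?_).trans_eq
      (by ring))
    filter_upwards [hcF.ae_mem] with x hx
    rw [abs_mul]
    exact mul_le_mul (hr x (hT.face_subset F hF hx)) (hrs x hx) (abs_nonneg _) hb0
  intro x hx
  have h1 := hu x hx
  have h2 := hq x (hT.face_subset F hF hx)
  have h3 : u x - pval q x = pval (n - m) x - pval (q - m) x := by
    rw [hun, Set.indicator_of_mem hx, pval_sub, pval_sub]; ring
  rw [h3]
  refine (abs_sub _ _).trans ((add_le_add h1 h2).trans_eq ?_)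
  rw [hb]; ring

end Residual

end HHO

/-! ### Local equivalence of the hybrid norm and the reconstruction norm -/

namespace HHO

variable {d : ℕ} {Ω : Set (E d)} {M : PolytopalMesh d Ω} {k : ℕ} {p c : ℝ} {T : M.elems} {x₀ : E d}

/-- The discrete `L^p` norm, to the power `p`, of a vector polynomial on `T` and of functions on
the faces of `T`. -/
noncomputable def pairNorm (p : ℝ) (T : M.elems) (Q : Fin d → Poly d) (g : M.faces → E d → ℝ) :
    ℝ :=
  (∫ x in T.1, ‖vval Q x‖ ^ p) + M.hT T * ∑ F ∈ M.facesOf T, ∫ x, |g F x| ^ p ∂(surf F.1)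

/-- Pointwise bound of a vector polynomial and of functions on the faces of `T`. -/
def SupLE (T : M.elems) (x₀ : E d) (Q : Fin d → Poly d) (g : M.faces → E d → ℝ) (a : ℝ) : Prop :=
  (∀ x ∈ Metric.closedBall x₀ (M.hT T), ‖vval Q x‖ ≤ a) ∧
    ∀ F ∈ M.facesOf T, ∀ x ∈ F.1, |g F x| ≤ a

lemma hT_nonneg (T : M.elems) : 0 ≤ M.hT T := Metric.diam_nonneg

lemma pairNorm_nonneg (Q : Fin d → Poly d) (g : M.faces → E d → ℝ) : 0 ≤ pairNorm p T Q g :=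
  add_nonneg (integral_nonneg fun x => by positivity)
    (mul_nonneg (hT_nonneg T) (Finset.sum_nonneg fun F _ => integral_nonneg fun x => by positivity))

lemma mul_pow_pred {h : ℝ} (hd : 1 ≤ d) : h * h ^ (d - 1) = h ^ d := by
  rw [← pow_succ', Nat.sub_add_cancel hd]

section

variable (hT : ElemControl M (k + 1) p c T x₀) (hd : 1 ≤ d) (hc : 1 ≤ c) (hp : 1 ≤ p)
include hT

lemma exists_residual (hd : 1 ≤ d) (v : Space M k) {F : M.faces} (hF : F ∈ M.facesOf T) :
    ∃ (u : E d → ℝ) (q : Poly d), IsResidual k T.1 F.1 (gradRec v T) (potRec v T) u q ∧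
      ∀ x ∈ F.1, M.hT T * bdryRes v T F x = u x - pval q x - jump v T F x := by
  have hh := M.hT_pos hd T
  obtain ⟨m, hm, hvm⟩ := exists_eq_pval_of_mem_facePoly (facePart_mem v F)
  have hr := potRec_spec (T := T) v
  have hE := projElem_spec (M.isOpen_elem T) (M.isBounded_elem T) (M.nonempty_elem T) k
    (f := fun y => pval (potRec v T) y - pval (elemPart v T) y)
    ((continuous_pval _).sub (continuous_pval _))
  have hP := projFace_spec (hT.face F hF) (by positivity) (Nat.le_succ k)
    (f := fun y => pval (potRec v T) y - facePart v F y)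
    (g := fun y => pval (potRec v T) y - pval m y)
    ((continuous_pval _).sub (continuous_pval _))
    (fun x hx => by rw [hvm, Set.indicator_of_mem hx])
  -- Projections fix v_F and v_T, so adding these back to the projected differences gives the
  -- projections of r itself; the residual then splits into (u - q) minus the jump.
  refine ⟨projFace k F.1 (fun y => pval (potRec v T) y - facePart v F y) + facePart v F,
    projElem k T.1 (fun y => pval (potRec v T) y - pval (elemPart v T) y) + elemPart v T,
    ⟨hr.1, Submodule.add_mem _ hP.1 (facePart_mem v F), Submodule.add_mem _ hE.1 (elemPart_mem v T),
      hr.2, fun w hw => ?_, fun w hw => ?_⟩, fun x hx => ?_⟩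
  · rw [← hE.2 w hw]
    refine integral_congr_ae (Eventually.of_forall fun x => ?_)
    simp only [pval_add]
    ring
  · rw [← hP.2 w hw]
    refine integral_congr_ae (Eventually.of_forall fun x => ?_)
    simp only [Pi.add_apply]
    ring
  · rw [bdryRes, ← mul_assoc, mul_one_div_cancel hh.ne', one_mul, jump, pval_add, Pi.add_apply]
    ring

/-- On F the residual is a polynomial of degree at most k, so the inverse inequality on F applies to
it. -/
lemma exists_bdryRes_eq (hd : 1 ≤ d) (v : Space M k) {F : M.faces} (hF : F ∈ M.facesOf T) :
    ∃ n ∈ ElemPoly d k, ∀ x ∈ F.1, bdryRes v T F x = pval n x := by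
  have hh := M.hT_pos hd T
  obtain ⟨u, q, hu, h⟩ := exists_residual hT hd v hF
  obtain ⟨m, hm, hum⟩ := exists_eq_pval_of_mem_facePoly hu.face_mem
  obtain ⟨j, hj, hvj⟩ := exists_jump_eq v T F
  refine ⟨(M.hT T)⁻¹ • (m - q - j), Submodule.smul_mem _ _ (Submodule.sub_mem _
    (Submodule.sub_mem _ hm hu.elem_mem) hj), fun x hx => ?_⟩
  have h1 := h x hx
  rw [hum, Set.indicator_of_mem hx, hvj x hx] at h1
  rw [pval_smul, pval_sub, pval_sub, ← h1, inv_mul_cancel_left₀ hh.ne']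

include hd hc in
lemma abs_hT_mul_bdryRes_add_jump_le (v : Space M k) {a : ℝ} (ha : 0 ≤ a)
    (hG : ∀ x ∈ Metric.closedBall x₀ (M.hT T), ‖vval (gradRec v T) x‖ ≤ a) {F : M.faces}
    (hF : F ∈ M.facesOf T) {x : E d} (hx : x ∈ F.1) :
    |M.hT T * bdryRes v T F x + jump v T F x| ≤ 2 * c ^ 4 * M.hT T * a := by
  obtain ⟨u, q, hu, h⟩ := exists_residual hT hd v hF
  rw [h x hx, sub_add_cancel]
  exact hu.abs_sub_le hT hd hc hF ha hG x hx

include hd hc in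
lemma bdryRes_sub (v w : Space M k) {F : M.faces} (hF : F ∈ M.facesOf T) {x : E d}
    (hx : x ∈ F.1) : bdryRes (v - w) T F x = bdryRes v T F x - bdryRes w T F x := by
  have hh := M.hT_pos hd T
  obtain ⟨u₁, q₁, hu₁, h₁⟩ := exists_residual hT hd v hF
  obtain ⟨u₂, q₂, hu₂, h₂⟩ := exists_residual hT hd w hF
  obtain ⟨u, q, hu, h⟩ := exists_residual hT hd (v - w) hF
  -- Linearity of `gradRec` makes the combined residual data correspond to G = 0, and the bound with
  -- a = 0 forces u - q to be linear. Linearity of the potential itself is not needed.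
  have h3 := (hu.sub hT hF (hu₁.sub hT hF hu₂)).abs_sub_le hT hd hc hF le_rfl
    (fun y _ => by rw [gradRec_sub hT, sub_self, vval_zero, norm_zero]) x hx
  rw [mul_zero] at h3
  have h4 := abs_nonpos_iff.1 h3
  have e := h x hx
  have e₁ := h₁ x hx
  have e₂ := h₂ x hx
  have e₃ := jump_sub v w T F x
  simp only [Pi.sub_apply, pval_sub] at h4
  have : M.hT T * bdryRes (v - w) T F x = M.hT T * (bdryRes v T F x - bdryRes w T F x) := by
    linarith
  exact mul_left_cancel₀ hh.ne' this

-- Shared by both directions of the equivalence. A face integral scales like h_T · h_T^(d-1) =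
-- h_T^d, as the volume term does, and the number of faces is at most c.
include hd hc in
lemma abs_functional_le {P Q : Fin d → Poly d} {g : M.faces → E d → ℝ} {a s : ℝ} (ha : 0 ≤ a)
    (hs : 0 ≤ s) (hP : ∀ x ∈ Metric.closedBall x₀ (M.hT T), ‖vval P x‖ ≤ a)
    (hg : ∀ F ∈ M.facesOf T, ∀ x ∈ F.1, |g F x| ≤ M.hT T * a)
    (hQ : ∀ x ∈ Metric.closedBall x₀ (M.hT T), ‖vval Q x‖ ≤ s) :
    |∫ x in T.1, (inner ℝ (vval P x) (vval Q x) : ℝ)| +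
      |∑ F ∈ M.facesOf T, ∫ x, g F x * inner ℝ (vval Q x) (M.normal T F) ∂(surf F.1)| ≤
        2 * c ^ 2 * a * M.hT T ^ d * s := by
  have hh := M.hT_pos hd T
  have h1 : |∫ x in T.1, (inner ℝ (vval P x) (vval Q x) : ℝ)| ≤ a * s * (c * M.hT T ^ d) := by
    refine hT.elem.integral_le (by positivity) ?_
    filter_upwards [hT.elem.ae_mem] with x hx
    exact (abs_real_inner_le_norm _ _).trans (mul_le_mul (hP x hx) (hQ x hx) (norm_nonneg _) ha)
  have h2 : ∀ F ∈ M.facesOf T, |∫ x, g F x * inner ℝ (vval Q x) (M.normal T F) ∂(surf F.1)| ≤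
      M.hT T * a * s * (c * M.hT T ^ (d - 1)) := fun F hF => by
    refine (hT.face F hF).integral_le (by positivity) ?_
    filter_upwards [(hT.face F hF).ae_mem] with x hx
    rw [abs_mul]
    refine mul_le_mul (hg F hF x hx) ?_ (abs_nonneg _) (by positivity)
    calc _ ≤ ‖vval Q x‖ * ‖M.normal T F‖ := abs_real_inner_le_norm _ _
      _ ≤ s * 1 := mul_le_mul (hQ x (hT.face_subset F hF hx)) (norm_normal_le T F)
        (norm_nonneg _) hs
      _ = s := mul_one s
  have h3 : |∑ F ∈ M.facesOf T, ∫ x, g F x * inner ℝ (vval Q x) (M.normal T F) ∂(surf F.1)| ≤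
      c ^ 2 * a * M.hT T ^ d * s := by
    refine (Finset.abs_sum_le_sum_abs _ _).trans ((Finset.sum_le_sum h2).trans ?_)
    rw [Finset.sum_const, nsmul_eq_mul]
    calc _ ≤ c * (M.hT T * a * s * (c * M.hT T ^ (d - 1))) :=
          mul_le_mul_of_nonneg_right hT.card_le (by positivity)
      _ = c ^ 2 * a * (M.hT T * M.hT T ^ (d - 1)) * s := by ring
      _ = _ := by rw [mul_pow_pred hd]
  have h4 : a * s * (c * M.hT T ^ d) ≤ c ^ 2 * a * M.hT T ^ d * s := by
    have : c ≤ c ^ 2 := by nlinarith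
    calc _ = c * (a * M.hT T ^ d * s) := by ring
      _ ≤ c ^ 2 * (a * M.hT T ^ d * s) := by gcongr
      _ = _ := by ring
  linarith

include hd hc in
lemma norm_gradRec_le (v : Space M k) {a : ℝ} (ha : 0 ≤ a)
    (hv : ∀ x ∈ Metric.closedBall x₀ (M.hT T), ‖vval (grad (elemPart v T)) x‖ ≤ a)
    (hj : ∀ F ∈ M.facesOf T, ∀ x ∈ F.1, |jump v T F x| ≤ M.hT T * a) :
    ∀ x ∈ Metric.closedBall x₀ (M.hT T), ‖vval (gradRec v T) x‖ ≤ c * (2 * c ^ 2 * a) := by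
  have hh := M.hT_pos hd T
  have hG := gradRec_spec hT v
  refine norm_le_of_sq_le (W := M.hT T ^ d) (by positivity) (by linarith) (by positivity)
    (hT.elem.vval_sq_le fun i => elemPoly_mono (Nat.le_succ k) (hG.1 i)) fun s hs hQ => ?_
  -- The reconstruction is tested with itself.
  rw [hG.2 _ hG.1]
  exact (add_le_add (le_abs_self _) (le_abs_self _)).trans
    (abs_functional_le hT hd hc ha hs hv hj hQ)

omit hT in
lemma grad_elemPart_mem (v : Space M k) (T : M.elems) (i : Fin d) :
    grad (elemPart v T) i ∈ ElemPoly d k :=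
  grad_mem_elemPoly (elemPoly_mono (Nat.le_succ k) (elemPart_mem v T)) i

include hd hc in
lemma norm_grad_elemPart_le (v : Space M k) {a : ℝ} (ha : 0 ≤ a)
    (hG : ∀ x ∈ Metric.closedBall x₀ (M.hT T), ‖vval (gradRec v T) x‖ ≤ a)
    (hj : ∀ F ∈ M.facesOf T, ∀ x ∈ F.1, |jump v T F x| ≤ M.hT T * a) :
    ∀ x ∈ Metric.closedBall x₀ (M.hT T),
      ‖vval (grad (elemPart v T)) x‖ ≤ c * (2 * c ^ 2 * a) := by
  have hh := M.hT_pos hd T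
  have hm : ∀ i, grad (elemPart v T) i ∈ ElemPoly d k := grad_elemPart_mem v T
  refine norm_le_of_sq_le (W := M.hT T ^ d) (by positivity) (by linarith) (by positivity)
    (hT.elem.vval_sq_le fun i => elemPoly_mono (Nat.le_succ k) (hm i)) fun s hs hQ => ?_
  -- The same equation tested with ∇v_T, solved for the volume term in ∇v_T.
  have h1 := (gradRec_spec hT v).2 _ hm
  have h2 := abs_functional_le hT hd hc ha hs hG hj hQ
  rw [← sub_eq_iff_eq_add] at h1
  rw [← h1]
  exact (le_abs_self _).trans ((abs_sub _ _).trans h2)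

/-- Pointwise bound of the reconstructions by the gradient and the scaled jumps. -/
lemma SupLE.gradRec (hd : 1 ≤ d) (hc : 1 ≤ c) (v : Space M k) {a : ℝ} (ha : 0 ≤ a)
    (h : SupLE T x₀ (grad (elemPart v T)) (fun F x => jump v T F x / M.hT T) a) :
    SupLE T x₀ (gradRec v T) (bdryRes v T) (5 * c ^ 7 * a) := by
  have hh := M.hT_pos hd T
  have hj : ∀ F ∈ M.facesOf T, ∀ x ∈ F.1, |jump v T F x| ≤ M.hT T * a := fun F hF x hx => by
    have := h.2 F hF x hx
    rwa [abs_div, abs_of_pos hh, div_le_iff₀ hh, mul_comm] at this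
  have hG := norm_gradRec_le hT hd hc v ha h.1 hj
  have h37 : c ^ 3 ≤ c ^ 7 := pow_le_pow_right₀ hc (by norm_num)
  have h7 : 1 ≤ c ^ 7 := one_le_pow₀ hc
  refine ⟨fun x hx => (hG x hx).trans ?_, fun F hF x hx => ?_⟩
  · calc c * (2 * c ^ 2 * a) = 2 * c ^ 3 * a := by ring
      _ ≤ 5 * c ^ 7 * a := by gcongr; norm_num
  · have h1 := abs_hT_mul_bdryRes_add_jump_le hT hd hc v (by positivity) hG hF hx
    have h2 := hj F hF x hx
    have h3 : |M.hT T * bdryRes v T F x| ≤ M.hT T * (5 * c ^ 7 * a) := by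
      calc |M.hT T * bdryRes v T F x| =
            |M.hT T * bdryRes v T F x + jump v T F x - jump v T F x| := by rw [add_sub_cancel_right]
        _ ≤ 2 * c ^ 4 * M.hT T * (c * (2 * c ^ 2 * a)) + M.hT T * a :=
          (abs_sub _ _).trans (add_le_add h1 h2)
        _ = M.hT T * (4 * c ^ 7 * a + 1 * a) := by ring
        _ ≤ M.hT T * (4 * c ^ 7 * a + c ^ 7 * a) := by gcongr
        _ = _ := by ring
    rw [abs_mul, abs_of_pos hh] at h3
    exact le_of_mul_le_mul_left h3 hh

/-- The residual and G_T first bound the jumps by 3 c⁴ h_T a; testing with ∇v_T then multiplies 3 c⁴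
a by 2 c³, which gives 6 c⁷. -/
lemma SupLE.grad_elemPart (hd : 1 ≤ d) (hc : 1 ≤ c) (v : Space M k) {a : ℝ} (ha : 0 ≤ a)
    (h : SupLE T x₀ (HHO.gradRec v T) (bdryRes v T) a) :
    SupLE T x₀ (grad (elemPart v T)) (fun F x => jump v T F x / M.hT T) (6 * c ^ 7 * a) := by
  have hh := M.hT_pos hd T
  have h4 : 1 ≤ c ^ 4 := one_le_pow₀ hc
  have h47 : c ^ 4 ≤ c ^ 7 := pow_le_pow_right₀ hc (by norm_num)
  have hj : ∀ F ∈ M.facesOf T, ∀ x ∈ F.1, |jump v T F x| ≤ M.hT T * (3 * c ^ 4 * a) :=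
    fun F hF x hx => by
    have h1 := abs_hT_mul_bdryRes_add_jump_le hT hd hc v ha h.1 hF hx
    have h2 := h.2 F hF x hx
    calc |jump v T F x| =
          |M.hT T * bdryRes v T F x + jump v T F x - M.hT T * bdryRes v T F x| := by
            rw [add_sub_cancel_left]
      _ ≤ 2 * c ^ 4 * M.hT T * a + M.hT T * a := by
        refine (abs_sub _ _).trans (add_le_add h1 ?_)
        rw [abs_mul, abs_of_pos hh]
        gcongr
      _ = M.hT T * (2 * c ^ 4 * a + 1 * a) := by ring
      _ ≤ M.hT T * (2 * c ^ 4 * a + c ^ 4 * a) := by gcongr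
      _ = _ := by ring
  have h3a : a ≤ 3 * c ^ 4 * a := by nlinarith
  have hG := norm_grad_elemPart_le hT hd hc v (by positivity)
    (fun x hx => (h.1 x hx).trans h3a) hj
  refine ⟨fun x hx => (hG x hx).trans_eq (by ring), fun F hF x hx => ?_⟩
  rw [abs_div, abs_of_pos hh, div_le_iff₀ hh, mul_comm]
  refine (hj F hF x hx).trans ?_
  gcongr
  norm_num

include hd hc hp in
lemma SupLE.of_pairNorm {Q : Fin d → Poly d} {g : M.faces → E d → ℝ}
    (hQ : ∀ i, Q i ∈ ElemPoly d k)
    (hg : ∀ F ∈ M.facesOf T, ∃ n ∈ ElemPoly d k, ∀ x ∈ F.1, g F x = pval n x) {a : ℝ}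
    (ha : 0 ≤ a) (h : (d : ℝ) ^ p * c * pairNorm p T Q g ≤ M.hT T ^ d * a ^ p) :
    SupLE T x₀ Q g a := by
  have hh := M.hT_pos hd T
  have hp0 : 0 < p := by linarith
  have hd1 : (1 : ℝ) ≤ d := by exact_mod_cast hd
  have hdp : (1 : ℝ) ≤ (d : ℝ) ^ p := Real.one_le_rpow hd1 hp0.le
  have hfn : ∀ F, 0 ≤ ∫ x, |g F x| ^ p ∂(surf F.1) := fun F =>
    integral_nonneg fun x => by positivity
  refine ⟨fun x hx => ?_, fun F hF x hx => ?_⟩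
  · have h1 := hT.elem.vval_rpow_le hd (by positivity) (by linarith) hp
      (fun i => elemPoly_mono (Nat.le_succ k) (hQ i)) x hx
    have h2 : ∫ x in T.1, ‖vval Q x‖ ^ p ≤ pairNorm p T Q g :=
      le_add_of_nonneg_right (mul_nonneg hh.le (Finset.sum_nonneg fun F _ => hfn F))
    have h3 : M.hT T ^ d * ‖vval Q x‖ ^ p ≤ M.hT T ^ d * a ^ p :=
      h1.trans ((mul_le_mul_of_nonneg_left h2 (by positivity)).trans h)
    have h4 := le_of_mul_le_mul_left h3 (by positivity)
    exact (Real.rpow_le_rpow_iff (norm_nonneg _) ha hp0).1 h4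
  · obtain ⟨n, hn, hgn⟩ := hg F hF
    have h1 := (hT.face F hF).sup_rpow_le n (elemPoly_mono (Nat.le_succ k) hn) x hx
    have h2 : ∫ y, |pval n y| ^ p ∂(surf F.1) = ∫ y, |g F y| ^ p ∂(surf F.1) :=
      integral_congr_ae ((hT.face F hF).ae_mem.mono fun y hy => by simp only [hgn y hy])
    rw [h2, ← hgn x hx] at h1
    have h3 : M.hT T * ∫ y, |g F y| ^ p ∂(surf F.1) ≤ pairNorm p T Q g := by
      have := Finset.single_le_sum (fun F _ => hfn F) hF
      exact (mul_le_mul_of_nonneg_left this hh.le).trans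
        (le_add_of_nonneg_left (integral_nonneg fun x => by positivity))
    have h4 : M.hT T ^ d * |g F x| ^ p ≤ M.hT T ^ d * a ^ p := by
      calc M.hT T ^ d * |g F x| ^ p = M.hT T * (M.hT T ^ (d - 1) * |g F x| ^ p) := by
            rw [← mul_assoc, mul_pow_pred hd]
        _ ≤ M.hT T * (c * ∫ y, |g F y| ^ p ∂(surf F.1)) := by gcongr
        _ = 1 * c * (M.hT T * ∫ y, |g F y| ^ p ∂(surf F.1)) := by ring
        _ ≤ (d : ℝ) ^ p * c * pairNorm p T Q g :=
          mul_le_mul (by gcongr) h3 (mul_nonneg hh.le (hfn F)) (by positivity)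
        _ ≤ _ := h
    exact (Real.rpow_le_rpow_iff (abs_nonneg _) ha hp0).1 (le_of_mul_le_mul_left h4 (by positivity))

include hd hc hp in
lemma SupLE.pairNorm_le {Q : Fin d → Poly d} {g : M.faces → E d → ℝ} {a : ℝ} (ha : 0 ≤ a)
    (h : SupLE T x₀ Q g a) : pairNorm p T Q g ≤ 2 * c ^ 2 * (M.hT T ^ d * a ^ p) := by
  have hh := M.hT_pos hd T
  have hp0 : 0 ≤ p := by linarith
  have h1 : ∫ x in T.1, ‖vval Q x‖ ^ p ≤ a ^ p * (c * M.hT T ^ d) := by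
    refine (le_abs_self _).trans (hT.elem.integral_le (by positivity) ?_)
    filter_upwards [hT.elem.ae_mem] with x hx
    rw [abs_of_nonneg (by positivity)]
    exact Real.rpow_le_rpow (norm_nonneg _) (h.1 x hx) hp0
  have h2 : ∀ F ∈ M.facesOf T, ∫ x, |g F x| ^ p ∂(surf F.1) ≤ a ^ p * (c * M.hT T ^ (d - 1)) :=
    fun F hF => by
    refine (le_abs_self _).trans ((hT.face F hF).integral_le (by positivity) ?_)
    filter_upwards [(hT.face F hF).ae_mem] with x hx
    rw [abs_of_nonneg (by positivity)]
    exact Real.rpow_le_rpow (abs_nonneg _) (h.2 F hF x hx) hp0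
  have h3 : M.hT T * ∑ F ∈ M.facesOf T, ∫ x, |g F x| ^ p ∂(surf F.1) ≤
      c ^ 2 * (M.hT T ^ d * a ^ p) := by
    calc _ ≤ M.hT T * ∑ _F ∈ M.facesOf T, a ^ p * (c * M.hT T ^ (d - 1)) :=
          mul_le_mul_of_nonneg_left (Finset.sum_le_sum h2) hh.le
      _ = (M.facesOf T).card * (M.hT T * (a ^ p * (c * M.hT T ^ (d - 1)))) := by
        rw [Finset.sum_const, nsmul_eq_mul]; ring
      _ ≤ c * (M.hT T * (a ^ p * (c * M.hT T ^ (d - 1)))) :=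
        mul_le_mul_of_nonneg_right hT.card_le (by positivity)
      _ = c ^ 2 * ((M.hT T * M.hT T ^ (d - 1)) * a ^ p) := by ring
      _ = _ := by rw [mul_pow_pred hd]
  have h4 : a ^ p * (c * M.hT T ^ d) ≤ c ^ 2 * (M.hT T ^ d * a ^ p) := by
    have : c ≤ c ^ 2 := by nlinarith
    calc _ = c * (M.hT T ^ d * a ^ p) := by ring
      _ ≤ _ := by gcongr
  unfold pairNorm
  linarith

-- Transfers a comparison of suprema to a comparison of L^p norms, by passing to the supremum and
-- back.
include hd hc hp in
lemma pairNorm_le_of_supLE {Q Q' : Fin d → Poly d} {g g' : M.faces → E d → ℝ} {K : ℝ} (hK : 0 ≤ K)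
    (hQ : ∀ i, Q i ∈ ElemPoly d k)
    (hg : ∀ F ∈ M.facesOf T, ∃ n ∈ ElemPoly d k, ∀ x ∈ F.1, g F x = pval n x)
    (h : ∀ a, 0 ≤ a → SupLE T x₀ Q g a → SupLE T x₀ Q' g' (K * a)) :
    pairNorm p T Q' g' ≤ 2 * c ^ 3 * K ^ p * (d : ℝ) ^ p * pairNorm p T Q g := by
  have hh := M.hT_pos hd T
  have hp0 : 0 < p := by linarith
  have hN := pairNorm_nonneg (p := p) (T := T) Q g
  set N := pairNorm p T Q g with hNdef
  -- The value of a for which the bound required by `SupLE.of_pairNorm` is an equality.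
  set a := ((d : ℝ) ^ p * c * N / M.hT T ^ d) ^ p⁻¹ with ha
  have ha0 : 0 ≤ a := by positivity
  have hap : M.hT T ^ d * a ^ p = (d : ℝ) ^ p * c * N := by
    rw [ha, Real.rpow_inv_rpow (by positivity) hp0.ne', mul_div_cancel₀ _ (by positivity)]
  have h1 := (h a ha0 (SupLE.of_pairNorm hT hd hc hp hQ hg ha0 hap.ge)).pairNorm_le hT hd hc hp
    (by positivity)
  refine h1.trans_eq ?_
  rw [Real.mul_rpow hK ha0]
  calc _ = 2 * c ^ 2 * K ^ p * (M.hT T ^ d * a ^ p) := by ring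
    _ = _ := by rw [hap]; ring

end

lemma normL_rpow {V : Type*} [NormedAddCommGroup V] (hp : p ≠ 0) (f : E d → V)
    (μ : Measure (E d)) : normL p f μ ^ p = ∫ x, ‖f x‖ ^ p ∂μ := by
  rw [normL, one_div, Real.rpow_inv_rpow (integral_nonneg fun x => by positivity) hp]

lemma hF_nonneg (T : M.elems) (F : M.faces) : 0 ≤ M.hF T F := by
  unfold PolytopalMesh.hF
  split_ifs
  · exact hT_nonneg T
  · exact Metric.diam_nonneg

lemma localNorm_rpow (hp : p ≠ 0) (v : Space M k) (T : M.elems) :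
    localNorm p v T ^ p = (∫ x in T.1, ‖vval (grad (elemPart v T)) x‖ ^ p) +
      ∑ F ∈ M.facesOf T, M.hF T F ^ (1 - p) * ∫ x, |jump v T F x| ^ p ∂(surf F.1) := by
  have h1 : normL p (vval (grad (elemPart v T))) (volume.restrict T.1) ^ p +
      ∑ F ∈ M.facesOf T, M.hF T F ^ (1 - p) *
        normL p (fun x => facePart v F x - pval (elemPart v T) x) (surf F.1) ^ p =
      (∫ x in T.1, ‖vval (grad (elemPart v T)) x‖ ^ p) +
      ∑ F ∈ M.facesOf T, M.hF T F ^ (1 - p) * ∫ x, |jump v T F x| ^ p ∂(surf F.1) := by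
    simp only [normL_rpow hp]
    rfl
  rw [localNorm, h1, one_div, Real.rpow_inv_rpow _ hp]
  refine add_nonneg (integral_nonneg fun x => by positivity) (Finset.sum_nonneg fun F _ => ?_)
  exact mul_nonneg (Real.rpow_nonneg (hF_nonneg T F) _) (integral_nonneg fun x => by positivity)

section

variable (hT : ElemControl M (k + 1) p c T x₀) (hd : 1 ≤ d) (hc : 1 ≤ c) (hp : 1 ≤ p)
include hT hd hc hp

omit hT hc hp in
lemma hT_mul_integral_jump_div (v : Space M k) (F : M.faces) :
    M.hT T * ∫ x, |jump v T F x / M.hT T| ^ p ∂(surf F.1) =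
      M.hT T ^ (1 - p) * ∫ x, |jump v T F x| ^ p ∂(surf F.1) := by
  have hh := M.hT_pos hd T
  have h1 : ∀ x, |jump v T F x / M.hT T| ^ p = (M.hT T ^ p)⁻¹ * |jump v T F x| ^ p := fun x => by
    rw [abs_div, abs_of_pos hh, Real.div_rpow (abs_nonneg _) hh.le]; ring
  simp_rw [h1]
  rw [integral_const_mul, ← mul_assoc, Real.rpow_sub hh, Real.rpow_one, div_eq_mul_inv]

lemma pairNorm_le_localNorm (v : Space M k) :
    pairNorm p T (grad (elemPart v T)) (fun F x => jump v T F x / M.hT T) ≤ localNorm p v T ^ p := by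
  have hh := M.hT_pos hd T
  rw [localNorm_rpow (by linarith), pairNorm, Finset.mul_sum]
  refine add_le_add le_rfl (Finset.sum_le_sum fun F hF => ?_)
  rw [hT_mul_integral_jump_div hd]
  refine mul_le_mul_of_nonneg_right ?_ (integral_nonneg fun x => by positivity)
  -- The exponent 1 - p is negative, so monotonicity of the power needs a positive h_F.
  have h1 : 0 < M.hF T F := by
    have := hT.hT_le F hF
    by_contra hcon
    nlinarith
  exact Real.rpow_le_rpow_of_nonpos h1 (PolytopalMesh.hF_le_hT hF) (by linarith)

lemma localNorm_le_pairNorm (v : Space M k) :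
    localNorm p v T ^ p ≤
      c ^ (p - 1) * pairNorm p T (grad (elemPart v T)) (fun F x => jump v T F x / M.hT T) := by
  have hh := M.hT_pos hd T
  have hc1 : 1 ≤ c ^ (p - 1) := Real.one_le_rpow hc (by linarith)
  rw [localNorm_rpow (by linarith), pairNorm, mul_add, Finset.mul_sum, Finset.mul_sum]
  refine add_le_add (le_mul_of_one_le_left (integral_nonneg fun x => by positivity) hc1)
    (Finset.sum_le_sum fun F hF => ?_)
  rw [hT_mul_integral_jump_div hd, ← mul_assoc]
  refine mul_le_mul_of_nonneg_right ?_ (integral_nonneg fun x => by positivity)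
  have h1 := hT.hT_le F hF
  have h2 : M.hT T / c ≤ M.hF T F := by rwa [div_le_iff₀' (by linarith)]
  refine (Real.rpow_le_rpow_of_nonpos (by positivity) h2 (by linarith)).trans_eq ?_
  rw [Real.div_rpow hh.le (by linarith), div_eq_inv_mul, ← Real.rpow_neg (by linarith), neg_sub]

theorem pairNorm_gradRec_le (v : Space M k) :
    pairNorm p T (gradRec v T) (bdryRes v T) ≤
      2 * c ^ 3 * (5 * c ^ 7) ^ p * (d : ℝ) ^ p * localNorm p v T ^ p := by
  have hg : ∀ F ∈ M.facesOf T, ∃ n ∈ ElemPoly d k, ∀ x ∈ F.1,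
      jump v T F x / M.hT T = pval n x := fun F hF => by
    obtain ⟨q, hq, h⟩ := exists_jump_eq v T F
    refine ⟨(M.hT T)⁻¹ • q, Submodule.smul_mem _ _ hq, fun x hx => ?_⟩
    rw [h x hx, pval_smul, div_eq_inv_mul]
  refine (pairNorm_le_of_supLE hT hd hc hp (K := 5 * c ^ 7) (by positivity)
    (grad_elemPart_mem v T) hg fun a ha h => h.gradRec hT hd hc v ha).trans ?_
  exact mul_le_mul_of_nonneg_left (pairNorm_le_localNorm hT hd hc hp v) (by positivity)

theorem localNorm_le_pairNorm_gradRec (v : Space M k) :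
    localNorm p v T ^ p ≤ c ^ (p - 1) * (2 * c ^ 3 * (6 * c ^ 7) ^ p * (d : ℝ) ^ p) *
      pairNorm p T (gradRec v T) (bdryRes v T) := by
  refine (localNorm_le_pairNorm hT hd hc hp v).trans ?_
  rw [mul_assoc]
  refine mul_le_mul_of_nonneg_left ?_ (by positivity)
  exact pairNorm_le_of_supLE hT hd hc hp (K := 6 * c ^ 7) (by positivity)
    (gradRec_spec hT v).1 (fun F hF => exists_bdryRes_eq hT hd v hF)
    fun a ha h => h.grad_elemPart hT hd hc v ha

end

end HHO

/-! ### Strongly monotone fluxes: from pointwise to integral estimates -/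

namespace HHO

variable {d : ℕ}

/-- The pointwise form of the strong monotonicity, linearized by the weighted inequality of
arithmetic and geometric means. -/
lemma rpow_le_of_sq_le {p e D Y x₀ d₀ : ℝ} (hp : 1 ≤ p) (hp2 : p ≤ 2) (he : 0 ≤ e) (hD : 0 ≤ D)
    (hDe : D = 0 → e = 0) (hY : D ^ ((p - 2) / p) * e ^ 2 ≤ Y) (hx₀ : 0 < x₀) (hd₀ : 0 < d₀) :
    e ^ p ≤ x₀ ^ (p / 2) * d₀ ^ (1 - p / 2) * (p / 2 / x₀ * Y + (1 - p / 2) / d₀ * D) := by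
  have hp0 : 0 < p := by linarith
  have hY0 : 0 ≤ Y := (mul_nonneg (Real.rpow_nonneg hD _) (sq_nonneg e)).trans hY
  have h2 : 0 ≤ 1 - p / 2 := by linarith
  -- At D = 0 the power D^((p-2)/p) carries no information: for p < 2 its value in Lean is 0. The
  -- case is settled by `hDe`.
  rcases hD.eq_or_lt with h0 | h0
  · rw [hDe h0.symm, Real.zero_rpow hp0.ne']
    positivity
  · have h1 : e ^ 2 ≤ Y * D ^ ((2 - p) / p) := by
      have h3 : D ^ ((p - 2) / p) * D ^ ((2 - p) / p) = 1 := by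
        rw [← Real.rpow_add h0, ← add_div]
        simp
      calc e ^ 2 = D ^ ((p - 2) / p) * e ^ 2 * D ^ ((2 - p) / p) := by
            rw [mul_right_comm, h3, one_mul]
        _ ≤ _ := by gcongr
    have h4 : e ^ p ≤ Y ^ (p / 2) * D ^ (1 - p / 2) := by
      calc e ^ p = (e ^ 2) ^ (p / 2) := by
            rw [← Real.rpow_natCast_mul he]
            congr 1
            push_cast
            ring
        _ ≤ (Y * D ^ ((2 - p) / p)) ^ (p / 2) := by gcongr
        _ = _ := by
          rw [Real.mul_rpow hY0 (by positivity), ← Real.rpow_mul hD]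
          congr 2
          field_simp
    have h5 := Real.geom_mean_le_arith_mean2_weighted (show 0 ≤ p / 2 by positivity) h2
      (div_nonneg hY0 hx₀.le) (div_nonneg hD hd₀.le) (by ring)
    rw [Real.div_rpow hY0 hx₀.le, Real.div_rpow hD hd₀.le, div_mul_div_comm,
      div_le_iff₀ (by positivity)] at h5
    refine h4.trans (h5.trans_eq ?_)
    ring

/-- A strongly monotone Hölder-continuous Carathéodory map with degeneracy function `δ`. -/
structure IsFlux {V : Type*} [NormedAddCommGroup V] [InnerProductSpace ℝ V] (μ : Measure (E d))
    (p : ℝ) (σ : E d → V → V) (δ : E d → ℝ) (C s : ℝ) : Prop where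
  hc_nonneg : 0 ≤ C
  sm_pos : 0 < s
  integrable : Integrable (fun x => δ x ^ p) μ
  nonneg : ∀ᵐ x ∂μ, 0 ≤ δ x
  zero : ∀ᵐ x ∂μ, σ x 0 = 0
  measurable : ∀ ξ, AEStronglyMeasurable (fun x => σ x ξ) μ
  continuity : ∀ᵐ x ∂μ, ∀ τ η,
    ‖σ x τ - σ x η‖ ≤ C * (δ x ^ p + ‖τ‖ ^ p + ‖η‖ ^ p) ^ ((p - 2) / p) * ‖τ - η‖
  monotonicity : ∀ᵐ x ∂μ, ∀ τ η,
    s * (δ x ^ p + ‖τ‖ ^ p + ‖η‖ ^ p) ^ ((p - 2) / p) * ‖τ - η‖ ^ 2 ≤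
      inner ℝ (σ x τ - σ x η) (τ - η)

namespace IsFlux

variable {V : Type*} [NormedAddCommGroup V] [InnerProductSpace ℝ V] {μ : Measure (E d)} {p : ℝ}
  {σ : E d → V → V} {δ : E d → ℝ} {C s : ℝ} (hσ : IsFlux μ p σ δ C s) (hp : 1 < p) (hp2 : p ≤ 2)
include hσ hp hp2

/-- The larger of ‖τ‖ and ‖η‖ is at least ‖τ - η‖ / 2, and the exponent (p-2)/p is nonpositive, so
the singular weight is at most 2 ‖τ - η‖^(p-2). The estimate serves measurability and integrability
only; its constant does not reach the final bound. -/
lemma holder : ∀ᵐ x ∂μ, ∀ τ η, ‖σ x τ - σ x η‖ ≤ C * 2 * ‖τ - η‖ ^ (p - 1) := by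
  filter_upwards [hσ.continuity, hσ.nonneg] with x hx hδ τ η
  have hp0 : 0 < p := by linarith
  rcases eq_or_ne τ η with rfl | hne
  · rw [sub_self, norm_zero, sub_self, norm_zero, Real.zero_rpow (by linarith), mul_zero]
  have hn : 0 < ‖τ - η‖ := norm_pos_iff.2 (sub_ne_zero.2 hne)
  have h1 : (‖τ - η‖ / 2) ^ p ≤ δ x ^ p + ‖τ‖ ^ p + ‖η‖ ^ p := by
    have hδp : 0 ≤ δ x ^ p := Real.rpow_nonneg hδ p
    have h2 := norm_sub_le τ η
    rcases le_total ‖τ‖ ‖η‖ with h | h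
    · have : (‖τ - η‖ / 2) ^ p ≤ ‖η‖ ^ p := by gcongr; linarith
      have : 0 ≤ ‖τ‖ ^ p := by positivity
      linarith
    · have : (‖τ - η‖ / 2) ^ p ≤ ‖τ‖ ^ p := by gcongr; linarith
      have : 0 ≤ ‖η‖ ^ p := by positivity
      linarith
  have h2 : (δ x ^ p + ‖τ‖ ^ p + ‖η‖ ^ p) ^ ((p - 2) / p) ≤ 2 * ‖τ - η‖ ^ (p - 2) := by
    calc _ ≤ ((‖τ - η‖ / 2) ^ p) ^ ((p - 2) / p) :=
          Real.rpow_le_rpow_of_nonpos (by positivity) h1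
            (div_nonpos_of_nonpos_of_nonneg (by linarith) hp0.le)
      _ = (2 : ℝ) ^ (2 - p) * ‖τ - η‖ ^ (p - 2) := by
        rw [← Real.rpow_mul (by positivity), mul_div_cancel₀ _ hp0.ne',
          Real.div_rpow hn.le (by norm_num), div_eq_inv_mul, ← Real.rpow_neg (by norm_num), neg_sub]
      _ ≤ 2 * ‖τ - η‖ ^ (p - 2) := by
        gcongr
        calc (2 : ℝ) ^ (2 - p) ≤ 2 ^ (1 : ℝ) :=
              Real.rpow_le_rpow_of_exponent_le (by norm_num) (by linarith)
          _ = 2 := Real.rpow_one 2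
  have hC := hσ.hc_nonneg
  calc _ ≤ C * (δ x ^ p + ‖τ‖ ^ p + ‖η‖ ^ p) ^ ((p - 2) / p) * ‖τ - η‖ := hx τ η
    _ ≤ C * (2 * ‖τ - η‖ ^ (p - 2)) * ‖τ - η‖ := by gcongr
    _ = C * 2 * (‖τ - η‖ ^ (p - 2) * ‖τ - η‖ ^ (1 : ℝ)) := by rw [Real.rpow_one]; ring
    _ = _ := by
      rw [← Real.rpow_add hn]
      congr 2
      ring

/-- The Carathéodory argument: only the sections σ(·, ξ) are measurable by assumption. Along simple
approximations of A the composition is measurable piece by piece, and Hölder continuity passes to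
the limit. -/
lemma aestronglyMeasurable_comp {A : E d → V} (hA : Continuous A) :
    AEStronglyMeasurable (fun x => σ x (A x)) μ := by
  have hAm : StronglyMeasurable A := hA.stronglyMeasurable
  refine aestronglyMeasurable_of_tendsto_ae atTop (f := fun n x => σ x (hAm.approx n x))
    (fun n => ?_) ?_
  · have hu : (⋃ y : (hAm.approx n).range, (hAm.approx n) ⁻¹' {y.1}) = Set.univ :=
      Set.eq_univ_of_forall fun x => Set.mem_iUnion.2
        ⟨⟨hAm.approx n x, SimpleFunc.mem_range_self _ x⟩, rfl⟩
    rw [← Measure.restrict_univ (μ := μ), ← hu, aestronglyMeasurable_iUnion_iff]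
    intro y
    refine ((hσ.measurable y.1).mono_measure Measure.restrict_le_self).congr ?_
    filter_upwards [ae_restrict_mem ((hAm.approx n).measurableSet_fiber y.1)] with x hx
    rw [show hAm.approx n x = y.1 from hx]
  · filter_upwards [hσ.holder hp hp2] with x hx
    rw [tendsto_iff_norm_sub_tendsto_zero]
    have h1 : Tendsto (fun n => ‖hAm.approx n x - A x‖) atTop (𝓝 0) :=
      tendsto_iff_norm_sub_tendsto_zero.1 (hAm.tendsto_approx x)
    have h2 : Tendsto (fun n => C * 2 * ‖hAm.approx n x - A x‖ ^ (p - 1)) atTop (𝓝 0) := by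
      have := (h1.rpow_const (p := p - 1) (Or.inr (by linarith))).const_mul (C * 2)
      rwa [Real.zero_rpow (by linarith), mul_zero] at this
    exact squeeze_zero (fun n => norm_nonneg _) (fun n => hx _ _) h2

variable [IsFiniteMeasure μ] {B : Set (E d)} (hB : Bornology.IsBounded B) (hμ : ∀ᵐ x ∂μ, x ∈ B)
include hB hμ

lemma integrable_inner {A H : E d → V} (hA : Continuous A) (hH : Continuous H) :
    Integrable (fun x => (inner ℝ (σ x (A x)) (H x) : ℝ)) μ := by
  obtain ⟨a, ha⟩ := hB.isCompact_closure.exists_bound_of_continuousOn hA.continuousOn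
  obtain ⟨b, hb⟩ := hB.isCompact_closure.exists_bound_of_continuousOn hH.continuousOn
  have hC := hσ.hc_nonneg
  refine Integrable.of_bound ((hσ.aestronglyMeasurable_comp hp hp2 hA).inner
    hH.aestronglyMeasurable) (C * 2 * a ^ (p - 1) * b) ?_
  filter_upwards [hσ.holder hp hp2, hσ.zero, hμ] with x hx h0 hxB
  have h1 := hx (A x) 0
  have hAx := ha x (subset_closure hxB)
  rw [h0, sub_zero, sub_zero] at h1
  have h2 : C * 2 * ‖A x‖ ^ (p - 1) ≤ C * 2 * a ^ (p - 1) := by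
    have : 0 ≤ p - 1 := by linarith
    gcongr
  exact (norm_inner_le_norm _ _).trans (mul_le_mul (h1.trans h2) (hb x (subset_closure hxB))
    (norm_nonneg _) ((norm_nonneg _).trans (h1.trans h2)))

omit hp hp2 [IsFiniteMeasure μ] hB hμ in
lemma inner_sub_nonneg : ∀ᵐ x ∂μ, ∀ τ η : V, (0 : ℝ) ≤ inner ℝ (σ x τ - σ x η) (τ - η) := by
  filter_upwards [hσ.monotonicity, hσ.nonneg] with x hx hδ τ η
  have hs := hσ.sm_pos
  have : 0 ≤ δ x ^ p := Real.rpow_nonneg hδ p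
  exact (by positivity : (0 : ℝ) ≤
    s * (δ x ^ p + ‖τ‖ ^ p + ‖η‖ ^ p) ^ ((p - 2) / p) * ‖τ - η‖ ^ 2).trans (hx τ η)

/-- The parameters `x₀` and `d₀` are kept free, so that the same pair can be used on all elements
and faces before summation. -/
lemma integral_rpow_le {A₁ A₂ : E d → V} (h₁ : Continuous A₁) (h₂ : Continuous A₂)
    {x₀ d₀ : ℝ} (hx₀ : 0 < x₀) (hd₀ : 0 < d₀) :
    ∫ x, ‖A₁ x - A₂ x‖ ^ p ∂μ ≤ x₀ ^ (p / 2) * d₀ ^ (1 - p / 2) *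
      (p / 2 / x₀ * (s⁻¹ * ∫ x, (inner ℝ (σ x (A₁ x) - σ x (A₂ x)) (A₁ x - A₂ x) : ℝ) ∂μ) +
        (1 - p / 2) / d₀ *
          (∫ x, δ x ^ p ∂μ + ∫ x, ‖A₁ x‖ ^ p ∂μ + ∫ x, ‖A₂ x‖ ^ p ∂μ)) := by
  have hp0 : 0 < p := by linarith
  have hs := hσ.sm_pos
  have hrp : ∀ {f : E d → V}, Continuous f → Integrable (fun x => ‖f x‖ ^ p) μ := fun hf =>
    integrable_of_continuous hB hμ (hf.norm.rpow_const fun _ => Or.inr hp0.le)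
  have hi : Integrable (fun x => (inner ℝ (σ x (A₁ x) - σ x (A₂ x)) (A₁ x - A₂ x) : ℝ)) μ := by
    simp_rw [inner_sub_left]
    exact (hσ.integrable_inner hp hp2 hB hμ h₁ (h₁.sub h₂)).sub
      (hσ.integrable_inner hp hp2 hB hμ h₂ (h₁.sub h₂))
  have hD : Integrable (fun x => δ x ^ p + ‖A₁ x‖ ^ p + ‖A₂ x‖ ^ p) μ :=
    (hσ.integrable.add (hrp h₁)).add (hrp h₂)
  have hDint : ∫ x, δ x ^ p ∂μ + ∫ x, ‖A₁ x‖ ^ p ∂μ + ∫ x, ‖A₂ x‖ ^ p ∂μ =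
      ∫ x, (δ x ^ p + ‖A₁ x‖ ^ p + ‖A₂ x‖ ^ p) ∂μ := by
    rw [integral_add (f := fun x => δ x ^ p + ‖A₁ x‖ ^ p) (hσ.integrable.add (hrp h₁)) (hrp h₂),
      integral_add hσ.integrable (hrp h₁)]
  rw [hDint, ← integral_const_mul, ← integral_const_mul, ← integral_const_mul,
    ← integral_add ((hi.const_mul _).const_mul _) (hD.const_mul _), ← integral_const_mul]
  refine integral_mono_ae (hrp (h₁.sub h₂)) ((((hi.const_mul _).const_mul _).add
    (hD.const_mul _)).const_mul _) ?_
  filter_upwards [hσ.monotonicity, hσ.nonneg] with x hx hδ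
  have hδp : 0 ≤ δ x ^ p := Real.rpow_nonneg hδ p
  refine rpow_le_of_sq_le hp.le hp2 (norm_nonneg _) (by positivity) (fun h0 => ?_) ?_ hx₀ hd₀
  · have e1 : 0 ≤ ‖A₁ x‖ ^ p := by positivity
    have e2 : 0 ≤ ‖A₂ x‖ ^ p := by positivity
    have h3 : ‖A₁ x‖ = 0 := (Real.rpow_eq_zero (norm_nonneg _) hp0.ne').1 (by linarith)
    have h4 : ‖A₂ x‖ = 0 := (Real.rpow_eq_zero (norm_nonneg _) hp0.ne').1 (by linarith)
    rw [norm_eq_zero.1 h3, norm_eq_zero.1 h4, sub_self, norm_zero]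
  · rw [inv_mul_eq_div, le_div_iff₀ hs]
    refine le_trans (le_of_eq ?_) (hx (A₁ x) (A₂ x))
    ring

end IsFlux

lemma integrable_rpow_of_memLp {p : ℝ} (hp : 0 < p) {μ : Measure (E d)} {δ : E d → ℝ}
    (h : MemLp δ (ENNReal.ofReal p) μ) (h0 : ∀ᵐ x ∂μ, 0 ≤ δ x) :
    Integrable (fun x => δ x ^ p) μ := by
  have := h.integrable_norm_rpow (by simpa using hp) ENNReal.ofReal_ne_top
  rw [ENNReal.toReal_ofReal hp.le] at this
  exact this.congr (h0.mono fun x hx => by simp only [Real.norm_of_nonneg hx])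

lemma FluxAssumption.isFlux {Ω T : Set (E d)} {p : ℝ} (hp : 0 < p) {σ : E d → E d → E d}
    {δ : E d → ℝ} {σhc σsm : ℝ} (h : FluxAssumption Ω p σ δ σhc σsm) (hT : T ⊆ Ω) :
    IsFlux (volume.restrict T) p σ δ σhc σsm := by
  have hle : (volume : Measure (E d)).restrict T ≤ volume.restrict Ω :=
    Measure.restrict_mono_set _ hT
  have hae : ∀ {P : E d → Prop}, (∀ᵐ x ∂(volume.restrict Ω), P x) →
      ∀ᵐ x ∂(volume.restrict T), P x := fun h => ae_mono hle h
  exact ⟨h.hc_pos.le, h.sm_pos,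
    (integrable_rpow_of_memLp hp h.degeneracy_memLp h.degeneracy_nonneg).mono_measure hle,
    hae h.degeneracy_nonneg, hae h.zero,
    fun ξ => ((h.measurable ξ).mono_measure hle).aestronglyMeasurable,
    hae h.continuity, hae h.monotonicity⟩

lemma StabAssumption.isFlux {Ω : Set (E d)} {M : PolytopalMesh d Ω} {p : ℝ} (hp : 0 < p)
    {S : M.elems → E d → ℝ → ℝ} {ζ : E d → ℝ} {chc csm σhc σsm : ℝ}
    (h : StabAssumption M p S ζ chc csm σhc σsm) (hchc : 0 ≤ chc) (hcsm : 0 < csm)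
    (hσhc : 0 ≤ σhc) (hσsm : 0 < σsm) {T : M.elems} {F : M.faces} (hF : F ∈ M.facesOf T) :
    IsFlux (surf F.1) p (S T) ζ (chc * σhc) (csm * σsm) where
  hc_nonneg := by positivity
  sm_pos := by positivity
  integrable := integrable_rpow_of_memLp hp (h.degeneracy_memLp F) (h.degeneracy_nonneg F)
  nonneg := h.degeneracy_nonneg F
  zero := h.zero T F hF
  measurable ξ := (h.measurable T F hF ξ).aestronglyMeasurable
  continuity := by
    filter_upwards [h.continuity T F hF] with x hx τ η
    refine (hx η τ).trans_eq ?_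
    simp only [Real.norm_eq_abs]
    ring
  monotonicity := by
    filter_upwards [h.monotonicity T F hF] with x hx τ η
    refine le_trans (le_of_eq ?_) ((hx η τ).trans_eq ?_)
    · simp only [Real.norm_eq_abs]
      ring
    · simp [mul_comm]

end HHO

/-! ### Local gaps, summation over the mesh and optimization -/

namespace HHO

variable {d : ℕ} {Ω : Set (E d)} {M : PolytopalMesh d Ω} {k : ℕ} {p c : ℝ} {T : M.elems} {x₀ : E d}

/-- The contribution of the flux in `T` to `a_h(v, v - w) - a_h(w, v - w)`. -/
noncomputable def elemGap (σ : E d → E d → E d) (v w : Space M k) (T : M.elems) : ℝ :=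
  ∫ x in T.1, inner ℝ (σ x (vval (gradRec v T) x) - σ x (vval (gradRec w T) x))
    (vval (gradRec v T) x - vval (gradRec w T) x)

/-- The contribution of the stabilization on `F` to `a_h(v, v - w) - a_h(w, v - w)`. -/
noncomputable def faceGap (S : M.elems → E d → ℝ → ℝ) (v w : Space M k) (T : M.elems)
    (F : M.faces) : ℝ :=
  ∫ x, (S T x (bdryRes v T F x) - S T x (bdryRes w T F x)) *
    (bdryRes v T F x - bdryRes w T F x) ∂(surf F.1)

section Local

variable {σ : E d → E d → E d} {S : M.elems → E d → ℝ → ℝ} {δ ζ : E d → ℝ}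
  {σhc σsm chc csm : ℝ}

lemma isFiniteMeasure_elem (T : M.elems) : IsFiniteMeasure ((volume : Measure (E d)).restrict T.1) :=
  isFiniteMeasure_restrict (M.isOpen_elem T) (M.isBounded_elem T)

lemma elemGap_nonneg {s : ℝ} (hσ : IsFlux (volume.restrict T.1) p σ δ σhc s) (v w : Space M k) :
    0 ≤ elemGap σ v w T :=
  integral_nonneg_of_ae (hσ.inner_sub_nonneg.mono fun _ h => h _ _)

lemma faceGap_nonneg {F : M.faces} {s : ℝ} (hS : IsFlux (surf F.1) p (S T) ζ chc s)
    (v w : Space M k) : 0 ≤ faceGap S v w T F :=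
  integral_nonneg_of_ae (hS.inner_sub_nonneg.mono fun x h => by
    simpa [mul_comm] using h (bdryRes v T F x) (bdryRes w T F x))

variable (hT : ElemControl M (k + 1) p c T x₀) (hd : 1 ≤ d) (hc : 1 ≤ c) (hp : 1 < p) (hp2 : p ≤ 2)
include hT hp hp2

lemma integral_flux_sub {s : ℝ} (hσ : IsFlux (volume.restrict T.1) p σ δ σhc s)
    (v w : Space M k) :
    (∫ x in T.1, (inner ℝ (σ x (vval (gradRec v T) x)) (vval (gradRec (v - w) T) x) : ℝ)) -
      ∫ x in T.1, (inner ℝ (σ x (vval (gradRec w T) x)) (vval (gradRec (v - w) T) x) : ℝ) =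
    elemGap σ v w T := by
  have := isFiniteMeasure_elem T
  have hae : ∀ᵐ x ∂((volume : Measure (E d)).restrict T.1), x ∈ T.1 :=
    ae_restrict_mem (M.isOpen_elem T).measurableSet
  have hi := fun Q : Fin d → Poly d => hσ.integrable_inner hp hp2 (M.isBounded_elem T) hae
    (continuous_vval Q) (continuous_vval (gradRec (v - w) T))
  rw [← integral_sub (hi _) (hi _), elemGap]
  simp only [gradRec_sub hT, vval_sub, inner_sub_left]

include hd hc

lemma integral_stab_sub {s : ℝ} {F : M.faces} (hF : F ∈ M.facesOf T)
    (hS : IsFlux (surf F.1) p (S T) ζ chc s) (v w : Space M k) :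
    (∫ x, S T x (bdryRes v T F x) * bdryRes (v - w) T F x ∂(surf F.1)) -
      ∫ x, S T x (bdryRes w T F x) * bdryRes (v - w) T F x ∂(surf F.1) = faceGap S v w T F := by
  have hcF := hT.face F hF
  have := hcF.finite
  obtain ⟨e, -, he⟩ := exists_bdryRes_eq hT hd (v - w) hF
  have hi : ∀ u : Space M k, Integrable
      (fun x => S T x (bdryRes u T F x) * bdryRes (v - w) T F x) (surf F.1) := fun u => by
    obtain ⟨n, -, hn⟩ := exists_bdryRes_eq hT hd u hF
    refine (hS.integrable_inner hp hp2 hcF.bounded hcF.ae_mem (continuous_pval n)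
      (continuous_pval e)).congr ?_
    filter_upwards [hcF.ae_mem] with x hx
    rw [hn x hx, he x hx]
    simp [mul_comm]
  rw [← integral_sub (hi v) (hi w), faceGap]
  refine integral_congr_ae (hcF.ae_mem.mono fun x hx => ?_)
  simp only [bdryRes_sub hT hd hc v w hF hx]
  ring

/-- The volume estimate and h_T times the face estimates are added; for fixed X and D the bound is
linear in the gaps and in the degeneracy terms. -/
lemma pairNorm_sub_le {s t : ℝ} (hσ : IsFlux (volume.restrict T.1) p σ δ σhc s)
    (hS : ∀ F ∈ M.facesOf T, IsFlux (surf F.1) p (S T) ζ chc t) (v w : Space M k) {X D : ℝ}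
    (hX : 0 < X) (hD : 0 < D) :
    pairNorm p T (gradRec (v - w) T) (bdryRes (v - w) T) ≤ X ^ (p / 2) * D ^ (1 - p / 2) *
      (p / 2 / X * (s⁻¹ * elemGap σ v w T +
          M.hT T * ∑ F ∈ M.facesOf T, t⁻¹ * faceGap S v w T F) +
        (1 - p / 2) / D * ((∫ x in T.1, δ x ^ p) +
          M.hT T * ∑ F ∈ M.facesOf T, ∫ x, ζ x ^ p ∂(surf F.1) +
          pairNorm p T (gradRec v T) (bdryRes v T) + pairNorm p T (gradRec w T) (bdryRes w T))) := by
  have hh := M.hT_pos hd T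
  have := isFiniteMeasure_elem T
  have hae : ∀ᵐ x ∂((volume : Measure (E d)).restrict T.1), x ∈ T.1 :=
    ae_restrict_mem (M.isOpen_elem T).measurableSet
  have h1 := hσ.integral_rpow_le hp hp2 (M.isBounded_elem T) hae (continuous_vval (gradRec v T))
    (continuous_vval (gradRec w T)) hX hD
  have h1' : ∫ x in T.1, ‖vval (gradRec (v - w) T) x‖ ^ p =
      ∫ x in T.1, ‖vval (gradRec v T) x - vval (gradRec w T) x‖ ^ p := by
    simp only [gradRec_sub hT, vval_sub]
  have h2 : ∀ F ∈ M.facesOf T, ∫ x, |bdryRes (v - w) T F x| ^ p ∂(surf F.1) ≤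
      X ^ (p / 2) * D ^ (1 - p / 2) * (p / 2 / X * (t⁻¹ * faceGap S v w T F) +
        (1 - p / 2) / D * (∫ x, ζ x ^ p ∂(surf F.1) + ∫ x, |bdryRes v T F x| ^ p ∂(surf F.1) +
          ∫ x, |bdryRes w T F x| ^ p ∂(surf F.1))) := fun F hF => by
    have hcF := hT.face F hF
    have := hcF.finite
    obtain ⟨n, -, hn⟩ := exists_bdryRes_eq hT hd v hF
    obtain ⟨m, -, hm⟩ := exists_bdryRes_eq hT hd w hF
    have h3 := (hS F hF).integral_rpow_le hp hp2 hcF.bounded hcF.ae_mem (continuous_pval n)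
      (continuous_pval m) hX hD
    have e1 : ∫ x, |bdryRes (v - w) T F x| ^ p ∂(surf F.1) =
        ∫ x, ‖pval n x - pval m x‖ ^ p ∂(surf F.1) :=
      integral_congr_ae (hcF.ae_mem.mono fun x hx => by
        simp only [bdryRes_sub hT hd hc v w hF hx, hn x hx, hm x hx, Real.norm_eq_abs])
    have e2 : faceGap S v w T F = ∫ x, (inner ℝ (S T x (pval n x) - S T x (pval m x))
        (pval n x - pval m x) : ℝ) ∂(surf F.1) :=
      integral_congr_ae (hcF.ae_mem.mono fun x hx => by
        simp [hn x hx, hm x hx, mul_comm])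
    have e3 : ∫ x, |bdryRes v T F x| ^ p ∂(surf F.1) = ∫ x, ‖pval n x‖ ^ p ∂(surf F.1) :=
      integral_congr_ae (hcF.ae_mem.mono fun x hx => by simp only [hn x hx, Real.norm_eq_abs])
    have e4 : ∫ x, |bdryRes w T F x| ^ p ∂(surf F.1) = ∫ x, ‖pval m x‖ ^ p ∂(surf F.1) :=
      integral_congr_ae (hcF.ae_mem.mono fun x hx => by simp only [hm x hx, Real.norm_eq_abs])
    rw [e1, e2, e3, e4]
    exact h3
  have h4 := mul_le_mul_of_nonneg_left (Finset.sum_le_sum h2) hh.le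
  rw [← h1'] at h1
  have h5 := add_le_add h1 h4
  refine h5.trans_eq ?_
  rw [← Finset.mul_sum, Finset.sum_add_distrib, ← Finset.mul_sum, ← Finset.mul_sum,
    ← Finset.mul_sum, Finset.sum_add_distrib, Finset.sum_add_distrib]
  unfold pairNorm elemGap
  ring

end Local

lemma globalNorm_rpow (hp : p ≠ 0) (v : Space M k) :
    globalNorm p v ^ p = ∑ T : M.elems, localNorm p v T ^ p := by
  rw [globalNorm, one_div, Real.rpow_inv_rpow _ hp]
  refine Finset.sum_nonneg fun T _ => Real.rpow_nonneg ?_ _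
  refine Real.rpow_nonneg (add_nonneg ?_ (Finset.sum_nonneg fun F _ => mul_nonneg ?_ ?_)) _
  · exact Real.rpow_nonneg (Real.rpow_nonneg (integral_nonneg fun x => by positivity) _) _
  · exact Real.rpow_nonneg (hF_nonneg T F) _
  · exact Real.rpow_nonneg (Real.rpow_nonneg (integral_nonneg fun x => by positivity) _) _

lemma globalNorm_nonneg (v : Space M k) : 0 ≤ globalNorm p v := by
  refine Real.rpow_nonneg (Finset.sum_nonneg fun T _ => Real.rpow_nonneg ?_ _) _
  refine Real.rpow_nonneg (add_nonneg ?_ (Finset.sum_nonneg fun F _ => mul_nonneg ?_ ?_)) _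
  · exact Real.rpow_nonneg (Real.rpow_nonneg (integral_nonneg fun x => by positivity) _) _
  · exact Real.rpow_nonneg (hF_nonneg T F) _
  · exact Real.rpow_nonneg (Real.rpow_nonneg (integral_nonneg fun x => by positivity) _) _

lemma skeletonNorm_rpow (hp : p ≠ 0) {ζ : E d → ℝ}
    (hζ : ∀ F : M.faces, ∀ᵐ x ∂(surf F.1), 0 ≤ ζ x) :
    skeletonNorm M p ζ ^ p =
      ∑ T : M.elems, M.hT T * ∑ F ∈ M.facesOf T, ∫ x, ζ x ^ p ∂(surf F.1) := by
  have h1 : ∀ F : M.faces, normL p ζ (surf F.1) ^ p = ∫ x, ζ x ^ p ∂(surf F.1) := fun F => by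
    rw [normL_rpow hp]
    exact integral_congr_ae ((hζ F).mono fun x hx => by simp only [Real.norm_of_nonneg hx])
  simp only [skeletonNorm, h1]
  rw [one_div, Real.rpow_inv_rpow _ hp]
  exact Finset.sum_nonneg fun T _ => mul_nonneg (hT_nonneg T) (Finset.sum_nonneg fun F _ =>
    integral_nonneg_of_ae ((hζ F).mono fun x hx => Real.rpow_nonneg hx p))

lemma sum_integral_le (hΩ : IsPolytope Ω) {f : E d → ℝ} (hf : IntegrableOn f Ω)
    (h0 : ∀ᵐ x ∂(volume.restrict Ω), 0 ≤ f x) :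
    ∑ T : M.elems, ∫ x in T.1, f x ≤ ∫ x in Ω, f x := by
  have hsub : (⋃ T ∈ (Finset.univ : Finset M.elems), T.1) ⊆ Ω :=
    Set.iUnion₂_subset fun T _ => M.elem_subset hΩ T
  rw [← integral_biUnion_finset Finset.univ (fun T _ => (M.isOpen_elem T).measurableSet)
    (fun T _ T' _ hne => M.elem_disjoint T.1 T.2 T'.1 T'.2 fun h => hne (Subtype.ext h))
    (fun T _ => hf.mono_set (M.elem_subset hΩ T))]
  exact setIntegral_mono_set hf h0 hsub.eventuallyLE

/-- Optimizing a family of linear bounds. -/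
lemma le_rpow_mul_rpow {a L X D : ℝ} (ha : 0 ≤ a) (ha1 : a ≤ 1) (hX : 0 ≤ X) (hD : 0 ≤ D)
    (h : ∀ x y, 0 < x → 0 < y → L ≤ x ^ a * y ^ (1 - a) * (a / x * X + (1 - a) / y * D)) :
    L ≤ X ^ a * D ^ (1 - a) := by
  -- The optimal parameters are X and D themselves; they are shifted by ε because either may vanish.
  have h1 : ∀ ε : ℝ, 0 < ε → L ≤ (X + ε) ^ a * (D + ε) ^ (1 - a) := fun ε hε => by
    refine (h (X + ε) (D + ε) (by linarith) (by linarith)).trans ?_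
    refine mul_le_of_le_one_right (by positivity) ?_
    have e1 : a / (X + ε) * X ≤ a := by
      rw [div_mul_eq_mul_div, div_le_iff₀ (by linarith)]
      nlinarith
    have e2 : (1 - a) / (D + ε) * D ≤ 1 - a := by
      rw [div_mul_eq_mul_div, div_le_iff₀ (by linarith)]
      nlinarith
    linarith
  have hlim : Tendsto (fun ε : ℝ => (X + ε) ^ a * (D + ε) ^ (1 - a)) (𝓝[>] 0)
      (𝓝 (X ^ a * D ^ (1 - a))) := by
    have hadd : ∀ z : ℝ, Tendsto (fun ε : ℝ => z + ε) (𝓝[>] 0) (𝓝 z) := fun z => by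
      have : Tendsto (fun ε : ℝ => z + ε) (𝓝 0) (𝓝 (z + 0)) :=
        (continuous_const.add continuous_id).tendsto 0
      rw [add_zero] at this
      exact this.mono_left nhdsWithin_le_nhds
    exact ((hadd X).rpow_const (Or.inr ha)).mul ((hadd D).rpow_const (Or.inr (by linarith)))
  exact ge_of_tendsto hlim (by filter_upwards [self_mem_nhdsWithin] with ε hε using h1 ε hε)

end HHO

/-! ### The global estimate -/

theorem lemma1 (d k : ℕ) (hd : 1 ≤ d) (p : ℝ) (hp : p ∈ Set.Ioc (1 : ℝ) 2)
    (ρ : ℝ) (hρ : ρ ∈ Set.Ioo (0 : ℝ) 1) (csm : ℝ) (hcsm : 0 < csm) :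
    ∃ C : ℝ, 0 < C ∧
      ∀ (Ω : Set (HHO.E d)), HHO.IsPolytope Ω →
      ∀ (M : HHO.PolytopalMesh d Ω), M.IsRegular ρ →
      ∀ (σ : HHO.E d → HHO.E d → HHO.E d) (δ : HHO.E d → ℝ) (σhc σsm : ℝ),
        HHO.FluxAssumption Ω p σ δ σhc σsm →
      ∀ (S : M.elems → HHO.E d → ℝ → ℝ) (ζ : HHO.E d → ℝ) (chc : ℝ), 0 < chc →
        HHO.StabAssumption M p S ζ chc csm σhc σsm →
      ∀ v w : HHO.Space M k,
        HHO.globalNorm p (v - w) ^ 2 ≤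
          C * (σsm⁻¹ *
            (HHO.normL p δ (volume.restrict Ω) ^ p + HHO.skeletonNorm M p ζ ^ p +
              HHO.globalNorm p v ^ p + HHO.globalNorm p w ^ p) ^ ((2 - p) / p) *
            (HHO.diffusion σ S v (v - w) - HHO.diffusion σ S w (v - w))) := by
  open HHO in
  obtain ⟨hp1, hp2⟩ := hp
  have hp0 : 0 < p := by linarith
  obtain ⟨c, hc, hctl⟩ := exists_elemControl hd (k + 1) hp1.le hρ
  have hd1 : (1 : ℝ) ≤ d := by exact_mod_cast hd
  -- Both equivalence constants are fixed before Ω and the mesh. The bound 1 ≤ C₁ lets C₁ also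
  -- absorb the norms of δ and ζ.
  obtain ⟨C₁, hC₁, hup⟩ : ∃ C₁ : ℝ, 1 ≤ C₁ ∧ ∀ (Ω : Set (E d)) (M : PolytopalMesh d Ω),
      M.IsRegular ρ → ∀ (T : M.elems) (v : Space M k),
        pairNorm p T (gradRec v T) (bdryRes v T) ≤ C₁ * localNorm p v T ^ p := by
    refine ⟨2 * c ^ 3 * (5 * c ^ 7) ^ p * (d : ℝ) ^ p, ?_, fun Ω M hM T v => ?_⟩
    · have h1 : 1 ≤ c ^ 3 := one_le_pow₀ hc
      have h2 : 1 ≤ c ^ 7 := one_le_pow₀ hc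
      have h3 : 1 ≤ (5 * c ^ 7) ^ p := Real.one_le_rpow (by linarith) hp0.le
      have h4 : (1 : ℝ) ≤ (d : ℝ) ^ p := Real.one_le_rpow hd1 hp0.le
      have h5 : 1 ≤ 2 * c ^ 3 := by linarith
      exact one_le_mul_of_one_le_of_one_le (one_le_mul_of_one_le_of_one_le h5 h3) h4
    · obtain ⟨x₀, hT⟩ := hctl Ω M hM T
      exact pairNorm_gradRec_le hT hd hc hp1.le v
  obtain ⟨C₂, hC₂, hlow⟩ : ∃ C₂ : ℝ, 0 < C₂ ∧ ∀ (Ω : Set (E d)) (M : PolytopalMesh d Ω),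
      M.IsRegular ρ → ∀ (T : M.elems) (v : Space M k),
        localNorm p v T ^ p ≤ C₂ * pairNorm p T (gradRec v T) (bdryRes v T) := by
    refine ⟨c ^ (p - 1) * (2 * c ^ 3 * (6 * c ^ 7) ^ p * (d : ℝ) ^ p), by positivity,
      fun Ω M hM T v => ?_⟩
    obtain ⟨x₀, hT⟩ := hctl Ω M hM T
    exact localNorm_le_pairNorm_gradRec hT hd hc hp1.le v
  -- The flux gaps enter with weight 1 and the stabilization gaps with weight csm⁻¹; κ dominates
  -- both.
  set κ := 1 + csm⁻¹ with hκ
  have hκ0 : 0 < κ := by positivity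
  refine ⟨C₂ ^ (2 / p) * κ * C₁ ^ ((2 - p) / p), by positivity,
    fun Ω hΩ M hM σ δ σhc σsm hσ S ζ chc hchc hS v w => ?_⟩
  have hσsm := hσ.sm_pos
  have hσT : ∀ T : M.elems, IsFlux (volume.restrict T.1) p σ δ σhc σsm := fun T =>
    hσ.isFlux hp0 (M.elem_subset hΩ T)
  have hSF : ∀ T : M.elems, ∀ F ∈ M.facesOf T,
      IsFlux (surf F.1) p (S T) ζ (chc * σhc) (csm * σsm) := fun T F hF =>
    hS.isFlux hp0 hchc.le hcsm hσ.hc_pos.le hσsm hF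
  have hGT : ∀ T, 0 ≤ elemGap σ v w T := fun T => elemGap_nonneg (hσT T) v w
  have hGF : ∀ T, ∀ F ∈ M.facesOf T, 0 ≤ faceGap S v w T F := fun T F hF =>
    faceGap_nonneg (hSF T F hF) v w
  have hGF' : ∀ T, 0 ≤ M.hT T * ∑ F ∈ M.facesOf T, faceGap S v w T F := fun T =>
    mul_nonneg (hT_nonneg T) (Finset.sum_nonneg (hGF T))
  have hdiff : diffusion σ S v (v - w) - diffusion σ S w (v - w) =
      ∑ T : M.elems, (elemGap σ v w T + M.hT T * ∑ F ∈ M.facesOf T, faceGap S v w T F) := by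
    unfold diffusion
    rw [← Finset.sum_sub_distrib]
    refine Finset.sum_congr rfl fun T _ => ?_
    obtain ⟨x₀, hT⟩ := hctl Ω M hM T
    rw [← integral_flux_sub hT hp1 hp2 (hσT T) v w,
      ← Finset.sum_congr rfl fun F hF => integral_stab_sub hT hd hc hp1 hp2 hF (hSF T F hF) v w,
      Finset.sum_sub_distrib, stab, stab]
    ring
  set G := diffusion σ S v (v - w) - diffusion σ S w (v - w) with hG
  have hG0 : 0 ≤ G := by
    rw [hdiff]
    exact Finset.sum_nonneg fun T _ => add_nonneg (hGT T) (hGF' T)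
  set X := ∑ T : M.elems, (σsm⁻¹ * elemGap σ v w T +
    M.hT T * ∑ F ∈ M.facesOf T, (csm * σsm)⁻¹ * faceGap S v w T F) with hX
  have hX0 : 0 ≤ X := Finset.sum_nonneg fun T _ => add_nonneg
    (mul_nonneg (inv_nonneg.2 hσsm.le) (hGT T)) (mul_nonneg (hT_nonneg T)
      (Finset.sum_nonneg fun F hF => mul_nonneg (by positivity) (hGF T F hF)))
  have hXG : X ≤ κ * σsm⁻¹ * G := by
    rw [hdiff, Finset.mul_sum]
    refine Finset.sum_le_sum fun T _ => ?_
    rw [← Finset.mul_sum, mul_inv, hκ]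
    have h1 := hGT T
    have h2 := hGF' T
    have h3 : 0 ≤ σsm⁻¹ := inv_nonneg.2 hσsm.le
    have h4 : 0 ≤ csm⁻¹ := inv_nonneg.2 hcsm.le
    have h5 := mul_nonneg (mul_nonneg h4 h3) h1
    have h6 := mul_nonneg h3 h2
    nlinarith
  set N := normL p δ (volume.restrict Ω) ^ p + skeletonNorm M p ζ ^ p + globalNorm p v ^ p +
    globalNorm p w ^ p with hN
  set D := ∑ T : M.elems, ((∫ x in T.1, δ x ^ p) +
    M.hT T * ∑ F ∈ M.facesOf T, ∫ x, ζ x ^ p ∂(surf F.1) +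
    pairNorm p T (gradRec v T) (bdryRes v T) + pairNorm p T (gradRec w T) (bdryRes w T)) with hD
  have hζ0 : ∀ T : M.elems, 0 ≤ M.hT T * ∑ F ∈ M.facesOf T, ∫ x, ζ x ^ p ∂(surf F.1) := fun T =>
    mul_nonneg (hT_nonneg T) (Finset.sum_nonneg fun F hF =>
      integral_nonneg_of_ae ((hS.degeneracy_nonneg F).mono fun x hx => Real.rpow_nonneg hx p))
  have hD0 : 0 ≤ D := Finset.sum_nonneg fun T _ => add_nonneg (add_nonneg (add_nonneg
    (integral_nonneg_of_ae ((hσT T).nonneg.mono fun x hx => Real.rpow_nonneg hx p)) (hζ0 T))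
    (pairNorm_nonneg _ _)) (pairNorm_nonneg _ _)
  have hδ : normL p δ (volume.restrict Ω) ^ p = ∫ x in Ω, δ x ^ p := by
    rw [normL_rpow hp0.ne']
    exact integral_congr_ae (hσ.degeneracy_nonneg.mono fun x hx => by
      simp only [Real.norm_of_nonneg hx])
  have hδ0 : 0 ≤ normL p δ (volume.restrict Ω) ^ p := by
    rw [normL_rpow hp0.ne']
    exact integral_nonneg fun x => by positivity
  have hζN := skeletonNorm_rpow (M := M) hp0.ne' hS.degeneracy_nonneg
  have hζN0 : 0 ≤ skeletonNorm M p ζ ^ p := by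
    rw [hζN]
    exact Finset.sum_nonneg fun T _ => hζ0 T
  have hN0 : 0 ≤ N := add_nonneg (add_nonneg (add_nonneg hδ0 hζN0)
    (Real.rpow_nonneg (globalNorm_nonneg v) _)) (Real.rpow_nonneg (globalNorm_nonneg w) _)
  have hDN : D ≤ C₁ * N := by
    have h1 : ∑ T : M.elems, ∫ x in T.1, δ x ^ p ≤ normL p δ (volume.restrict Ω) ^ p := by
      rw [hδ]
      exact sum_integral_le hΩ
        (integrable_rpow_of_memLp hp0 hσ.degeneracy_memLp hσ.degeneracy_nonneg)
        (hσ.degeneracy_nonneg.mono fun x hx => Real.rpow_nonneg hx p)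
    have h2 : ∀ u : Space M k, ∑ T : M.elems, pairNorm p T (gradRec u T) (bdryRes u T) ≤
        C₁ * globalNorm p u ^ p := fun u => by
      rw [globalNorm_rpow hp0.ne', Finset.mul_sum]
      exact Finset.sum_le_sum fun T _ => hup Ω M hM T u
    have h3 := h2 v
    have h4 := h2 w
    rw [hD, Finset.sum_add_distrib, Finset.sum_add_distrib, Finset.sum_add_distrib, ← hζN, hN]
    have h5 := le_mul_of_one_le_left hδ0 hC₁
    have h6 := le_mul_of_one_le_left hζN0 hC₁
    rw [mul_add, mul_add, mul_add]
    linarith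
  have hL : ∑ T : M.elems, pairNorm p T (gradRec (v - w) T) (bdryRes (v - w) T) ≤
      X ^ (p / 2) * D ^ (1 - p / 2) := by
    -- For each fixed x and y the local bounds are summed, and only then are the parameters
    -- optimized; this plays the part of Hölder's inequality for integrals and sums together.
    refine le_rpow_mul_rpow (by positivity) (by linarith) hX0 hD0 fun x y hx hy => ?_
    rw [hX, hD, Finset.mul_sum, Finset.mul_sum, ← Finset.sum_add_distrib, Finset.mul_sum]
    refine Finset.sum_le_sum fun T _ => ?_
    obtain ⟨x₀, hT⟩ := hctl Ω M hM T
    exact pairNorm_sub_le hT hd hc hp1 hp2 (hσT T) (hSF T) v w hx hy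
  have hE : globalNorm p (v - w) ^ p ≤
      C₂ * ((κ * σsm⁻¹ * G) ^ (p / 2) * (C₁ * N) ^ (1 - p / 2)) := by
    rw [globalNorm_rpow hp0.ne']
    have h0 : 0 ≤ 1 - p / 2 := by linarith
    calc _ ≤ ∑ T : M.elems, C₂ * pairNorm p T (gradRec (v - w) T) (bdryRes (v - w) T) :=
          Finset.sum_le_sum fun T _ => hlow Ω M hM T (v - w)
      _ = C₂ * ∑ T : M.elems, pairNorm p T (gradRec (v - w) T) (bdryRes (v - w) T) := by
        rw [Finset.mul_sum]
      _ ≤ C₂ * (X ^ (p / 2) * D ^ (1 - p / 2)) := by gcongr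
      _ ≤ _ := by gcongr
  have hA0 : 0 ≤ κ * σsm⁻¹ * G := hX0.trans hXG
  have hC₁0 : 0 ≤ C₁ := by linarith
  have hCN : 0 ≤ C₁ * N := mul_nonneg hC₁0 hN0
  -- The power 2/p turns the exponent p/2 into 1 and the exponent 1 - p/2 into (2 - p)/p.
  calc globalNorm p (v - w) ^ 2 = (globalNorm p (v - w) ^ p) ^ (2 / p) := by
        rw [← Real.rpow_mul (globalNorm_nonneg _), mul_div_cancel₀ _ hp0.ne', Real.rpow_two]
    _ ≤ (C₂ * ((κ * σsm⁻¹ * G) ^ (p / 2) * (C₁ * N) ^ (1 - p / 2))) ^ (2 / p) :=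
      Real.rpow_le_rpow (Real.rpow_nonneg (globalNorm_nonneg _) _) hE (by positivity)
    _ = C₂ ^ (2 / p) * (κ * σsm⁻¹ * G * (C₁ ^ ((2 - p) / p) * N ^ ((2 - p) / p))) := by
      rw [Real.mul_rpow hC₂.le (by positivity), Real.mul_rpow (by positivity) (by positivity),
        ← Real.rpow_mul hA0, ← Real.rpow_mul hCN, ← Real.mul_rpow hC₁0 hN0]
      have e1 : p / 2 * (2 / p) = 1 := by field_simp
      have e2 : (1 - p / 2) * (2 / p) = (2 - p) / p := by field_simp
      rw [e1, e2, Real.rpow_one]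
    _ = _ := by ring
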